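/- Let $d\ge 1$, $\Omega=[0,1]^d$, $p\in\,]1,2]$ and $\Psi(x)=|x|^{p-2}x$. Let $K\ge 0$ be a symmetric measurable kernel on $\Omega^2$ with $K\in L^{\infty,2}(\Omega^2)$, where $\|F\|_{L^{\infty,q}(\Omega^2)}=\operatorname{ess\,sup}_{x\in\Omega}\|F(x,\cdot)\|_{L^q(\Omega)}$, and let $f,g\in L^2(\Omega)$, with $f$ independent of time. Put $\Delta_p^Ku(x)=-\int_\Omega K(x,y)\Psi(u(y)-u(x))\,dy$. A solution on $[0,T]$ of $$\partial_t u=-\Delta_p^Ku+f,\qquad u(\cdot,0)=g \tag{P}$$ is a function $u\in C([0,T];L^1(\Omega))\cap W^{1,1}(]0,T[;L^1(\Omega))$ with $u(\cdot,0)=g$ a.e. which satisfies the equation a.e. in $\Omega\times]0,T[$. *Discretization.* Take a rectangular mesh of $\Omega$ (not necessarily equispaced) with cells $\Omega_i=\prod_k\,]x_{i_k-1},x_{i_k}]$, $i\in[n]^d$, where $0=x_0<\dots<x_n=1$ in each coordinate direction; $h_i=|\Omega_i|$ and $\delta_n$ is the largest side length of a cell. Let $P_n$ be the operator of mean values over the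 cells $\Omega_i$ (over $\Omega_i\times\Omega_j$ for kernels) and $I_n$ the piecewise constant injection, $I_n\mathbf v=\sum_i\mathbf v_i\chi_{\Omega_i}$ (similarly for kernels). Let $0=t_0<t_1<\dots<t_N=T$ be a partition, $\tau_k=t_{k+1}-t_k$, $\tau=\max_k\tau_k$. Put $\mathbf K=P_nK$, $\mathbf f=P_nf$, $f_n=I_n\mathbf f$, and let $\mathbf u^0,\dots,\mathbf u^N$ be given by the forward Euler scheme $$\frac{\mathbf u^{k+1}_i-\mathbf u^{k}_i}{\tau_k}=\sum_{j}h_j\mathbf K_{ij}\Psi(\mathbf u^k_j-\mathbf u^k_i)+\mathbf f_i\quad(0\le k<N),\qquad \mathbf u^0=P_ng.$$ The step sizes are subject to the nonlinear CFL condition: for every $0\le k<N$, $$\tau_k\le 2\kappa\,\big\|\Delta_p^{I_n\mathbf K}(I_n\mathbf u^k)-f_n\big\|_{L^2(\Omega)}^{\frac{2-p}{p-1}},\qquad \kappa=2^{\frac{p-2}{2(p-1)}}\Big(C_2^{1/2}\|I_n\mathbf K\|_{L^{\infty,1}(\Omega^2)}\Big)^{\frac1{1-p}}\Big(1-\frac1p\Big),$$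 with $C_2=\max(2^{2-p},(p-1)2^{2-p},1)$ and $\kappa=+\infty$ if $I_n\mathbf K=0$; a step at which the norm above vanishes is not restricted. Then the following hold. (i) For every $T>0$, (P) has a unique solution $u$ on $[0,T]$. For every mesh and partition the sequence $(\mathbf u^k)$ is uniquely defined. For every $T$ and every mesh, $\|I_n\mathbf u^k\|_{L^2(\Omega)}$ is bounded uniformly in $k$ and in all partitions of $[0,T]$ that satisfy the CFL condition; when $\mathbf f=\mathbf 0$ the bound is also uniform in $n$, in the mesh and in $T$. (ii) There is a constant $C>0$, depending only on $p,g,f,K$ if $p<2$, and only on $g,f,K$ and a positive lower bound of $T$ if $p=2$, such that for all $\tau$ sufficiently small (depending on $T$ and the data, but not on the mesh) $$\sup_{0\le k<N,\ t\in]t_k,t_{k+1}]}\|I_n\mathbf u^{k}-u(\cdot,t)\|_{L^2(\Omega)}\le e^{T/2}\Big(\|I_nP_ng-g\|_{L^2(\Omega)}+CT^{1/2}\big(\tau^{\frac1{3-p}}+\|f_n-f\|_{L^2(\Omega)}+\|I_nP_nK-K\|_{L^{\infty,2}(\Omega^2)}\big)\Big).$$ If $f,g\in L^\infty(\Omega)$,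 the same holds with $\|I_nP_nK-K\|_{L^{2}(\Omega^2)}$ in place of $\|I_nP_nK-K\|_{L^{\infty,2}(\Omega^2)}$. (iii) Let $s\in\,]0,1]$. Suppose moreover that $f,g\in L^\infty(\Omega)\cap\mathrm{Lip}(s,L^2(\Omega))$ and $K\in\mathrm{Lip}(s,L^2(\Omega^2))$, where $F\in\mathrm{Lip}(s,L^2(S))$ means that $F\in L^2(S)$ and $$\sup_{h>0}h^{-s}\sup_{|z|<h}\Big(\int_{x,\,x+z\in S}|F(x+z)-F(x)|^2dx\Big)^{1/2}<\infty .$$ Then, with $C$ depending only on $s$ and on the same quantities as in (ii), for all $\tau$ sufficiently small (in the same sense) $$\sup_{0\le k<N,\ t\in]t_k,t_{k+1}]}\|I_n\mathbf u^{k}-u(\cdot,t)\|_{L^2(\Omega)}\le Ce^{T/2}\Big((1+T^{1/2})\delta_n^{s}+T^{1/2}\tau^{\frac1{3-p}}\Big).$$ -/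

import Mathlib

open MeasureTheory
open scoped ENNReal

noncomputable section

namespace NonlocalPLap

/-- Points of `ℝ^d`. Only the Lebesgue measure of this type is used, not its norm. -/
abbrev Pt (d : ℕ) : Type := Fin d → ℝ

/-- The domain `Ω = [0,1]^d`. -/
def Om (d : ℕ) : Set (Pt d) := Set.Icc 0 1

/-- Lebesgue measure on `Ω`. -/
def muOm (d : ℕ) : Measure (Pt d) := volume.restrict (Om d)

/-- Lebesgue measure on `Ω²`. -/
def muOm2 (d : ℕ) : Measure (Pt d × Pt d) := volume.restrict (Om d ×ˢ Om d)

/-- The norm of `L^{∞,q}(Ω²)`: the supremum over `x ∈ Ω`, up to null sets, of the `L^q(Ω)` norm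
of `F(x,·)`. -/
def normInf {d : ℕ} (F : Pt d → Pt d → ℝ) (q : ℝ≥0∞) : ℝ≥0∞ :=
  essSup (fun x => eLpNorm (F x) q (muOm d)) (muOm d)

/-- `Ψ(x) = |x|^{p-2} x`. -/
def Psi (p x : ℝ) : ℝ := |x| ^ (p - 2) * x

/-- The nonlocal `p`-Laplacian with kernel `K`. -/
def plap {d : ℕ} (K : Pt d → Pt d → ℝ) (p : ℝ) (u : Pt d → ℝ) (x : Pt d) : ℝ :=
  -∫ y, K x y * Psi p (u y - u x) ∂(muOm d)

/-- `u` is a (strong) solution on `[0,T]` of `∂u/∂t = -Δ_p^K u + f`, `u(0) = g`: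
`u` belongs to `C([0,T]; L¹(Ω)) ∩ W^{1,1}(]0,T[; L¹(Ω))`, that is, `u` is continuous and is the
primitive of a Bochner integrable `u' : ]0,T[ → L¹(Ω)`, and the equation holds almost everywhere. -/
def IsSolution {d : ℕ} (p T : ℝ) (K : Pt d → Pt d → ℝ) (f : ℝ → Pt d → ℝ) (g : Pt d → ℝ)
    (u : ℝ → Lp ℝ 1 (muOm d)) : Prop :=
  ContinuousOn u (Set.Icc 0 T) ∧
  (u 0 : Pt d → ℝ) =ᵐ[muOm d] g ∧
  ∃ u' : ℝ → Lp ℝ 1 (muOm d),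
    IntervalIntegrable u' volume 0 T ∧
    (∀ t ∈ Set.Icc 0 T, u t = u 0 + ∫ r in (0 : ℝ)..t, u' r) ∧
    ∀ᵐ t ∂(volume.restrict (Set.Ioo 0 T)), ∀ᵐ x ∂(muOm d),
      (u' t : Pt d → ℝ) x = -plap K p (u t : Pt d → ℝ) x + f t x

/-! ### Space discretization -/

/-- A rectangular mesh of `[0,1]^d` with `n` intervals in each coordinate direction, not
necessarily equispaced. -/
structure Mesh (d n : ℕ) where
  pt : Fin d → Fin (n + 1) → ℝ
  strictMono : ∀ k, StrictMono (pt k)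
  pt_zero : ∀ k, pt k 0 = 0
  pt_last : ∀ k, pt k (Fin.last n) = 1

namespace Mesh

variable {d n : ℕ} (m : Mesh d n)

/-- The cell `∏_k ]x_{i_k - 1}, x_{i_k}]`. -/
def cell (i : Fin d → Fin n) : Set (Pt d) :=
  Set.univ.pi fun k => Set.Ioc (m.pt k (i k).castSucc) (m.pt k (i k).succ)

/-- The size `h_i` of a cell. -/
def vol (i : Fin d → Fin n) : ℝ := (volume (m.cell i)).toReal

/-- The maximal mesh size `δ_n`. -/
def delta : ℝ := ⨆ a : Fin d × Fin n, (m.pt a.1 a.2.succ - m.pt a.1 a.2.castSucc)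

/-- The projector `P_n`: mean values over the cells. -/
def proj (u : Pt d → ℝ) (i : Fin d → Fin n) : ℝ := (1 / m.vol i) * ∫ x in m.cell i, u x

/-- The projector `P_n` on kernels. -/
def proj2 (K : Pt d → Pt d → ℝ) (i j : Fin d → Fin n) : ℝ :=
  (1 / (m.vol i * m.vol j)) * ∫ z in m.cell i ×ˢ m.cell j, K z.1 z.2

/-- The piecewise constant injector `I_n`. -/
def inj (v : (Fin d → Fin n) → ℝ) (x : Pt d) : ℝ :=
  ∑ i, v i * (m.cell i).indicator (fun _ => (1 : ℝ)) x

/-- The piecewise constant injector `I_n` on discrete kernels. -/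
def inj2 (M : (Fin d → Fin n) → (Fin d → Fin n) → ℝ) (x y : Pt d) : ℝ :=
  ∑ i, ∑ j, M i j * (m.cell i).indicator (fun _ => (1 : ℝ)) x *
    (m.cell j).indicator (fun _ => (1 : ℝ)) y

/-- The discrete `p`-Laplacian with discrete kernel `M`. -/
def plapDisc (M : (Fin d → Fin n) → (Fin d → Fin n) → ℝ) (p : ℝ)
    (v : (Fin d → Fin n) → ℝ) (i : Fin d → Fin n) : ℝ :=
  -∑ j, m.vol j * M i j * Psi p (v j - v i)

end Mesh

/-! ### Time discretization -/

/-- A partition `0 = t_0 < t_1 < ⋯ < t_N = T`, not necessarily equispaced. -/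
structure TimeGrid (T : ℝ) (N : ℕ) where
  t : Fin (N + 1) → ℝ
  strictMono : StrictMono t
  t_zero : t 0 = 0
  t_last : t (Fin.last N) = T

namespace TimeGrid

variable {T : ℝ} {N : ℕ} (θ : TimeGrid T N)

/-- The `k`-th step `t_{k+1} - t_k`. -/
def step (k : Fin N) : ℝ := θ.t k.succ - θ.t k.castSucc

/-- The maximal step `τ`. -/
def tau : ℝ := ⨆ k : Fin N, θ.step k

end TimeGrid

/-- The sequence `u^0, …, u^N` is generated by the forward Euler scheme with discrete kernel `M`,
time-independent second member `b` and initial value `a`. -/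
def IsForwardEuler {d n N : ℕ} {T : ℝ} (m : Mesh d n) (θ : TimeGrid T N) (p : ℝ)
    (M : (Fin d → Fin n) → (Fin d → Fin n) → ℝ) (b a : (Fin d → Fin n) → ℝ)
    (u : Fin (N + 1) → (Fin d → Fin n) → ℝ) : Prop :=
  u 0 = a ∧
  ∀ (k : Fin N) (i : Fin d → Fin n),
    (u k.succ i - u k.castSucc i) / θ.step k = -m.plapDisc M p (u k.castSucc) i + b i

/-- `C₂ = max(2^{2-p}, (p-1) 2^{2-p}, 1)`. -/
def constTwo (p : ℝ) : ℝ := max (max ((2 : ℝ) ^ (2 - p)) ((p - 1) * (2 : ℝ) ^ (2 - p))) 1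

/-- `2^{(p-2)/(2(p-1))} (C₂^{1/2} ‖K‖_{L^{∞,1}})^{1/(1-p)} (1 - 1/p)`, as an extended nonnegative
number; it is `∞` if the kernel vanishes. -/
def cflConst {d : ℕ} (K : Pt d → Pt d → ℝ) (p : ℝ) : ℝ≥0∞ :=
  ENNReal.ofReal ((2 : ℝ) ^ ((p - 2) / (2 * (p - 1)))) *
    (ENNReal.ofReal (Real.sqrt (constTwo p)) * normInf K 1) ^ (1 / (1 - p)) *
    ENNReal.ofReal (1 - 1 / p)

/-- The norm in `L²(Ω)` of the residual `Δ_p^{I_n M} (I_n v) - I_n b`. -/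
def residual {d n : ℕ} (m : Mesh d n) (p : ℝ) (M : (Fin d → Fin n) → (Fin d → Fin n) → ℝ)
    (b v : (Fin d → Fin n) → ℝ) : ℝ≥0∞ :=
  eLpNorm (fun x => plap (m.inj2 M) p (m.inj v) x - m.inj b x) 2 (muOm d)

/-- The nonlinear CFL condition `τ_k ≤ 2 C ‖Δ_p^{I_n M} u_n^k - f_n‖^{(2-p)/(p-1)}`. A step at
which the residual vanishes, so that the scheme does not move, is not restricted. -/
def StepCondition {d n N : ℕ} {T : ℝ} (m : Mesh d n) (θ : TimeGrid T N) (p : ℝ)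
    (M : (Fin d → Fin n) → (Fin d → Fin n) → ℝ) (b : (Fin d → Fin n) → ℝ)
    (u : Fin (N + 1) → (Fin d → Fin n) → ℝ) : Prop :=
  ∀ k : Fin N, residual m p M b (u k.castSucc) = 0 ∨
    ENNReal.ofReal (θ.step k) ≤
      2 * cflConst (m.inj2 M) p * residual m p M b (u k.castSucc) ^ ((2 - p) / (p - 1))

/-! ### Lipschitz spaces -/

/-- Euclidean length on `ℝ^d`. -/
def len {d : ℕ} (z : Pt d) : ℝ := Real.sqrt (∑ i, z i ^ 2)

/-- Euclidean length on `ℝ^d × ℝ^d = ℝ^{2d}`. -/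
def len2 {d : ℕ} (z : Pt d × Pt d) : ℝ := Real.sqrt (∑ i, z.1 i ^ 2 + ∑ i, z.2 i ^ 2)

/-- The first-order `L^q(S)` modulus of smoothness, for the length function `ℓ`. -/
def modSmooth {E : Type} [AddGroup E] [MeasureSpace E] (ℓ : E → ℝ) (S : Set E) (q : ℝ≥0∞)
    (F : E → ℝ) (h : ℝ) : ℝ≥0∞ :=
  ⨆ (z : E) (_ : ℓ z < h),
    eLpNorm (fun x => F (x + z) - F x) q (volume.restrict {x | x ∈ S ∧ x + z ∈ S})

/-- `F ∈ Lip(s, L^q(S))`. -/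
def MemLip {E : Type} [AddGroup E] [MeasureSpace E] (ℓ : E → ℝ) (S : Set E) (s : ℝ) (q : ℝ≥0∞)
    (F : E → ℝ) : Prop :=
  MemLp F q (volume.restrict S) ∧
    (⨆ (h : ℝ) (_ : 0 < h), ENNReal.ofReal (h ^ (-s)) * modSmooth ℓ S q F h) < ⊤

end NonlocalPLap

end

open NonlocalPLap

/-! Almost everything follows from the co-coercivity of the nonlocal operator `A` in `L²(Ω)`. Put `q
= p/(p-1) ≥ 2`. Since `Ψ` is increasing and Hölder continuous of order `p-1`, the product
`(Ψ(a)-Ψ(b))(a-b)` dominates a multiple of `|Ψ(a)-Ψ(b)|^q` (`psi_cocoercive`). Symmetry of `K` turns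
`⟨Au-Av, u-v⟩` into a double integral of such products, and Hölder's inequality for the measure
`K(x,y)dy` gives `⟨Au-Av, u-v⟩ ≥ c‖Au-Av‖^q`, where `c` depends only on `p` and a bound of the
`L^{∞,1}` norm of the kernel (`IsKernel.cocoercive`). Mean values over cells do not increase that
norm (`IsKernel.inj2_proj2`), so all projected kernels share the same `c`, and the scheme is a
forward Euler scheme in `L²(Ω)` for the projected operator.

Existence: `A` is monotone and uniformly continuous, so the Euler polygons form a Cauchy sequence
(`exists_flow`). Uniqueness must cover curves that are only `L¹`-valued; it comes from a comparison
principle in `L¹(Ω)` (`IsKernel.comparison`), which also gives sup bounds for bounded data.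

Error: the Euler polygon `y` started from a node `x` moves with velocity `b-Ax` and is compared with
the exact flow `u` (`Cocoercive.step_error`). Replacing `y` by `x` in the pairing with `Ax-Au` costs
at most `τR‖Ax-Au‖`, with `R` a bound of the residuals; Young's inequality absorbs this in
`c‖Ax-Au‖^q` and leaves a multiple of `(τR)^p`. The weight `e^{-t}` absorbs the errors in source and
kernel, and it is also what makes the growth of `u` harmless. The result is of order `τ^{p/2}`. If
`p < 2`, then `p/2 > 1/(3-p)`, and a small `τ` swallows all constants that depend on `T`. If `p = 2`
the exponents agree and there is no such room: there the residuals are shown not to increase, and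
the lower bound of `T` pays for the jump between node and polygon (`exists_euler_rate`).

Boundedness for fixed `T` is a discrete Gronwall argument. Without source, the CFL condition says
that `τ_k‖Au‖² ≤ 2⟨Au, u⟩`, so no step increases the norm. The rate for Lipschitz data follows by
comparing a function on each cell with its values on a cube of side `δ_n`
(`eLpNorm_mean_sub_sq_le`). -/

namespace NonlocalPLap

/-! ### Scalar inequalities -/

section Scalar

variable {p : ℝ}

lemma psi_neg (x : ℝ) : Psi p (-x) = -Psi p x := by simp [Psi]

lemma psi_zero : Psi p 0 = 0 := by simp [Psi]

lemma psi_of_nonneg (hp1 : 1 < p) {x : ℝ} (hx : 0 ≤ x) : Psi p x = x ^ (p - 1) := by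
  rcases hx.eq_or_lt with rfl | hx
  · rw [psi_zero, Real.zero_rpow (by linarith)]
  · rw [Psi, abs_of_pos hx, ← Real.rpow_add_one hx.ne']
    congr 1
    ring

lemma abs_psi (hp1 : 1 < p) (x : ℝ) : |Psi p x| = |x| ^ (p - 1) := by
  rcases le_total 0 x with hx | hx
  · rw [psi_of_nonneg hp1 hx, abs_of_nonneg hx, abs_of_nonneg (by positivity)]
  · have h := psi_of_nonneg hp1 (neg_nonneg.2 hx)
    rw [psi_neg] at h
    rw [← abs_neg (Psi p x), h, abs_of_nonpos hx, abs_of_nonneg (Real.rpow_nonneg (by linarith) _)]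

lemma psi_mono (hp1 : 1 < p) : Monotone (Psi p) := by
  have key : ∀ a b : ℝ, 0 ≤ a → a ≤ b → Psi p a ≤ Psi p b := fun a b ha hab => by
    rw [psi_of_nonneg hp1 ha, psi_of_nonneg hp1 (ha.trans hab)]
    exact Real.rpow_le_rpow ha hab (by linarith)
  intro a b hab
  rcases le_total 0 a with ha | ha
  · exact key a b ha hab
  · rcases le_total 0 b with hb | hb
    · have h1 := key 0 (-a) le_rfl (by linarith)
      have h2 := key 0 b le_rfl hb
      rw [psi_zero] at h1 h2
      rw [psi_neg] at h1
      linarith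
    · have h1 := key (-b) (-a) (by linarith) (by linarith)
      rw [psi_neg, psi_neg] at h1
      linarith

lemma measurable_psi : Measurable (Psi p) := by
  unfold Psi
  fun_prop

lemma rpow_sub_rpow_le {α a b : ℝ} (hα : 0 ≤ α) (hα1 : α ≤ 1) (hb : 0 ≤ b) (hab : b ≤ a) :
    a ^ α - b ^ α ≤ (a - b) ^ α := by
  have h := Real.rpow_add_le_add_rpow (sub_nonneg.2 hab) hb hα hα1
  rw [sub_add_cancel] at h
  linarith

/-- For equal signs this is the subadditivity of `x ↦ x^(p-1)`. The factor 2 comes from opposite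
signs, where each of the two powers is bounded separately. -/
lemma psi_sub_psi_le (hp1 : 1 < p) (hp2 : p ≤ 2) {a b : ℝ} (hab : b ≤ a) :
    Psi p a - Psi p b ≤ 2 * (a - b) ^ (p - 1) := by
  have h0 : 0 ≤ (a - b) ^ (p - 1) := Real.rpow_nonneg (by linarith) _
  rcases le_total 0 b with hb | hb
  · rw [psi_of_nonneg hp1 hb, psi_of_nonneg hp1 (hb.trans hab)]
    have := rpow_sub_rpow_le (α := p - 1) (by linarith) (by linarith) hb hab
    linarith
  · have hb' := psi_of_nonneg hp1 (neg_nonneg.2 hb)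
    rw [psi_neg] at hb'
    rcases le_total 0 a with ha | ha
    · rw [psi_of_nonneg hp1 ha, sub_eq_add_neg, hb']
      have h1 : a ^ (p - 1) ≤ (a - b) ^ (p - 1) :=
        Real.rpow_le_rpow ha (by linarith) (by linarith)
      have h2 : (-b) ^ (p - 1) ≤ (a - b) ^ (p - 1) :=
        Real.rpow_le_rpow (by linarith) (by linarith) (by linarith)
      linarith
    · have ha' := psi_of_nonneg hp1 (neg_nonneg.2 ha)
      rw [psi_neg] at ha'
      have := rpow_sub_rpow_le (α := p - 1) (by linarith) (by linarith) (neg_nonneg.2 ha)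
        (neg_le_neg hab)
      rw [← hb', ← ha', show -b - -a = a - b by ring] at this
      linarith

lemma abs_psi_sub_psi_le (hp1 : 1 < p) (hp2 : p ≤ 2) (a b : ℝ) :
    |Psi p a - Psi p b| ≤ 2 * |a - b| ^ (p - 1) := by
  rcases le_total b a with h | h
  · rw [abs_of_nonneg (sub_nonneg.2 (psi_mono hp1 h)), abs_of_nonneg (sub_nonneg.2 h)]
    exact psi_sub_psi_le hp1 hp2 h
  · rw [abs_sub_comm, abs_sub_comm a b, abs_of_nonneg (sub_nonneg.2 (psi_mono hp1 h)),
      abs_of_nonneg (sub_nonneg.2 h)]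
    exact psi_sub_psi_le hp1 hp2 h

lemma psi_sub_mul_sub_eq (hp1 : 1 < p) (a b : ℝ) :
    (Psi p a - Psi p b) * (a - b) = |Psi p a - Psi p b| * |a - b| := by
  rcases le_total b a with h | h
  · rw [abs_of_nonneg (sub_nonneg.2 (psi_mono hp1 h)), abs_of_nonneg (sub_nonneg.2 h)]
  · rw [abs_of_nonpos (sub_nonpos.2 (psi_mono hp1 h)), abs_of_nonpos (sub_nonpos.2 h)]
    ring

lemma one_lt_conj (hp1 : 1 < p) : 1 < p / (p - 1) := by
  rw [lt_div_iff₀ (by linarith)]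
  linarith

lemma two_le_conj (hp1 : 1 < p) (hp2 : p ≤ 2) : 2 ≤ p / (p - 1) := by
  rw [le_div_iff₀ (by linarith)]
  linarith

lemma conj_eq (hp1 : 1 < p) : p / (p - 1) = 1 + 1 / (p - 1) := by
  have : p - 1 ≠ 0 := by linarith
  field_simp
  ring

lemma rpow_conj (hp1 : 1 < p) {x : ℝ} (hx : 0 ≤ x) :
    x ^ (p / (p - 1)) = x * x ^ (1 / (p - 1)) := by
  have : 0 < 1 / (p - 1) := by
    have : 0 < p - 1 := by linarith
    positivity
  rw [conj_eq hp1, Real.rpow_add_of_nonneg hx zero_le_one this.le, Real.rpow_one]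

/-- Co-coercivity of `Ψ`. -/
lemma psi_cocoercive (hp1 : 1 < p) (hp2 : p ≤ 2) (a b : ℝ) :
    (2 : ℝ)⁻¹ ^ (1 / (p - 1)) * |Psi p a - Psi p b| ^ (p / (p - 1)) ≤
      (Psi p a - Psi p b) * (a - b) := by
  have hp : 0 < p - 1 := by linarith
  rw [psi_sub_mul_sub_eq hp1, rpow_conj hp1 (abs_nonneg _), mul_left_comm]
  gcongr
  -- With one factor `|Psi p a - Psi p b|` removed, what remains is the Hölder bound solved for `|a
  -- - b|`.
  rw [← Real.mul_rpow (by positivity) (by positivity)]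
  calc (2⁻¹ * |Psi p a - Psi p b|) ^ (1 / (p - 1))
      ≤ (|a - b| ^ (p - 1)) ^ (1 / (p - 1)) := by
        apply Real.rpow_le_rpow (by positivity) _ (by positivity)
        have := abs_psi_sub_psi_le hp1 hp2 a b
        linarith
    _ = |a - b| := by
        rw [← Real.rpow_mul (abs_nonneg _), mul_one_div_cancel hp.ne', Real.rpow_one]

/-- Against `b = 0` co-coercivity is an equality with constant 1. The loss of a power of 2 in
`psi_cocoercive` would be too much for the CFL argument. -/
lemma psi_mul_self (hp1 : 1 < p) (a : ℝ) : Psi p a * a = |Psi p a| ^ (p / (p - 1)) := by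
  have hp : p - 1 ≠ 0 := by linarith
  have h := psi_sub_mul_sub_eq hp1 a 0
  rw [psi_zero, sub_zero, sub_zero] at h
  rw [h, rpow_conj hp1 (abs_nonneg _), abs_psi hp1, ← Real.rpow_mul (abs_nonneg a),
    mul_one_div_cancel hp, Real.rpow_one]

lemma abs_psi_le (hp1 : 1 < p) (hp2 : p ≤ 2) (a : ℝ) : |Psi p a| ≤ 1 + |a| := by
  rw [abs_psi hp1]
  rcases le_total |a| 1 with h | h
  · have := Real.rpow_le_one (abs_nonneg a) h (by linarith : 0 ≤ p - 1)
    linarith [abs_nonneg a]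
  · have := Real.rpow_le_rpow_of_exponent_le h (by linarith : p - 1 ≤ 1)
    rw [Real.rpow_one] at this
    linarith

lemma abs_psi_sub_le (hp1 : 1 < p) (hp2 : p ≤ 2) (a b : ℝ) :
    |Psi p (a - b)| ≤ 1 + |a| + |b| := by
  have := abs_psi_le hp1 hp2 (a - b)
  have := abs_sub a b
  linarith

end Scalar

/-! ### Dissipative evolution equations in a Hilbert space -/

section Flow

open Filter Topology Set

variable {H : Type*} [NormedAddCommGroup H] [InnerProductSpace ℝ H]

/-- The explicit Euler iterates with constant step `δ`. -/
def eulerIter (F : H → H) (g : H) (δ : ℝ) : ℕ → H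
  | 0 => g
  | k + 1 => eulerIter F g δ k + δ • F (eulerIter F g δ k)

lemma norm_eulerIter_le {F : H → H} {L : ℝ} (hL : 0 ≤ L) (hF : ∀ x, ‖F x‖ ≤ L * (1 + ‖x‖))
    (g : H) {δ : ℝ} (hδ : 0 ≤ δ) (k : ℕ) :
    1 + ‖eulerIter F g δ k‖ ≤ (1 + ‖g‖) * Real.exp (L * (k * δ)) := by
  induction k with
  | zero => simp [eulerIter]
  | succ k ih =>
    have h1 : ‖eulerIter F g δ (k + 1)‖ ≤
        ‖eulerIter F g δ k‖ + δ * (L * (1 + ‖eulerIter F g δ k‖)) := by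
      refine (norm_add_le _ _).trans ?_
      rw [norm_smul, Real.norm_of_nonneg hδ]
      gcongr
      exact hF _
    calc 1 + ‖eulerIter F g δ (k + 1)‖
        ≤ (1 + ‖eulerIter F g δ k‖) * (L * δ + 1) := by linarith
      _ ≤ ((1 + ‖g‖) * Real.exp (L * (k * δ))) * Real.exp (L * δ) := by
          gcongr
          exact Real.add_one_le_exp _
      _ = (1 + ‖g‖) * Real.exp (L * ((k + 1 : ℕ) * δ)) := by
          rw [mul_assoc, ← Real.exp_add]
          push_cast
          ring_nf

lemma floor_div_mul_le {δ t : ℝ} (hδ : 0 < δ) (ht : 0 ≤ t) : (⌊t / δ⌋₊ : ℝ) * δ ≤ t := by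
  rw [← le_div_iff₀ hδ]
  exact Nat.floor_le (by positivity)

lemma lt_floor_div_mul {δ : ℝ} (hδ : 0 < δ) (t : ℝ) : t < (⌊t / δ⌋₊ : ℝ) * δ + δ := by
  have := Nat.lt_floor_add_one (t / δ)
  rw [div_lt_iff₀ hδ] at this
  linarith

/-- The floor is locally constant to the right, also at the nodes. Hence the Euler polygon has a
right derivative at every point. -/
lemma continuousWithinAt_floor_comp {E : Type*} [TopologicalSpace E] (f : ℕ → E) {δ t : ℝ}
    (hδ : 0 < δ) (ht : 0 ≤ t) : ContinuousWithinAt (fun s => f ⌊s / δ⌋₊) (Ici t) t := by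
  have : ∀ᶠ s in 𝓝[Ici t] t, f ⌊s / δ⌋₊ = f ⌊t / δ⌋₊ := by
    filter_upwards [self_mem_nhdsWithin,
      mem_nhdsWithin_of_mem_nhds (Iio_mem_nhds (lt_floor_div_mul hδ t))] with s hs hs'
    congr 1
    rw [Nat.floor_eq_iff (div_nonneg (ht.trans hs) hδ.le), le_div_iff₀ hδ, div_lt_iff₀ hδ]
    constructor
    · exact (floor_div_mul_le hδ ht).trans hs
    · rw [add_mul, one_mul]
      exact hs'
  exact (tendsto_congr' this).2 tendsto_const_nhds

/-- The Euler polygon with constant step, as the primitive of a step function. -/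
lemma exists_eulerPolygon [CompleteSpace H] {F : H → H} {L : ℝ} (hL : 0 ≤ L)
    (hF : ∀ x, ‖F x‖ ≤ L * (1 + ‖x‖)) (g : H) {δ T : ℝ} (hδ : 0 < δ) :
    ∃ v : ℝ → H, ∃ w : ℝ → H,
      (∀ t ∈ Icc 0 T, ‖F (v t)‖ ≤ L * ((1 + ‖g‖) * Real.exp (L * T))) ∧
      StronglyMeasurable (fun t => F (v t)) ∧
      (∀ t, 0 ≤ t → ContinuousWithinAt (fun t => F (v t)) (Ici t) t) ∧
      (∀ t ∈ Icc 0 T, w t = g + ∫ s in (0 : ℝ)..t, F (v s)) ∧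
      ∀ t ∈ Icc 0 T, ‖w t - v t‖ ≤ δ * (L * ((1 + ‖g‖) * Real.exp (L * T))) := by
  set U := eulerIter F g δ with hU
  set R := L * ((1 + ‖g‖) * Real.exp (L * T)) with hR
  set J : ℝ → H := fun t => F (U ⌊t / δ⌋₊) with hJ
  have hbound : ∀ t ∈ Icc 0 T, ‖J t‖ ≤ R := by
    intro t ht
    refine (hF _).trans ?_
    rw [hR]
    gcongr
    refine (norm_eulerIter_le hL hF g hδ.le _).trans ?_
    gcongr
    exact (floor_div_mul_le hδ ht.1).trans ht.2
  have hmeas : StronglyMeasurable J := by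
    have h1 : StronglyMeasurable (fun k : ℕ => F (U k)) := StronglyMeasurable.of_discrete
    exact h1.comp_measurable (Nat.measurable_floor.comp (measurable_id.div_const δ))
  have hint : ∀ a ∈ Icc 0 T, ∀ b ∈ Icc 0 T, IntervalIntegrable J volume a b := by
    intro a ha b hb
    rw [intervalIntegrable_iff]
    refine Measure.integrableOn_of_bounded (M := R) (by simp) hmeas.aestronglyMeasurable ?_
    refine (ae_restrict_iff' measurableSet_uIoc).2 (Eventually.of_forall fun t ht => ?_)
    exact hbound t ⟨(le_min ha.1 hb.1).trans ht.1.le, ht.2.trans (max_le ha.2 hb.2)⟩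
  have hnode : ∀ k : ℕ, (k : ℝ) * δ ≤ T → g + ∫ s in (0 : ℝ)..(k * δ), J s = U k := by
    intro k
    induction k with
    | zero => simp [hU, eulerIter]
    | succ k ih =>
      intro hk
      push_cast at hk ⊢
      have hk0 : (0 : ℝ) ≤ k * δ := by positivity
      have hk' : (k : ℝ) * δ ≤ T := by nlinarith
      have hm : (0 : ℝ) ∈ Icc 0 T := ⟨le_rfl, hk0.trans hk'⟩
      rw [← intervalIntegral.integral_add_adjacent_intervals (b := k * δ)
        (hint _ hm _ ⟨hk0, hk'⟩) (hint _ ⟨hk0, hk'⟩ _ ⟨by positivity, hk⟩), ← add_assoc, ih hk']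
      have : ∫ s in (k * δ)..((k + 1) * δ), J s = ∫ s in (k * δ)..((k + 1) * δ), F (U k) := by
        apply intervalIntegral.integral_congr_ae
        -- The floor equals `k` on a half-open interval closed on the left, while interval integrals
        -- use the one closed on the right; the right endpoint is discarded as a null set.
        have hne : ∀ᵐ s : ℝ, s ≠ (k + 1) * δ := by simp [ae_iff, measure_singleton]
        filter_upwards [hne] with s hs hs'
        rw [uIoc_of_le (by nlinarith)] at hs'
        have h2 : ⌊s / δ⌋₊ = k := by
          rw [Nat.floor_eq_iff (div_nonneg (hk0.trans hs'.1.le) hδ.le), le_div_iff₀ hδ,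
            div_lt_iff₀ hδ]
          exact ⟨hs'.1.le, lt_of_le_of_ne hs'.2 hs⟩
        simp only [hJ, h2]
      rw [this, intervalIntegral.integral_const]
      simp only [hU, eulerIter]
      congr 2
      ring
  refine ⟨fun t => U ⌊t / δ⌋₊, fun t => g + ∫ s in (0 : ℝ)..t, J s, hbound, hmeas,
    fun t ht => continuousWithinAt_floor_comp (fun k => F (U k)) hδ ht, fun _ _ => rfl, ?_⟩
  intro t ht
  have h1 := floor_div_mul_le hδ ht.1
  have h2 := lt_floor_div_mul hδ t
  have hm : (0 : ℝ) ∈ Icc 0 T := ⟨le_rfl, ht.1.trans ht.2⟩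
  have hk : (⌊t / δ⌋₊ : ℝ) * δ ∈ Icc 0 T := ⟨by positivity, h1.trans ht.2⟩
  beta_reduce
  rw [← hnode _ hk.2, add_sub_add_left_eq_sub,
    intervalIntegral.integral_interval_sub_left (hint _ hm _ ht) (hint _ hm _ hk)]
  have := intervalIntegral.norm_integral_le_of_norm_le_const (a := (⌊t / δ⌋₊ : ℝ) * δ) (b := t)
    (f := J) (C := R) (fun s hs => by
      rw [uIoc_of_le h1] at hs
      exact hbound s ⟨hk.1.trans hs.1.le, hs.2.trans ht.2⟩)
  refine this.trans ?_
  rw [abs_of_nonneg (by linarith), mul_comm]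
  have hR0 : 0 ≤ R := by positivity
  gcongr
  linarith

/-- Existence for `u' = F(u)`, `u(0) = g`, if `F` is uniformly continuous and dissipative and has
linear growth. -/
theorem exists_flow [CompleteSpace H] {F : H → H} {L : ℝ} (hL : 0 ≤ L)
    (hF : ∀ x, ‖F x‖ ≤ L * (1 + ‖x‖)) (hc : UniformContinuous F)
    (hd : ∀ x y, inner ℝ (F x - F y) (x - y) ≤ 0) (g : H) {T : ℝ} (hT : 0 < T) :
    ∃ u : ℝ → H, Continuous u ∧ u 0 = g ∧ ∀ t ∈ Icc 0 T, HasDerivAt u (F (u t)) t := by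
  set R := L * ((1 + ‖g‖) * Real.exp (L * T)) with hR
  have hR0 : 0 ≤ R := by positivity
  choose v w hv hvm hvc hw hvw using fun m : ℕ =>
    exists_eulerPolygon hL hF g (T := T) (Nat.one_div_pos_of_nat (α := ℝ) (n := m))
  have hint : ∀ m, IntervalIntegrable (fun t => F (v m t)) volume 0 T := by
    intro m
    rw [intervalIntegrable_iff]
    refine Measure.integrableOn_of_bounded (M := R) (by simp) (hvm m).aestronglyMeasurable ?_
    refine (ae_restrict_iff' measurableSet_uIoc).2 (Eventually.of_forall fun t ht => ?_)
    rw [uIoc_of_le hT.le] at ht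
    exact hv m t ⟨ht.1.le, ht.2⟩
  have hintsub : ∀ m, ∀ t ∈ Icc 0 T, IntervalIntegrable (fun t => F (v m t)) volume 0 t := by
    intro m t ht
    refine (hint m).mono_set ?_
    rw [uIcc_of_le ht.1, uIcc_of_le hT.le]
    exact Icc_subset_Icc_right ht.2
  have hwc : ∀ m, ContinuousOn (w m) (Icc 0 T) := by
    intro m
    refine ContinuousOn.congr ?_ (hw m)
    have := intervalIntegral.continuousOn_primitive_interval' (hint m) left_mem_uIcc
    rw [uIcc_of_le hT.le] at this
    exact continuousOn_const.add this
  have hwd : ∀ m, ∀ t ∈ Ico 0 T, HasDerivWithinAt (w m) (F (v m t)) (Ici t) t := by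
    intro m t ht
    have h1 : HasDerivWithinAt (fun t => ∫ s in (0 : ℝ)..t, F (v m s)) (F (v m t)) (Ici t) t :=
      intervalIntegral.integral_hasDerivWithinAt_right (hintsub m t ⟨ht.1, ht.2.le⟩)
        (t := Ioi t) ⟨univ, univ_mem, (hvm m).aestronglyMeasurable⟩
        ((hvc m t ht.1).mono Ioi_subset_Ici_self)
    have h2 := h1.const_add g
    refine h2.congr_of_eventuallyEq ?_ (hw m t ⟨ht.1, ht.2.le⟩)
    filter_upwards [self_mem_nhdsWithin, mem_nhdsWithin_of_mem_nhds (Iio_mem_nhds ht.2)]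
      with s hs hs'
    exact hw m s ⟨ht.1.trans hs, hs'.le⟩
  have hwdist : ∀ m, ∀ t ∈ Icc 0 T, ‖w m t - g‖ ≤ R * T := by
    intro m t ht
    rw [hw m t ht, add_sub_cancel_left]
    have := intervalIntegral.norm_integral_le_of_norm_le_const (a := 0) (b := t)
      (f := fun s => F (v m s)) (C := R) (fun s hs => by
        rw [uIoc_of_le ht.1] at hs
        exact hv m s ⟨hs.1.le, hs.2.trans ht.2⟩)
    refine this.trans ?_
    rw [sub_zero, abs_of_nonneg ht.1]
    gcongr
    exact ht.2
  have hsmall : ∀ η > 0, ∀ᶠ m : ℕ in atTop, 1 / ((m : ℝ) + 1) * R < η := by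
    intro η hη
    have : Tendsto (fun m : ℕ => 1 / ((m : ℝ) + 1) * R) atTop (𝓝 (0 * R)) :=
      tendsto_one_div_add_atTop_nhds_zero_nat.mul_const R
    rw [zero_mul] at this
    exact this.eventually (Iio_mem_nhds hη)
  have hcauchy : UniformCauchySeqOn w atTop (Icc 0 T) := by
    rw [Metric.uniformCauchySeqOn_iff]
    intro ε hε
    -- The factor 8 collects the 2 from the derivative of the square, the bound `2RT` for the
    -- distance of two polygons, and two perturbation terms. The summand 1 keeps `C` positive when
    -- `R = 0`.
    set C := 8 * (R * T) * T + 1 with hC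
    have hC0 : 0 < C := by positivity
    obtain ⟨η, hη, hηF⟩ := Metric.uniformContinuous_iff.1 hc (ε ^ 2 / (2 * C)) (by positivity)
    obtain ⟨M, hM⟩ := eventually_atTop.1 (hsmall η hη)
    refine ⟨M, fun m hm l hl t ht => ?_⟩
    have hnear : ∀ m ≥ M, ∀ t ∈ Icc 0 T, ‖F (v m t) - F (w m t)‖ ≤ ε ^ 2 / (2 * C) := by
      intro m hm t ht
      rw [← dist_eq_norm]
      refine (hηF ?_).le
      rw [dist_comm, dist_eq_norm]
      exact (hvw m t ht).trans_lt (hM m hm)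
    have hN : ∀ ⦃t⦄, t ∈ Icc 0 T → ‖w m t - w l t‖ ^ 2 ≤ 8 * (R * T) * (ε ^ 2 / (2 * C)) * t := by
      refine image_le_of_deriv_right_le_deriv_boundary
        (f := fun t => ‖w m t - w l t‖ ^ 2)
        (B := fun t => 8 * (R * T) * (ε ^ 2 / (2 * C)) * t)
        (f' := fun t => 2 * inner ℝ (w m t - w l t) (F (v m t) - F (v l t)))
        (B' := fun _ => 8 * (R * T) * (ε ^ 2 / (2 * C))) ?_ ?_ ?_ ?_ ?_ ?_
      · exact ((hwc m).sub (hwc l)).norm.pow 2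
      · intro t ht
        exact ((hwd m t ht).sub (hwd l t ht)).norm_sq
      · have h0 : (0 : ℝ) ∈ Icc 0 T := ⟨le_rfl, hT.le⟩
        simp [hw m 0 h0, hw l 0 h0]
      · fun_prop
      · intro t _
        simpa using ((hasDerivAt_id t).const_mul (8 * (R * T) * (ε ^ 2 / (2 * C)))).hasDerivWithinAt
      · intro t ht
        have ht' : t ∈ Icc 0 T := ⟨ht.1, ht.2.le⟩
        -- The first bracket is handled by dissipativity; the second compares nodes with polygons
        -- and is small by uniform continuity.
        have e1 : F (v m t) - F (v l t) = (F (w m t) - F (w l t)) +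
            ((F (v m t) - F (w m t)) - (F (v l t) - F (w l t))) := by abel
        have e2 : ‖w m t - w l t‖ ≤ 2 * (R * T) := by
          have := norm_sub_le (w m t - g) (w l t - g)
          rw [sub_sub_sub_cancel_right] at this
          linarith [hwdist m t ht', hwdist l t ht']
        have e3 : ‖(F (v m t) - F (w m t)) - (F (v l t) - F (w l t))‖ ≤ 2 * (ε ^ 2 / (2 * C)) := by
          have := norm_sub_le (F (v m t) - F (w m t)) (F (v l t) - F (w l t))
          linarith [hnear m hm t ht', hnear l hl t ht']
        rw [e1, inner_add_right]
        have e4 := real_inner_le_norm (w m t - w l t)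
          ((F (v m t) - F (w m t)) - (F (v l t) - F (w l t)))
        have e5 := mul_le_mul e2 e3 (norm_nonneg _) (by positivity)
        have e6 := hd (w m t) (w l t)
        rw [real_inner_comm] at e6
        linarith
    have h2 := hN ht
    rw [dist_eq_norm]
    refine lt_of_pow_lt_pow_left₀ 2 hε.le (h2.trans_lt ?_)
    calc 8 * (R * T) * (ε ^ 2 / (2 * C)) * t ≤ 8 * (R * T) * (ε ^ 2 / (2 * C)) * T := by
          gcongr
          exact ht.2
      _ = (8 * (R * T) * T) * (ε ^ 2 / (2 * C)) := by ring
      _ ≤ C * (ε ^ 2 / (2 * C)) := by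
          gcongr
          linarith
      _ = ε ^ 2 / 2 := by field_simp
      _ < ε ^ 2 := by linarith [pow_pos hε 2]
  have hlim : ∀ t ∈ Icc 0 T, ∃ x, Tendsto (fun m => w m t) atTop (𝓝 x) := fun t ht =>
    cauchySeq_tendsto_of_complete (hcauchy.cauchySeq ht)
  choose! u₀ hu₀ using hlim
  have hunif := hcauchy.tendstoUniformlyOn_of_tendsto (fun t ht => hu₀ t ht)
  have hu₀c : ContinuousOn u₀ (Icc 0 T) :=
    hunif.continuousOn (Frequently.of_forall hwc)
  have hvlim : ∀ t ∈ Icc 0 T, Tendsto (fun m => F (v m t)) atTop (𝓝 (F (u₀ t))) := by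
    intro t ht
    refine (hc.continuous.tendsto _).comp ?_
    have h1 : Tendsto (fun m => w m t - v m t) atTop (𝓝 0) := by
      rw [tendsto_zero_iff_norm_tendsto_zero]
      refine squeeze_zero (fun _ => norm_nonneg _) (fun m => hvw m t ht) ?_
      have := (tendsto_one_div_add_atTop_nhds_zero_nat (𝕜 := ℝ)).mul_const R
      rwa [zero_mul] at this
    have h2 := (hu₀ t ht).sub h1
    simpa using h2
  have heq : ∀ t ∈ Icc 0 T, u₀ t = g + ∫ s in (0 : ℝ)..t, F (u₀ s) := by
    intro t ht
    refine tendsto_nhds_unique (hu₀ t ht) ?_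
    rw [tendsto_congr (fun m => hw m t ht)]
    refine tendsto_const_nhds.add ?_
    refine intervalIntegral.tendsto_integral_filter_of_dominated_convergence (fun _ => R)
      (Eventually.of_forall fun m => (hvm m).aestronglyMeasurable) ?_ (by simp) ?_
    · refine Eventually.of_forall fun m => Eventually.of_forall fun s hs => ?_
      rw [uIoc_of_le ht.1] at hs
      exact hv m s ⟨hs.1.le, hs.2.trans ht.2⟩
    · refine Eventually.of_forall fun s hs => ?_
      rw [uIoc_of_le ht.1] at hs
      exact hvlim s ⟨hs.1.le, hs.2.trans ht.2⟩
  -- The velocity is frozen outside `[0,T]`, so that it is continuous on the line and its primitive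
  -- has two-sided derivatives at the endpoints as well.
  set e : ℝ → H := fun t => F (u₀ (projIcc 0 T hT.le t)) with he
  have hec : Continuous e :=
    hc.continuous.comp (hu₀c.comp_continuous (continuous_subtype_val.comp continuous_projIcc)
      fun t => (projIcc 0 T hT.le t).2)
  set u : ℝ → H := fun t => g + ∫ s in (0 : ℝ)..t, e s with hu
  have huu₀ : ∀ t ∈ Icc 0 T, u t = u₀ t := by
    intro t ht
    rw [heq t ht, hu]
    simp only
    congr 1
    apply intervalIntegral.integral_congr
    intro s hs
    rw [uIcc_of_le ht.1] at hs
    simp only [he]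
    rw [projIcc_of_mem hT.le ⟨hs.1, hs.2.trans ht.2⟩]
  have hud : ∀ t, HasDerivAt u (e t) t := fun t =>
    (intervalIntegral.integral_hasDerivAt_right (hec.intervalIntegrable _ _)
      hec.stronglyMeasurable.stronglyMeasurableAtFilter hec.continuousAt).const_add g
  refine ⟨u, continuous_iff_continuousAt.2 fun t => (hud t).continuousAt, by simp [hu], ?_⟩
  intro t ht
  have := hud t
  rwa [show e t = F (u t) by rw [huu₀ t ht, he]; simp only; rw [projIcc_of_mem hT.le ht]] at this

end Flow

/-! ### Co-coercive operators in a Hilbert space -/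

section Cocoercive

open Filter Topology Set

variable {H : Type*} [NormedAddCommGroup H] [InnerProductSpace ℝ H] {p c : ℝ} {A : H → H}

/-- Co-coercivity of order `p / (p - 1)` with constant `c`. -/
def Cocoercive (p c : ℝ) (A : H → H) : Prop :=
  ∀ u v, c * ‖A u - A v‖ ^ (p / (p - 1)) ≤ inner ℝ (A u - A v) (u - v)

lemma Cocoercive.inner_nonneg (hA : Cocoercive p c A) (hc : 0 ≤ c) (u v : H) :
    0 ≤ inner ℝ (A u - A v) (u - v) :=
  le_trans (by positivity) (hA u v)

/-- Cauchy–Schwarz on the right of the co-coercivity inequality, then cancellation of one factor `‖A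
u - A v‖`: co-coercivity contains Hölder continuity of order `p - 1`. -/
lemma Cocoercive.norm_sub_le (hA : Cocoercive p c A) (hc : 0 < c) (hp1 : 1 < p) (u v : H) :
    ‖A u - A v‖ ≤ (‖u - v‖ / c) ^ (p - 1) := by
  have hp : 0 < p - 1 := by linarith
  rcases (norm_nonneg (A u - A v)).eq_or_lt with h0 | h0
  · rw [← h0]
    positivity
  have h := (hA u v).trans (real_inner_le_norm _ _)
  rw [rpow_conj hp1 h0.le, mul_left_comm] at h
  have h1 : ‖A u - A v‖ ^ (1 / (p - 1)) ≤ ‖u - v‖ / c := by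
    rw [le_div_iff₀ hc, mul_comm]
    exact le_of_mul_le_mul_left h h0
  have h2 := Real.rpow_le_rpow (by positivity) h1 hp.le
  rwa [← Real.rpow_mul h0.le, one_div_mul_cancel hp.ne', Real.rpow_one] at h2

lemma rpow_le_one_add {α x : ℝ} (hα : 0 ≤ α) (hα1 : α ≤ 1) (hx : 0 ≤ x) : x ^ α ≤ 1 + x := by
  rcases le_total x 1 with h | h
  · have := Real.rpow_le_one hx h hα
    linarith
  · have := Real.rpow_le_rpow_of_exponent_le h hα1
    rw [Real.rpow_one] at this
    linarith

lemma Cocoercive.norm_le (hA : Cocoercive p c A) (hc : 0 < c) (hp1 : 1 < p) (hp2 : p ≤ 2)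
    (hA0 : A 0 = 0) (u : H) : ‖A u‖ ≤ 1 + ‖u‖ / c := by
  have h := hA.norm_sub_le hc hp1 u 0
  rw [hA0, sub_zero, sub_zero] at h
  exact h.trans (rpow_le_one_add (by linarith) (by linarith) (by positivity))

lemma Cocoercive.uniformContinuous (hA : Cocoercive p c A) (hc : 0 < c) (hp1 : 1 < p) :
    UniformContinuous A := by
  have hp : 0 < p - 1 := by linarith
  rw [Metric.uniformContinuous_iff]
  intro ε hε
  refine ⟨c * ε ^ (1 / (p - 1)), by positivity, fun u v huv => ?_⟩
  rw [dist_eq_norm] at huv ⊢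
  refine (hA.norm_sub_le hc hp1 u v).trans_lt ?_
  calc (‖u - v‖ / c) ^ (p - 1) < (ε ^ (1 / (p - 1))) ^ (p - 1) := by
        apply Real.rpow_lt_rpow (by positivity) _ hp
        rw [div_lt_iff₀ hc]
        linarith
    _ = ε := by rw [← Real.rpow_mul hε.le, one_div_mul_cancel hp.ne', Real.rpow_one]

theorem Cocoercive.exists_flow [CompleteSpace H] (hA : Cocoercive p c A) (hc : 0 < c)
    (hp1 : 1 < p) (hp2 : p ≤ 2) (hA0 : A 0 = 0) (f g : H) {T : ℝ} (hT : 0 < T) :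
    ∃ u : ℝ → H, Continuous u ∧ u 0 = g ∧ ∀ t ∈ Icc 0 T, HasDerivAt u (-A (u t) + f) t := by
  refine NonlocalPLap.exists_flow (F := fun x => -A x + f) (L := 1 + 1 / c + ‖f‖) (by positivity)
    (fun x => ?_) ((hA.uniformContinuous hc hp1).neg.add uniformContinuous_const)
    (fun x y => ?_) g hT
  · have h1 := hA.norm_le hc hp1 hp2 hA0 x
    have h2 := norm_add_le (-A x) f
    rw [norm_neg] at h2
    have h3 : 0 ≤ ‖f‖ * ‖x‖ := by positivity
    have h4 : ‖x‖ / c = 1 / c * ‖x‖ := by ring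
    have h5 : 0 ≤ 1 / c := by positivity
    nlinarith [norm_nonneg x]
  · have := hA.inner_nonneg hc.le x y
    rw [add_sub_add_right_eq_sub, neg_sub_neg, ← neg_sub, inner_neg_left]
    linarith

/-- A Young inequality with a non-optimal constant. If the left side is positive, then `D ≤
(r/c)^(p-1)`, and `D * r` alone obeys the bound. It lets co-coercivity absorb the delay of the
explicit scheme. -/
lemma mul_sub_rpow_conj_le (hp1 : 1 < p) (hc : 0 < c) {D r : ℝ} (hD : 0 ≤ D) (hr : 0 ≤ r) :
    D * r - c * D ^ (p / (p - 1)) ≤ (1 / c) ^ (p - 1) * r ^ p := by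
  have hp : 0 < p - 1 := by linarith
  have h0 : 0 ≤ (1 / c) ^ (p - 1) * r ^ p := by positivity
  rcases le_or_gt (D * r) (c * D ^ (p / (p - 1))) with h | h
  · linarith
  rw [rpow_conj hp1 hD, mul_left_comm] at h ⊢
  have h1 : c * D ^ (1 / (p - 1)) ≤ r := (lt_of_mul_lt_mul_left h hD).le
  have h2 : D ≤ (1 / c * r) ^ (p - 1) := by
    have h3 : D ^ (1 / (p - 1)) ≤ 1 / c * r := by
      rw [one_div_mul_eq_div, le_div_iff₀ hc]
      linarith
    have h4 := Real.rpow_le_rpow (by positivity) h3 hp.le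
    rwa [← Real.rpow_mul hD, one_div_mul_cancel hp.ne', Real.rpow_one] at h4
  have h5 : D * r ≤ (1 / c) ^ (p - 1) * r ^ p := by
    calc D * r ≤ (1 / c * r) ^ (p - 1) * r := by gcongr
      _ = (1 / c) ^ (p - 1) * (r ^ (p - 1) * r) := by
          rw [Real.mul_rpow (by positivity) hr, mul_assoc]
      _ = (1 / c) ^ (p - 1) * r ^ p := by
          rcases hr.eq_or_lt with rfl | hr
          · rw [Real.zero_rpow (by linarith : p ≠ 0), mul_zero]
          · rw [← Real.rpow_add_one hr.ne', sub_add_cancel]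
  have h6 : 0 ≤ D * (c * D ^ (1 / (p - 1))) := by positivity
  linarith

lemma hasDerivAt_exp_neg_mul {φ : ℝ → ℝ} {φ' t : ℝ} (h : HasDerivAt φ φ' t) :
    HasDerivAt (fun t => Real.exp (-t) * φ t) (Real.exp (-t) * (φ' - φ t)) t := by
  have h1 : HasDerivAt (fun t => Real.exp (-t)) (-Real.exp (-t)) t := by
    simpa using (hasDerivAt_id t).neg.exp
  convert! h1.mul h using 1
  ring

/-- Energy estimate. -/
lemma norm_sq_flow_le {B : H → H} (hB : ∀ x, 0 ≤ inner ℝ (B x) x) {f : H} {u : ℝ → H} {T : ℝ}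
    (hu : ∀ t ∈ Icc 0 T, HasDerivAt u (-B (u t) + f) t) {t : ℝ} (ht : t ∈ Icc 0 T) :
    Real.exp (-t) * ‖u t‖ ^ 2 ≤ ‖u 0‖ ^ 2 + ‖f‖ ^ 2 := by
  have hd : ∀ t ∈ Icc 0 T, HasDerivAt (fun t => Real.exp (-t) * (‖u t‖ ^ 2 + ‖f‖ ^ 2))
      (Real.exp (-t) * (2 * inner ℝ (u t) (-B (u t) + f) - (‖u t‖ ^ 2 + ‖f‖ ^ 2))) t :=
    fun t ht => hasDerivAt_exp_neg_mul ((hu t ht).norm_sq.add_const _)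
  -- The weight contributes `-(‖u‖² + ‖f‖²)`, which cancels the Young bound of `2⟨u, f⟩`.
  have hanti : AntitoneOn (fun t => Real.exp (-t) * (‖u t‖ ^ 2 + ‖f‖ ^ 2)) (Icc 0 T) := by
    refine antitoneOn_of_hasDerivWithinAt_nonpos (convex_Icc 0 T)
      (fun t ht => (hd t ht).continuousAt.continuousWithinAt)
      (fun t ht => (hd t (interior_subset ht)).hasDerivWithinAt) (fun t ht => ?_)
    refine mul_nonpos_of_nonneg_of_nonpos (Real.exp_pos _).le ?_
    have h1 := hB (u t)
    have h2 := real_inner_le_norm (u t) f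
    rw [inner_add_right, inner_neg_right, real_inner_comm]
    nlinarith [sq_nonneg (‖u t‖ - ‖f‖)]
  have h := hanti ⟨le_rfl, ht.1.trans ht.2⟩ ht ht.1
  simp only [neg_zero, Real.exp_zero, one_mul] at h
  have : 0 ≤ Real.exp (-t) * ‖f‖ ^ 2 := by positivity
  linarith

/-- Comparison of a Euler step with the flow of a perturbed operator. -/
lemma Cocoercive.step_error (hA : Cocoercive p c A) (hc : 0 < c) (hp1 : 1 < p)
    {B : H → H} {b f x : H} {u : ℝ → H} {a a' τ R Γ : ℝ} (ha : 0 ≤ a) (hτ : a' - a ≤ τ)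
    (hR : ‖A x - b‖ ≤ R)
    (hu : ∀ t ∈ Icc a a', HasDerivAt u (-B (u t) + f) t)
    (hΓ : ∀ t ∈ Icc a a', Real.exp (-t) * (‖b - f‖ + ‖A (u t) - B (u t)‖) ^ 2 ≤ Γ)
    {t : ℝ} (ht : t ∈ Icc a a') :
    Real.exp (-t) * ‖x - (t - a) • (A x - b) - u t‖ ^ 2 ≤
      Real.exp (-a) * ‖x - u a‖ ^ 2 +
        (t - a) * (2 * ((1 / c) ^ (p - 1) * (τ * R) ^ p) + Γ) := by
  set r := A x - b with hr
  set Λ := 2 * ((1 / c) ^ (p - 1) * (τ * R) ^ p) + Γ with hΛ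
  have hτ0 : 0 ≤ τ := by linarith [ht.1, ht.2]
  have hR0 : 0 ≤ R := (norm_nonneg _).trans hR
  -- The Euler polygon issued from `x`; its velocity is constant on the step.
  set y : ℝ → H := fun t => x - (t - a) • r with hy
  have hyd : ∀ t, HasDerivAt y (-r) t := fun t => by
    have := (((hasDerivAt_id t).sub_const a).smul_const r).const_sub x
    simpa using this
  have hd : ∀ t ∈ Icc a a', HasDerivAt (fun t => Real.exp (-t) * ‖y t - u t‖ ^ 2 - t * Λ)
      (Real.exp (-t) * (2 * inner ℝ (y t - u t) (-r - (-B (u t) + f)) - ‖y t - u t‖ ^ 2) - Λ) t :=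
    fun t ht => by
      have h1 := hasDerivAt_exp_neg_mul (((hyd t).sub (hu t ht)).norm_sq)
      have h2 := (hasDerivAt_id t).mul_const Λ
      rw [one_mul] at h2
      exact h1.sub h2
  have hanti : AntitoneOn (fun t => Real.exp (-t) * ‖y t - u t‖ ^ 2 - t * Λ) (Icc a a') := by
    refine antitoneOn_of_hasDerivWithinAt_nonpos (convex_Icc a a')
      (fun t ht => (hd t ht).continuousAt.continuousWithinAt)
      (fun t ht => (hd t (interior_subset ht)).hasDerivWithinAt) (fun t ht => ?_)
    replace ht := interior_subset ht
    set D := A x - A (u t) with hD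
    set z := b - f - (A (u t) - B (u t)) with hz
    have e1 : -r - (-B (u t) + f) = -D + z := by
      rw [hr, hD, hz]
      abel
    have e2 : y t - u t = (x - u t) - (t - a) • r := by
      simp only [hy]
      abel
    -- Co-coercivity controls the pairing of `D` with `x - u t`. The remaining pairing with `(t - a)
    -- • r` is at most `‖D‖ * (τ * R)` and is absorbed by Young's inequality.
    have e3 : inner ℝ (y t - u t) (-D) ≤ (1 / c) ^ (p - 1) * (τ * R) ^ p := by
      have h1 := hA x (u t)
      have h2 : inner ℝ ((t - a) • r) D ≤ ‖D‖ * (τ * R) := by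
        refine (real_inner_le_norm _ _).trans ?_
        rw [mul_comm, norm_smul, Real.norm_of_nonneg (sub_nonneg.2 ht.1)]
        gcongr
        linarith [ht.2]
      have h3 := mul_sub_rpow_conj_le hp1 hc (norm_nonneg D) (mul_nonneg hτ0 hR0)
      rw [inner_neg_right, e2, inner_sub_left, real_inner_comm D (x - u t)]
      linarith
    -- The consistency error `z` is paired with the full error; the term `-‖y t - u t‖ ^ 2` supplied
    -- by the weight absorbs the product.
    have e4 : 2 * inner ℝ (y t - u t) z - ‖y t - u t‖ ^ 2 ≤
        (‖b - f‖ + ‖A (u t) - B (u t)‖) ^ 2 := by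
      have h1 := real_inner_le_norm (y t - u t) z
      have h2 : ‖z‖ ≤ ‖b - f‖ + ‖A (u t) - B (u t)‖ := _root_.norm_sub_le _ _
      have h3 : ‖z‖ ^ 2 ≤ (‖b - f‖ + ‖A (u t) - B (u t)‖) ^ 2 := by gcongr
      nlinarith [sq_nonneg (‖y t - u t‖ - ‖z‖)]
    have e5 : Real.exp (-t) ≤ 1 := Real.exp_le_one_iff.2 (by linarith [ht.1])
    have e6 := hΓ t ht
    have e7 : 0 ≤ (1 / c) ^ (p - 1) * (τ * R) ^ p := by positivity
    rw [e1, inner_add_right]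
    calc Real.exp (-t) * (2 * (inner ℝ (y t - u t) (-D) + inner ℝ (y t - u t) z)
          - ‖y t - u t‖ ^ 2) - Λ
        = Real.exp (-t) * (2 * inner ℝ (y t - u t) (-D)) +
          Real.exp (-t) * (2 * inner ℝ (y t - u t) z - ‖y t - u t‖ ^ 2) - Λ := by ring
      _ ≤ Real.exp (-t) * (2 * ((1 / c) ^ (p - 1) * (τ * R) ^ p)) +
          Real.exp (-t) * (‖b - f‖ + ‖A (u t) - B (u t)‖) ^ 2 - Λ := by gcongr
      _ ≤ 1 * (2 * ((1 / c) ^ (p - 1) * (τ * R) ^ p)) + Γ - Λ := by gcongr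
      _ = 0 := by rw [hΛ]; ring
  have h := hanti ⟨le_rfl, ht.1.trans ht.2⟩ ht ht.1
  simp only [hy, sub_self, zero_smul, sub_zero] at h
  linarith

/-- The forward Euler scheme in `H` on a time grid. -/
def IsEuler {T : ℝ} {N : ℕ} (θ : TimeGrid T N) (A : H → H) (b : H) (x : Fin (N + 1) → H) : Prop :=
  ∀ k : Fin N, x k.succ = x k.castSucc - θ.step k • (A (x k.castSucc) - b)

end Cocoercive

/-! ### Forward Euler in a Hilbert space on a time grid: error, growth and stability. -/

section Grid

open Set

variable {T : ℝ} {N : ℕ} (θ : TimeGrid T N)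

lemma TimeGrid.step_pos (k : Fin N) : 0 < θ.step k :=
  sub_pos.2 (θ.strictMono k.castSucc_lt_succ)

lemma TimeGrid.step_le_tau (k : Fin N) : θ.step k ≤ θ.tau :=
  le_ciSup (Finite.bddAbove_range fun k => θ.step k) k

lemma TimeGrid.tau_nonneg : 0 ≤ θ.tau :=
  Real.iSup_nonneg fun k => (θ.step_pos k).le

lemma TimeGrid.t_mem (k : Fin (N + 1)) : θ.t k ∈ Icc 0 T := by
  constructor
  · rw [← θ.t_zero]
    exact θ.strictMono.monotone (Fin.zero_le k)
  · exact (θ.strictMono.monotone (Fin.le_last k)).trans_eq θ.t_last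

variable {H : Type*} [NormedAddCommGroup H] [InnerProductSpace ℝ H] {p c : ℝ} {A : H → H}
  {θ} {b : H} {x : Fin (N + 1) → H}

/-- Error estimate for the forward Euler scheme with a perturbed operator. -/
theorem Cocoercive.euler_error (hA : Cocoercive p c A) (hc : 0 < c) (hp1 : 1 < p)
    (hx : IsEuler θ A b x) {R Γ : ℝ} (hR : ∀ k : Fin N, ‖A (x k.castSucc) - b‖ ≤ R)
    {B : H → H} {f : H} {u : ℝ → H} (hu : ∀ t ∈ Icc 0 T, HasDerivAt u (-B (u t) + f) t)
    (hΓ : ∀ t ∈ Icc 0 T, Real.exp (-t) * (‖b - f‖ + ‖A (u t) - B (u t)‖) ^ 2 ≤ Γ)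
    (k : Fin N) {t : ℝ} (ht : t ∈ Icc (θ.t k.castSucc) (θ.t k.succ)) :
    ‖x k.castSucc - u t‖ ≤ Real.exp (T / 2) * (‖x 0 - u 0‖ +
      Real.sqrt T * Real.sqrt (2 * ((1 / c) ^ (p - 1) * (θ.tau * R) ^ p) + Γ)) + θ.tau * R := by
  set Λ := 2 * ((1 / c) ^ (p - 1) * (θ.tau * R) ^ p) + Γ with hΛ
  have hR0 : 0 ≤ R := (norm_nonneg _).trans (hR k)
  have hT : 0 ≤ T := (θ.t_mem 0).1.trans (θ.t_mem 0).2
  have hΓ0 : 0 ≤ Γ := le_trans (by positivity) (hΓ 0 ⟨le_rfl, hT⟩)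
  have hτ0 := θ.tau_nonneg
  have hΛ0 : 0 ≤ Λ := by positivity
  have hsub : ∀ k : Fin N, Icc (θ.t k.castSucc) (θ.t k.succ) ⊆ Icc 0 T := fun k =>
    Icc_subset_Icc (θ.t_mem _).1 (θ.t_mem _).2
  have hstep : ∀ k : Fin N, ∀ t ∈ Icc (θ.t k.castSucc) (θ.t k.succ),
      Real.exp (-t) * ‖x k.castSucc - (t - θ.t k.castSucc) • (A (x k.castSucc) - b) - u t‖ ^ 2 ≤
      Real.exp (-θ.t k.castSucc) * ‖x k.castSucc - u (θ.t k.castSucc)‖ ^ 2 +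
        (t - θ.t k.castSucc) * Λ := fun k t ht =>
    hA.step_error hc hp1 (θ.t_mem _).1 (θ.step_le_tau k) (hR k)
      (fun t ht => hu t (hsub k ht)) (fun t ht => hΓ t (hsub k ht)) ht
  -- The step estimates telescope, because the weight at the end of one step is the weight at the
  -- start of the next.
  have hnode : ∀ k : Fin (N + 1), Real.exp (-θ.t k) * ‖x k - u (θ.t k)‖ ^ 2 ≤
      ‖x 0 - u 0‖ ^ 2 + θ.t k * Λ := by
    intro k
    induction k using Fin.induction with
    | zero => simp [θ.t_zero]
    | succ k ih =>
      have h := hstep k (θ.t k.succ) ⟨(θ.strictMono k.castSucc_lt_succ).le, le_rfl⟩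
      have h2 := hx k
      rw [TimeGrid.step] at h2
      rw [← h2] at h
      linarith
  have h1 := hstep k t ht
  have h2 := hnode k.castSucc
  have htT := hsub k ht
  set y := x k.castSucc - (t - θ.t k.castSucc) • (A (x k.castSucc) - b) with hy
  have h3 : ‖y - u t‖ ^ 2 ≤ Real.exp T * (‖x 0 - u 0‖ ^ 2 + T * Λ) := by
    have h4 : Real.exp (-t) * ‖y - u t‖ ^ 2 ≤ ‖x 0 - u 0‖ ^ 2 + t * Λ := by linarith
    calc ‖y - u t‖ ^ 2 = Real.exp t * (Real.exp (-t) * ‖y - u t‖ ^ 2) := by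
          rw [← mul_assoc, ← Real.exp_add]
          simp
      _ ≤ Real.exp T * (‖x 0 - u 0‖ ^ 2 + T * Λ) := by
          have := htT.2
          have : t * Λ ≤ T * Λ := by gcongr
          gcongr
          linarith
  have h5 : ‖y - u t‖ ≤ Real.exp (T / 2) * (‖x 0 - u 0‖ + Real.sqrt T * Real.sqrt Λ) := by
    refine le_of_sq_le_sq (h3.trans ?_) (by positivity)
    rw [mul_pow, ← Real.exp_nat_mul]
    have e1 : ((2 : ℕ) : ℝ) * (T / 2) = T := by push_cast; ring
    rw [e1]
    gcongr
    have e2 := Real.sq_sqrt hT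
    have e3 := Real.sq_sqrt hΛ0
    have e4 : (Real.sqrt T * Real.sqrt Λ) ^ 2 = T * Λ := by rw [mul_pow, e2, e3]
    have e5 : 0 ≤ ‖x 0 - u 0‖ * (Real.sqrt T * Real.sqrt Λ) := by positivity
    nlinarith
  -- The statement concerns the node value, constant on the step, and not the polygon; the
  -- difference is one partial step.
  have h6 : ‖x k.castSucc - y‖ ≤ θ.tau * R := by
    have : x k.castSucc - y = (t - θ.t k.castSucc) • (A (x k.castSucc) - b) := by
      rw [hy]; abel
    rw [this, norm_smul, Real.norm_of_nonneg (sub_nonneg.2 ht.1)]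
    have h7 := hR k
    have h8 := θ.step_le_tau k
    rw [TimeGrid.step] at h8
    gcongr
    linarith [ht.2]
  have h9 := norm_add_le (x k.castSucc - y) (y - u t)
  rw [sub_add_sub_cancel] at h9
  linarith

/-- Discrete Gronwall bound. -/
lemma IsEuler.norm_le {L : ℝ} (hL : ∀ v, ‖A v - b‖ ≤ L * (1 + ‖v‖))
    (hx : IsEuler θ A b x) (k : Fin (N + 1)) :
    1 + ‖x k‖ ≤ (1 + ‖x 0‖) * Real.exp (L * θ.t k) := by
  induction k using Fin.induction with
  | zero => simp [θ.t_zero]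
  | succ k ih =>
    have hs := (θ.step_pos k).le
    have h1 : ‖x k.succ‖ ≤ ‖x k.castSucc‖ + θ.step k * (L * (1 + ‖x k.castSucc‖)) := by
      rw [hx k]
      refine (norm_sub_le _ _).trans ?_
      rw [norm_smul, Real.norm_of_nonneg hs]
      gcongr
      exact hL _
    calc 1 + ‖x k.succ‖ ≤ (1 + ‖x k.castSucc‖) * (L * θ.step k + 1) := by linarith
      _ ≤ (1 + ‖x k.castSucc‖) * Real.exp (L * θ.step k) := by
          gcongr
          exact Real.add_one_le_exp _
      _ ≤ ((1 + ‖x 0‖) * Real.exp (L * θ.t k.castSucc)) * Real.exp (L * θ.step k) := by gcongr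
      _ = (1 + ‖x 0‖) * Real.exp (L * θ.t k.succ) := by
          rw [mul_assoc, ← Real.exp_add, TimeGrid.step]
          ring_nf

/-- The residuals of the scheme do not increase if `p = 2` and the steps are small. -/
lemma IsEuler.norm_residual_le (hA : Cocoercive 2 c A) (hx : IsEuler θ A b x)
    (hτ : θ.tau ≤ 2 * c) (k : Fin (N + 1)) : ‖A (x k) - b‖ ≤ ‖A (x 0) - b‖ := by
  induction k using Fin.induction with
  | zero => exact le_rfl
  | succ k ih =>
    refine le_trans ?_ ih
    have hs := θ.step_pos k
    have hs' := (θ.step_le_tau k).trans hτ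
    have h := hA (x k.succ) (x k.castSucc)
    set r := A (x k.castSucc) - b with hr
    set D := A (x k.succ) - A (x k.castSucc) with hD
    have e1 : x k.succ - x k.castSucc = -(θ.step k • r) := by
      rw [hx k]
      abel
    have e2 : A (x k.succ) - b = r + D := by
      rw [hr, hD]
      abel
    rw [e1, inner_neg_right, inner_smul_right, show (2 : ℝ) / (2 - 1) = (2 : ℕ) by norm_num,
      Real.rpow_natCast] at h
    rw [e2]
    refine le_of_sq_le_sq ?_ (norm_nonneg _)
    rw [@norm_add_sq_real, real_inner_comm]
    -- Co-coercivity only controls `⟨D, r⟩` multiplied by the step, so the expansion of `‖r + D‖²`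
    -- is multiplied by the step as well.
    have e3 : θ.step k * ‖D‖ ^ 2 ≤ 2 * c * ‖D‖ ^ 2 := by gcongr
    have e4 : θ.step k * (2 * inner ℝ D r + ‖D‖ ^ 2) ≤ θ.step k * 0 := by linarith
    have := le_of_mul_le_mul_left e4 hs
    linarith

/-- Stability of the scheme without source term under the nonlinear CFL condition. -/
lemma IsEuler.norm_le_of_cfl (hp1 : 1 < p) (hp2 : p ≤ 2) (hx : IsEuler θ A 0 x)
    (h : ∀ k : Fin N, A (x k.castSucc) = 0 ∨ ∃ c, θ.step k ≤
        2 * c * ‖A (x k.castSucc)‖ ^ ((2 - p) / (p - 1)) ∧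
      c * ‖A (x k.castSucc)‖ ^ (p / (p - 1)) ≤ inner ℝ (A (x k.castSucc)) (x k.castSucc))
    (k : Fin (N + 1)) : ‖x k‖ ≤ ‖x 0‖ := by
  induction k using Fin.induction with
  | zero => exact le_rfl
  | succ k ih =>
    refine le_trans ?_ ih
    have hk := hx k
    rw [sub_zero] at hk
    rcases h k with h0 | ⟨c, h1, h2⟩
    · rw [hk, h0, smul_zero, sub_zero]
    · rw [hk]
      have hs := θ.step_pos k
      refine le_of_sq_le_sq ?_ (norm_nonneg _)
      set z := A (x k.castSucc)
      have e1 : ‖z‖ ^ (p / (p - 1)) = ‖z‖ ^ ((2 - p) / (p - 1)) * ‖z‖ ^ 2 := by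
        have hp : 0 < p - 1 := by linarith
        rw [← Real.rpow_natCast ‖z‖ 2, ← Real.rpow_add_of_nonneg (norm_nonneg z)
          (div_nonneg (by linarith) hp.le) (by norm_num)]
        congr 1
        push_cast
        field_simp
        ring
      rw [@norm_sub_sq_real, inner_smul_right, norm_smul, Real.norm_of_nonneg hs.le,
        real_inner_comm]
      rw [e1] at h2
      -- This is equivalent to `‖x - τ z‖ ≤ ‖x‖`. The exponent in the CFL condition is the one that
      -- lowers `p/(p-1)` to 2.
      have e2 : θ.step k * ‖z‖ ^ 2 ≤ 2 * inner ℝ z (x k.castSucc) := by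
        have : θ.step k * ‖z‖ ^ 2 ≤ (2 * c * ‖z‖ ^ ((2 - p) / (p - 1))) * ‖z‖ ^ 2 := by gcongr
        linarith
      have e3 := mul_le_mul_of_nonneg_left e2 hs.le
      nlinarith

end Grid

/-! ### Kernel operators -/

section KernelOp

open Set Filter
open scoped NNReal

lemma volume_Om (d : ℕ) : volume (Om d) = 1 := by
  rw [Om, Real.volume_Icc_pi]
  simp

instance isProbabilityMeasure_muOm (d : ℕ) : IsProbabilityMeasure (muOm d) :=
  ⟨by rw [muOm, Measure.restrict_apply_univ, volume_Om]⟩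

lemma muOm2_eq (d : ℕ) : muOm2 d = (muOm d).prod (muOm d) := by
  rw [muOm2, muOm, Measure.prod_restrict]
  rfl

variable {d : ℕ} {p : ℝ} {K : Pt d → Pt d → ℝ} {M : ℝ≥0}

/-- A nonnegative symmetric measurable kernel with `L^{∞,1}` norm at most `M`. -/
structure IsKernel (K : Pt d → Pt d → ℝ) (M : ℝ≥0) : Prop where
  meas : Measurable (Function.uncurry K)
  nonneg : ∀ x y, 0 ≤ K x y
  symm : ∀ x y, K x y = K y x
  bound : normInf K 1 ≤ M

lemma IsKernel.ae_lintegral_le (hK : IsKernel K M) :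
    ∀ᵐ x ∂(muOm d), ∫⁻ y, ‖K x y‖ₑ ∂(muOm d) ≤ M := by
  filter_upwards [ae_le_essSup (f := fun x => eLpNorm (K x) 1 (muOm d))] with x hx
  rw [← eLpNorm_one_eq_lintegral_enorm]
  exact hx.trans hK.bound

/-- By Tonelli, a bound of `∫ K(x,y) dy` uniform in `x` is all that is needed. Together with its
mirror image it makes a function of both variables integrable against `K` once it is dominated by a
sum of functions of one variable. -/
lemma IsKernel.integrable_mul_fst (hK : IsKernel K M) {φ : Pt d → ℝ}
    (hφ : Integrable φ (muOm d)) :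
    Integrable (fun z : Pt d × Pt d => K z.1 z.2 * φ z.1) ((muOm d).prod (muOm d)) := by
  have hm : AEStronglyMeasurable (fun z : Pt d × Pt d => K z.1 z.2 * φ z.1)
      ((muOm d).prod (muOm d)) :=
    hK.meas.aestronglyMeasurable.mul hφ.aestronglyMeasurable.comp_fst
  refine ⟨hm, ?_⟩
  rw [HasFiniteIntegral, lintegral_prod _ hm.enorm]
  calc ∫⁻ x, ∫⁻ y, ‖K x y * φ x‖ₑ ∂(muOm d) ∂(muOm d)
      ≤ ∫⁻ x, M * ‖φ x‖ₑ ∂(muOm d) := by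
        apply lintegral_mono_ae
        filter_upwards [hK.ae_lintegral_le] with x hx
        simp only [enorm_mul]
        rw [lintegral_mul_const' _ _ enorm_ne_top]
        gcongr
    _ = M * ∫⁻ x, ‖φ x‖ₑ ∂(muOm d) := lintegral_const_mul' _ _ ENNReal.coe_ne_top
    _ < ⊤ := ENNReal.mul_lt_top ENNReal.coe_lt_top hφ.hasFiniteIntegral

lemma IsKernel.integrable_mul_snd (hK : IsKernel K M) {φ : Pt d → ℝ}
    (hφ : Integrable φ (muOm d)) :
    Integrable (fun z : Pt d × Pt d => K z.1 z.2 * φ z.2) ((muOm d).prod (muOm d)) := by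
  refine (hK.integrable_mul_fst hφ).swap.congr (Eventually.of_forall fun z => ?_)
  simp [Function.comp, hK.symm z.2 z.1]

lemma aestronglyMeasurable_psi_sub {u : Pt d → ℝ} (hu : AEStronglyMeasurable u (muOm d)) :
    AEStronglyMeasurable (fun z : Pt d × Pt d => Psi p (u z.2 - u z.1))
      ((muOm d).prod (muOm d)) :=
  (measurable_psi.comp_aemeasurable
    (hu.comp_snd.sub hu.comp_fst).aemeasurable).aestronglyMeasurable

lemma IsKernel.integrable_psi (hK : IsKernel K M) (hp1 : 1 < p) (hp2 : p ≤ 2) {u : Pt d → ℝ}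
    (hu : Integrable u (muOm d)) :
    Integrable (fun z : Pt d × Pt d => K z.1 z.2 * Psi p (u z.2 - u z.1))
      ((muOm d).prod (muOm d)) := by
  have h1 := ((hK.integrable_mul_fst (integrable_const (1 : ℝ))).add
    (hK.integrable_mul_fst hu.abs)).add (hK.integrable_mul_snd hu.abs)
  refine h1.mono' (hK.meas.aestronglyMeasurable.mul
    (aestronglyMeasurable_psi_sub hu.aestronglyMeasurable)) (Eventually.of_forall fun z => ?_)
  rw [norm_mul, Real.norm_of_nonneg (hK.nonneg _ _), Real.norm_eq_abs]
  have h2 := abs_psi_sub_le hp1 hp2 (u z.2) (u z.1)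
  have h3 := mul_le_mul_of_nonneg_left h2 (hK.nonneg z.1 z.2)
  simp only [Pi.add_apply]
  linarith

lemma IsKernel.integrable_plap (hK : IsKernel K M) (hp1 : 1 < p) (hp2 : p ≤ 2) {u : Pt d → ℝ}
    (hu : Integrable u (muOm d)) : Integrable (plap K p u) (muOm d) :=
  (hK.integrable_psi hp1 hp2 hu).integral_prod_left.neg

lemma IsKernel.ae_plap_sub (hK : IsKernel K M) (hp1 : 1 < p) (hp2 : p ≤ 2) {u v : Pt d → ℝ}
    (hu : Integrable u (muOm d)) (hv : Integrable v (muOm d)) :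
    ∀ᵐ x ∂(muOm d), plap K p u x - plap K p v x =
      -∫ y, K x y * (Psi p (u y - u x) - Psi p (v y - v x)) ∂(muOm d) := by
  filter_upwards [(hK.integrable_psi hp1 hp2 hu).prod_right_ae,
    (hK.integrable_psi hp1 hp2 hv).prod_right_ae] with x h1 h2
  simp only [mul_sub]
  rw [integral_sub h1 h2, plap, plap]
  ring

/-- Integration by parts against an antisymmetric function. -/
lemma IsKernel.integral_mul_eq (hK : IsKernel K M) {D : Pt d → Pt d → ℝ}
    (hD : ∀ x y, D x y = -D y x) {w : Pt d → ℝ}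
    (hi : Integrable (fun z : Pt d × Pt d => K z.1 z.2 * D z.1 z.2 * w z.1)
      ((muOm d).prod (muOm d))) :
    ∫ x, (-∫ y, K x y * D x y ∂(muOm d)) * w x ∂(muOm d) =
      1 / 2 * ∫ z, K z.1 z.2 * (D z.1 z.2 * (w z.2 - w z.1)) ∂((muOm d).prod (muOm d)) := by
  have hi2 : Integrable (fun z : Pt d × Pt d => K z.1 z.2 * D z.1 z.2 * w z.2)
      ((muOm d).prod (muOm d)) := by
    refine hi.swap.neg.congr (Eventually.of_forall fun z => ?_)
    simp only [Pi.neg_apply, Function.comp, Prod.fst_swap, Prod.snd_swap]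
    rw [hK.symm z.2 z.1, hD z.2 z.1]
    ring
  have e1 : ∫ x, (-∫ y, K x y * D x y ∂(muOm d)) * w x ∂(muOm d) =
      -∫ z, K z.1 z.2 * D z.1 z.2 * w z.1 ∂((muOm d).prod (muOm d)) := by
    rw [integral_prod _ hi, ← integral_neg]
    congr 1
    ext x
    rw [neg_mul, ← integral_mul_const]
  have e2 : ∫ z, K z.1 z.2 * D z.1 z.2 * w z.2 ∂((muOm d).prod (muOm d)) =
      -∫ z, K z.1 z.2 * D z.1 z.2 * w z.1 ∂((muOm d).prod (muOm d)) := by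
    rw [← integral_prod_swap, ← integral_neg]
    congr 1
    ext z
    simp only [Prod.fst_swap, Prod.snd_swap]
    rw [hK.symm z.2 z.1, hD z.2 z.1]
    ring
  have e3 : ∫ z, K z.1 z.2 * (D z.1 z.2 * (w z.2 - w z.1)) ∂((muOm d).prod (muOm d)) =
      ∫ z, K z.1 z.2 * D z.1 z.2 * w z.2 ∂((muOm d).prod (muOm d)) -
      ∫ z, K z.1 z.2 * D z.1 z.2 * w z.1 ∂((muOm d).prod (muOm d)) := by
    rw [← integral_sub hi2 hi]
    congr 1
    ext z
    ring
  rw [e1, e3, e2]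
  ring

lemma psi_sub_antisymm (u v : Pt d → ℝ) (x y : Pt d) :
    Psi p (u y - u x) - Psi p (v y - v x) = -(Psi p (u x - u y) - Psi p (v x - v y)) := by
  rw [← neg_sub (u x), ← neg_sub (v x), psi_neg, psi_neg]
  ring

/-- The products are split by Young's inequality so that no term couples the two points: the first
group belongs to `x`, the second to `y`, as required by `IsKernel.integrable_mul_fst` and
`IsKernel.integrable_mul_snd`. -/
lemma abs_psi_sub_mul_le (hp1 : 1 < p) (hp2 : p ≤ 2) (a b a' b' w : ℝ) :
    |(Psi p (a - b) - Psi p (a' - b')) * w| ≤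
      (2 + 2 * b ^ 2 + 2 * b' ^ 2 + 2 * w ^ 2) + (a ^ 2 + a' ^ 2) := by
  have h1 := abs_psi_sub_le hp1 hp2 a b
  have h2 := abs_psi_sub_le hp1 hp2 a' b'
  have h3 := abs_sub (Psi p (a - b)) (Psi p (a' - b'))
  rw [abs_mul]
  have h4 : |Psi p (a - b) - Psi p (a' - b')| * |w| ≤
      ((1 + |a| + |b|) + (1 + |a'| + |b'|)) * |w| := by
    gcongr
    linarith
  have ha := sq_abs a
  have hb := sq_abs b
  have ha' := sq_abs a'
  have hb' := sq_abs b'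
  have hw := sq_abs w
  nlinarith [sq_nonneg (|a| - |w| / 2), sq_nonneg (|b| - |w| / 2), sq_nonneg (|a'| - |w| / 2),
    sq_nonneg (|b'| - |w| / 2), sq_nonneg (2 - |w|), abs_nonneg w, sq_nonneg (|w|)]

lemma IsKernel.integrable_psi_sub_mul (hK : IsKernel K M) (hp1 : 1 < p) (hp2 : p ≤ 2)
    {u v w : Pt d → ℝ} (hu : MemLp u 2 (muOm d)) (hv : MemLp v 2 (muOm d))
    (hw : MemLp w 2 (muOm d)) :
    Integrable (fun z : Pt d × Pt d =>
      K z.1 z.2 * (Psi p (u z.2 - u z.1) - Psi p (v z.2 - v z.1)) * w z.1)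
      ((muOm d).prod (muOm d)) := by
  have h1 := (hK.integrable_mul_fst ((((integrable_const (2 : ℝ)).add
    (hu.integrable_sq.const_mul 2)).add (hv.integrable_sq.const_mul 2)).add
    (hw.integrable_sq.const_mul 2))).add
    (hK.integrable_mul_snd (hu.integrable_sq.add hv.integrable_sq))
  refine h1.mono' ((hK.meas.aestronglyMeasurable.mul
    ((aestronglyMeasurable_psi_sub hu.1).sub (aestronglyMeasurable_psi_sub hv.1))).mul
    hw.1.comp_fst) (Eventually.of_forall fun z => ?_)
  rw [mul_assoc, norm_mul, Real.norm_of_nonneg (hK.nonneg _ _), Real.norm_eq_abs]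
  have h2 := abs_psi_sub_mul_le hp1 hp2 (u z.2) (u z.1) (v z.2) (v z.1) (w z.1)
  have h3 := mul_le_mul_of_nonneg_left h2 (hK.nonneg z.1 z.2)
  simp only [Pi.add_apply]
  linarith

/-- A weighted power mean inequality. -/
lemma lintegral_weighted_rpow_le {α : Type*} [MeasurableSpace α] {ν : Measure α} (hp1 : 1 < p)
    {k h : α → ℝ≥0∞} (hk : AEMeasurable k ν) (hh : AEMeasurable h ν) :
    (∫⁻ y, k y * h y ∂ν) ^ (p / (p - 1)) ≤
      (∫⁻ y, k y ∂ν) ^ (1 / (p - 1)) * ∫⁻ y, k y * h y ^ (p / (p - 1)) ∂ν := by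
  have hp : 0 < p - 1 := by linarith
  have hp0 : 0 < p := by linarith
  have hpq : p.HolderConjugate (p / (p - 1)) := Real.HolderConjugate.conjExponent hp1
  have hq : 0 < p / (p - 1) := by positivity
  -- Hölder's inequality after writing the weight as `k^(1/p) * k^(1/q)` with `q = p/(p-1)`.
  have h1 := ENNReal.lintegral_mul_le_Lp_mul_Lq ν hpq (f := fun y => k y ^ (1 / p))
    (g := fun y => k y ^ (1 / (p / (p - 1))) * h y) (hk.pow_const _) ((hk.pow_const _).mul hh)
  have e1 : ∀ y, ((fun y => k y ^ (1 / p)) * fun y => k y ^ (1 / (p / (p - 1))) * h y) y =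
      k y * h y := fun y => by
    simp only [Pi.mul_apply]
    rw [← mul_assoc, ← ENNReal.rpow_add_of_nonneg _ _ (by positivity) (by positivity)]
    rw [show 1 / p + 1 / (p / (p - 1)) = 1 by field_simp; ring, ENNReal.rpow_one]
  have e2 : ∀ y, (k y ^ (1 / p)) ^ p = k y := fun y => by
    rw [← ENNReal.rpow_mul, one_div_mul_cancel hp0.ne', ENNReal.rpow_one]
  have e3 : ∀ y, (k y ^ (1 / (p / (p - 1))) * h y) ^ (p / (p - 1)) =
      k y * h y ^ (p / (p - 1)) := fun y => by
    rw [ENNReal.mul_rpow_of_nonneg _ _ hq.le, ← ENNReal.rpow_mul, one_div_mul_cancel hq.ne',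
      ENNReal.rpow_one]
  simp only [e1, e2, e3] at h1
  have h2 := ENNReal.rpow_le_rpow h1 hq.le
  rw [ENNReal.mul_rpow_of_nonneg _ _ hq.le, ← ENNReal.rpow_mul, ← ENNReal.rpow_mul,
    one_div_mul_cancel hq.ne', ENNReal.rpow_one] at h2
  rwa [show 1 / p * (p / (p - 1)) = 1 / (p - 1) by field_simp] at h2

/-- Since `p/(p-1) ≥ 2` and `Ω` has measure 1, the `L²` norm is at most the `L^{p/(p-1)}` norm, to
which the weighted power mean inequality applies for almost every `x`. -/
lemma IsKernel.eLpNorm_rpow_le (hK : IsKernel K M) (hp1 : 1 < p) (hp2 : p ≤ 2)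
    {D : Pt d → Pt d → ℝ}
    (hD : AEStronglyMeasurable (Function.uncurry D) ((muOm d).prod (muOm d))) :
    eLpNorm (fun x => -∫ y, K x y * D x y ∂(muOm d)) 2 (muOm d) ^ (p / (p - 1)) ≤
      (M : ℝ≥0∞) ^ (1 / (p - 1)) *
        ∫⁻ z, ‖K z.1 z.2‖ₑ * ‖D z.1 z.2‖ₑ ^ (p / (p - 1)) ∂((muOm d).prod (muOm d)) := by
  have hp : 0 < p - 1 := by linarith
  have hq : 0 < p / (p - 1) := lt_trans one_pos (one_lt_conj hp1)
  set F : Pt d → ℝ := fun x => -∫ y, K x y * D x y ∂(muOm d) with hF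
  have hFm : AEStronglyMeasurable F (muOm d) :=
    (hK.meas.aestronglyMeasurable.mul hD).integral_prod_right'.neg
  have h1 : eLpNorm F 2 (muOm d) ≤ eLpNorm F (ENNReal.ofReal (p / (p - 1))) (muOm d) := by
    refine eLpNorm_le_eLpNorm_of_exponent_le ?_ hFm
    rw [ENNReal.le_ofReal_iff_toReal_le (by simp) hq.le]
    simpa using two_le_conj hp1 hp2
  refine (ENNReal.rpow_le_rpow h1 hq.le).trans ?_
  rw [eLpNorm_eq_lintegral_rpow_enorm_toReal (by simpa using hq) (by simp),
    ENNReal.toReal_ofReal hq.le, ← ENNReal.rpow_mul, one_div_mul_cancel hq.ne', ENNReal.rpow_one,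
    lintegral_prod (fun z : Pt d × Pt d => ‖K z.1 z.2‖ₑ * ‖D z.1 z.2‖ₑ ^ (p / (p - 1)))
      (hK.meas.enorm.aemeasurable.mul (hD.enorm.pow_const _)),
    ← lintegral_const_mul' _ _ (by simp [hp1.le])]
  apply lintegral_mono_ae
  filter_upwards [hK.ae_lintegral_le, hD.prodMk_left] with x hx hDx
  calc ‖F x‖ₑ ^ (p / (p - 1)) ≤ (∫⁻ y, ‖K x y‖ₑ * ‖D x y‖ₑ ∂(muOm d)) ^ (p / (p - 1)) := by
        gcongr
        rw [hF]
        simp only [enorm_neg]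
        refine (enorm_integral_le_lintegral_enorm _).trans_eq ?_
        simp only [enorm_mul]
    _ ≤ (∫⁻ y, ‖K x y‖ₑ ∂(muOm d)) ^ (1 / (p - 1)) *
          ∫⁻ y, ‖K x y‖ₑ * ‖D x y‖ₑ ^ (p / (p - 1)) ∂(muOm d) :=
        lintegral_weighted_rpow_le hp1
          (hK.meas.comp measurable_prodMk_left).enorm.aemeasurable hDx.enorm
    _ ≤ (M : ℝ≥0∞) ^ (1 / (p - 1)) *
          ∫⁻ y, ‖K x y‖ₑ * ‖D x y‖ₑ ^ (p / (p - 1)) ∂(muOm d) := by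
        gcongr

/-- The scalar constant `s` is a parameter because two values occur: the general one from
`psi_cocoercive`, and `s = 1` when `v = 0`. The norm is kept extended-valued, since its finiteness
is not yet known and is deduced from this inequality. -/
lemma IsKernel.coercive_aux (hK : IsKernel K M) (hp1 : 1 < p) (hp2 : p ≤ 2)
    {u v : Pt d → ℝ} (hu : MemLp u 2 (muOm d)) (hv : MemLp v 2 (muOm d)) {s : ℝ} (hs : 0 < s)
    (hsD : ∀ x y, s * |Psi p (u y - u x) - Psi p (v y - v x)| ^ (p / (p - 1)) ≤
      (Psi p (u y - u x) - Psi p (v y - v x)) * ((u y - u x) - (v y - v x))) :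
    0 ≤ ∫ x, (plap K p u x - plap K p v x) * (u x - v x) ∂(muOm d) ∧
    ENNReal.ofReal (s / 2) *
        eLpNorm (fun x => plap K p u x - plap K p v x) 2 (muOm d) ^ (p / (p - 1)) ≤
      ENNReal.ofReal ((M : ℝ) ^ (1 / (p - 1)) *
        ∫ x, (plap K p u x - plap K p v x) * (u x - v x) ∂(muOm d)) := by
  have hq : 0 < p / (p - 1) := lt_trans one_pos (one_lt_conj hp1)
  have hui := hu.integrable one_le_two
  have hvi := hv.integrable one_le_two
  set D : Pt d → Pt d → ℝ := fun x y => Psi p (u y - u x) - Psi p (v y - v x) with hD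
  have hDm : AEStronglyMeasurable (Function.uncurry D) ((muOm d).prod (muOm d)) :=
    (aestronglyMeasurable_psi_sub hu.1).sub (aestronglyMeasurable_psi_sub hv.1)
  have hae := hK.ae_plap_sub hp1 hp2 hui hvi
  have hi := hK.integrable_psi_sub_mul hp1 hp2 hu hv (hu.sub hv)
  have e1 : ∫ x, (plap K p u x - plap K p v x) * (u x - v x) ∂(muOm d) =
      1 / 2 * ∫ z, K z.1 z.2 * (D z.1 z.2 * ((u - v) z.2 - (u - v) z.1))
        ∂((muOm d).prod (muOm d)) := by
    rw [← hK.integral_mul_eq (psi_sub_antisymm u v) hi]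
    apply integral_congr_ae
    filter_upwards [hae] with x hx
    rw [hx]
    rfl
  have e2 : eLpNorm (fun x => plap K p u x - plap K p v x) 2 (muOm d) =
      eLpNorm (fun x => -∫ y, K x y * D x y ∂(muOm d)) 2 (muOm d) := eLpNorm_congr_ae hae
  have hpt : ∀ z : Pt d × Pt d, s * (K z.1 z.2 * |D z.1 z.2| ^ (p / (p - 1))) ≤
      K z.1 z.2 * (D z.1 z.2 * ((u - v) z.2 - (u - v) z.1)) := fun z => by
    have h1 := mul_le_mul_of_nonneg_left (hsD z.1 z.2) (hK.nonneg z.1 z.2)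
    simp only [hD, Pi.sub_apply]
    calc _ = K z.1 z.2 * (s * |Psi p (u z.2 - u z.1) - Psi p (v z.2 - v z.1)| ^ (p / (p - 1))) := by
          ring
      _ ≤ _ := h1
      _ = _ := by ring
  have hpos : ∀ z : Pt d × Pt d, 0 ≤ K z.1 z.2 * (D z.1 z.2 * ((u - v) z.2 - (u - v) z.1)) :=
    fun z => le_trans (mul_nonneg hs.le (mul_nonneg (hK.nonneg _ _) (by positivity))) (hpt z)
  -- The symmetrized integrand is the original one, with opposite sign, minus its image under the
  -- swap.
  have hi2 : Integrable (fun z : Pt d × Pt d =>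
      K z.1 z.2 * (D z.1 z.2 * ((u - v) z.2 - (u - v) z.1))) ((muOm d).prod (muOm d)) := by
    refine (hi.neg.sub hi.swap).congr (Eventually.of_forall fun z => ?_)
    simp only [Pi.neg_apply, Function.comp, Prod.fst_swap, Prod.snd_swap, Pi.sub_apply, hD]
    rw [hK.symm z.2 z.1, psi_sub_antisymm u v z.2 z.1]
    ring
  rw [e1, e2]
  refine ⟨mul_nonneg (by norm_num) (integral_nonneg hpos), ?_⟩
  calc ENNReal.ofReal (s / 2) *
        eLpNorm (fun x => -∫ y, K x y * D x y ∂(muOm d)) 2 (muOm d) ^ (p / (p - 1))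
      ≤ ENNReal.ofReal (s / 2) * ((M : ℝ≥0∞) ^ (1 / (p - 1)) *
        ∫⁻ z, ‖K z.1 z.2‖ₑ * ‖D z.1 z.2‖ₑ ^ (p / (p - 1)) ∂((muOm d).prod (muOm d))) := by
        gcongr
        exact hK.eLpNorm_rpow_le hp1 hp2 hDm
    _ = ENNReal.ofReal ((M : ℝ) ^ (1 / (p - 1)) / 2) * ∫⁻ z, ENNReal.ofReal
          (s * (K z.1 z.2 * |D z.1 z.2| ^ (p / (p - 1)))) ∂((muOm d).prod (muOm d)) := by
        have h1 : ∀ z : Pt d × Pt d, ENNReal.ofReal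
            (s * (K z.1 z.2 * |D z.1 z.2| ^ (p / (p - 1)))) =
            ENNReal.ofReal s * (‖K z.1 z.2‖ₑ * ‖D z.1 z.2‖ₑ ^ (p / (p - 1))) := fun z => by
          rw [ENNReal.ofReal_mul hs.le, ENNReal.ofReal_mul (hK.nonneg _ _),
            Real.enorm_of_nonneg (hK.nonneg _ _), ← ENNReal.ofReal_rpow_of_nonneg (abs_nonneg _) hq.le,
            Real.enorm_eq_ofReal_abs]
        simp only [h1]
        rw [lintegral_const_mul' _ _ (by simp), ← mul_assoc, ← mul_assoc]
        congr 1
        have h2 : (0 : ℝ) ≤ 1 / (p - 1) := by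
          have : 0 < p - 1 := by linarith
          positivity
        rw [← ENNReal.coe_rpow_of_nonneg _ h2, ← ENNReal.ofReal_coe_nnreal, NNReal.coe_rpow,
          ← ENNReal.ofReal_mul (by positivity), ← ENNReal.ofReal_mul (by positivity)]
        congr 1
        ring
    _ ≤ ENNReal.ofReal ((M : ℝ) ^ (1 / (p - 1)) / 2) * ∫⁻ z, ENNReal.ofReal
          (K z.1 z.2 * (D z.1 z.2 * ((u - v) z.2 - (u - v) z.1))) ∂((muOm d).prod (muOm d)) := by
        exact mul_le_mul' le_rfl (lintegral_mono fun z => ENNReal.ofReal_le_ofReal (hpt z))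
    _ = _ := by
        rw [← ofReal_integral_eq_lintegral_ofReal hi2 (Eventually.of_forall hpos),
          ← ENNReal.ofReal_mul (by positivity)]
        congr 1
        ring

/-- Coercivity against `v = 0` bounds a power of the possibly infinite norm by a real number. Thus
an `L^{∞,1}` kernel suffices for the operator to map `L²` into itself. -/
lemma IsKernel.memLp_plap (hK : IsKernel K M) (hp1 : 1 < p) (hp2 : p ≤ 2)
    {u : Pt d → ℝ} (hu : MemLp u 2 (muOm d)) : MemLp (plap K p u) 2 (muOm d) := by
  have hq : 0 < p / (p - 1) := lt_trans one_pos (one_lt_conj hp1)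
  refine ⟨(hK.integrable_plap hp1 hp2 (hu.integrable one_le_two)).1, ?_⟩
  have h := (hK.coercive_aux hp1 hp2 hu (MemLp.zero (p := 2) (μ := muOm d)) one_pos (fun x y => by
    simp only [Pi.zero_apply, sub_self, psi_zero, sub_zero, one_mul]
    exact (psi_mul_self hp1 _).ge)).2
  have h0 : ∀ x, plap K p u x - plap K p (0 : Pt d → ℝ) x = plap K p u x := fun x => by
    simp [plap, psi_zero]
  simp only [h0] at h
  by_contra hc
  rw [not_lt, top_le_iff] at hc
  change ENNReal.ofReal (1 / 2) * eLpNorm (plap K p u) 2 (muOm d) ^ (p / (p - 1)) ≤ _ at h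
  rw [hc, ENNReal.top_rpow_of_pos hq, ENNReal.mul_top (by norm_num)] at h
  exact absurd h (by simp)

lemma plap_congr {u v : Pt d → ℝ} (h : u =ᵐ[muOm d] v) : plap K p u =ᵐ[muOm d] plap K p v := by
  filter_upwards [h] with x hx
  rw [plap, plap, hx]
  congr 1
  apply integral_congr_ae
  filter_upwards [h] with y hy
  rw [hy]

/-- The nonlocal `p`-Laplacian as an operator in `L²(Ω)`. -/
noncomputable def plapLp (K : Pt d → Pt d → ℝ) (p : ℝ) (u : Lp ℝ 2 (muOm d)) : Lp ℝ 2 (muOm d) :=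
  open Classical in
  if h : MemLp (plap K p u) 2 (muOm d) then h.toLp _ else 0

lemma IsKernel.coeFn_plapLp (hK : IsKernel K M) (hp1 : 1 < p) (hp2 : p ≤ 2)
    (u : Lp ℝ 2 (muOm d)) : plapLp K p u =ᵐ[muOm d] plap K p u := by
  rw [plapLp, dif_pos (hK.memLp_plap hp1 hp2 (Lp.memLp u))]
  exact MemLp.coeFn_toLp _

lemma IsKernel.plapLp_zero (hK : IsKernel K M) (hp1 : 1 < p) (hp2 : p ≤ 2) :
    plapLp K p (0 : Lp ℝ 2 (muOm d)) = 0 := by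
  apply Lp.ext
  filter_upwards [hK.coeFn_plapLp hp1 hp2 0, Lp.coeFn_zero ℝ 2 (muOm d),
    plap_congr (K := K) (p := p) (Lp.coeFn_zero ℝ 2 (muOm d))] with x h1 h2 h3
  rw [h1, h2, h3]
  simp [plap, psi_zero]

lemma IsKernel.coercive_lp (hK : IsKernel K M) (hp1 : 1 < p) (hp2 : p ≤ 2)
    (u v : Lp ℝ 2 (muOm d)) {s : ℝ} (hs : 0 < s)
    (hsD : ∀ x y, s * |Psi p (u y - u x) - Psi p (v y - v x)| ^ (p / (p - 1)) ≤
      (Psi p (u y - u x) - Psi p (v y - v x)) * ((u y - u x) - (v y - v x))) :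
    s / 2 * ‖plapLp K p u - plapLp K p v‖ ^ (p / (p - 1)) ≤
      (M : ℝ) ^ (1 / (p - 1)) * inner ℝ (plapLp K p u - plapLp K p v) (u - v) := by
  have hq : 0 < p / (p - 1) := lt_trans one_pos (one_lt_conj hp1)
  obtain ⟨hnn, h⟩ := hK.coercive_aux hp1 hp2 (Lp.memLp u) (Lp.memLp v) hs hsD
  have hae : ⇑(plapLp K p u - plapLp K p v) =ᵐ[muOm d]
      fun x => plap K p u x - plap K p v x := by
    filter_upwards [Lp.coeFn_sub (plapLp K p u) (plapLp K p v), hK.coeFn_plapLp hp1 hp2 u,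
      hK.coeFn_plapLp hp1 hp2 v] with x h1 h2 h3
    rw [h1, Pi.sub_apply, h2, h3]
  have e1 : inner ℝ (plapLp K p u - plapLp K p v) (u - v) =
      ∫ x, (plap K p u x - plap K p v x) * (u x - v x) ∂(muOm d) := by
    rw [L2.inner_def]
    apply integral_congr_ae
    filter_upwards [hae, Lp.coeFn_sub u v] with x h1 h2
    rw [h1, h2]
    simp [mul_comm]
  have e2 : eLpNorm (fun x => plap K p u x - plap K p v x) 2 (muOm d) =
      ENNReal.ofReal ‖plapLp K p u - plapLp K p v‖ := by
    rw [← eLpNorm_congr_ae hae, Lp.norm_def, ENNReal.ofReal_toReal (Lp.eLpNorm_ne_top _)]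
  rw [e2, ← e1, ENNReal.ofReal_rpow_of_nonneg (norm_nonneg _) hq.le,
    ← ENNReal.ofReal_mul (by positivity)] at h
  rw [← e1] at hnn
  exact (ENNReal.ofReal_le_ofReal_iff (by positivity)).1 h

end KernelOp

/-! ### Co-coercivity of the operator in `L²(Ω)` and its dependence on the kernel. -/

section KernelOp

open Set Filter
open scoped NNReal

variable {d : ℕ} {p : ℝ} {K : Pt d → Pt d → ℝ} {M : ℝ≥0}

/-- The co-coercivity constant of the nonlocal `p`-Laplacian. -/
noncomputable def coerConst (p : ℝ) (M : ℝ≥0) : ℝ :=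
  (2 : ℝ)⁻¹ ^ (1 / (p - 1)) / 2 / (M : ℝ) ^ (1 / (p - 1))

lemma coerConst_pos (hM : 0 < M) : 0 < coerConst p M := by
  have : (0 : ℝ) < M := hM
  unfold coerConst
  positivity

lemma IsKernel.cocoercive (hK : IsKernel K M) (hp1 : 1 < p) (hp2 : p ≤ 2) (hM : 0 < M) :
    Cocoercive p (coerConst p M) (plapLp K p : Lp ℝ 2 (muOm d) → Lp ℝ 2 (muOm d)) := by
  intro u v
  have hM' : (0 : ℝ) < (M : ℝ) ^ (1 / (p - 1)) := Real.rpow_pos_of_pos hM _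
  have h := hK.coercive_lp hp1 hp2 u v (s := (2 : ℝ)⁻¹ ^ (1 / (p - 1))) (by positivity)
    (fun x y => psi_cocoercive hp1 hp2 _ _)
  rw [coerConst, div_mul_eq_mul_div, div_le_iff₀ hM']
  linarith

/-- The constant is better than the one from `coerConst`, thanks to `psi_mul_self`. It matches the
CFL constant, which for `p = 2` is exactly half the inverse of the kernel norm. -/
lemma IsKernel.inner_self_ge (hK : IsKernel K M) (hp1 : 1 < p) (hp2 : p ≤ 2)
    (u : Lp ℝ 2 (muOm d)) :
    1 / 2 * ‖plapLp K p u‖ ^ (p / (p - 1)) ≤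
      (M : ℝ) ^ (1 / (p - 1)) * inner ℝ (plapLp K p u) u := by
  obtain ⟨hnn, h⟩ := hK.coercive_aux hp1 hp2 (Lp.memLp u) (MemLp.zero (p := 2) (μ := muOm d))
    one_pos (fun x y => by
      simp only [Pi.zero_apply, sub_self, psi_zero, sub_zero, one_mul]
      exact (psi_mul_self hp1 _).ge)
  have hq : 0 < p / (p - 1) := lt_trans one_pos (one_lt_conj hp1)
  have h0 : ∀ x, plap K p (0 : Pt d → ℝ) x = 0 := fun x => by simp [plap, psi_zero]
  have e1 : inner ℝ (plapLp K p u) u =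
      ∫ x, plap K p u x * u x ∂(muOm d) := by
    rw [L2.inner_def]
    apply integral_congr_ae
    filter_upwards [hK.coeFn_plapLp hp1 hp2 u] with x h1
    rw [h1]
    simp [mul_comm]
  have e2 : eLpNorm (plap K p u) 2 (muOm d) = ENNReal.ofReal ‖plapLp K p u‖ := by
    rw [← eLpNorm_congr_ae (hK.coeFn_plapLp hp1 hp2 u), Lp.norm_def,
      ENNReal.ofReal_toReal (Lp.eLpNorm_ne_top _)]
  simp only [h0, Pi.zero_apply, sub_zero] at h hnn
  rw [← e1] at hnn
  rw [e2, ← e1, ENNReal.ofReal_rpow_of_nonneg (norm_nonneg _) hq.le,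
    ← ENNReal.ofReal_mul (by positivity)] at h
  exact (ENNReal.ofReal_le_ofReal_iff (by positivity)).1 h

/-- Hölder's inequality for an integral in one variable. -/
lemma enorm_integral_mul_le {E φ : Pt d → ℝ} (hE : AEStronglyMeasurable E (muOm d))
    (hφ : AEStronglyMeasurable φ (muOm d)) :
    ‖∫ y, E y * φ y ∂(muOm d)‖ₑ ≤ eLpNorm E 2 (muOm d) * eLpNorm φ 2 (muOm d) := by
  refine (enorm_integral_le_lintegral_enorm _).trans ?_
  rw [← eLpNorm_one_eq_lintegral_enorm]
  have h := eLpNorm_smul_le_mul_eLpNorm (p := 2) (q := 2) (r := 1) hφ hE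
  exact h

lemma eLpNorm_const_real (a : ℝ) : eLpNorm (fun _ : Pt d => a) 2 (muOm d) = ‖a‖ₑ := by
  rw [eLpNorm_const _ (by simp) (NeZero.ne _)]
  simp

lemma eLpNorm_psi_sub_le (hp1 : 1 < p) (hp2 : p ≤ 2) {u : Pt d → ℝ}
    (hu : AEStronglyMeasurable u (muOm d)) (a : ℝ) :
    eLpNorm (fun y => Psi p (u y - a)) 2 (muOm d) ≤ 1 + ‖a‖ₑ + eLpNorm u 2 (muOm d) := by
  have h1 : eLpNorm (fun y => Psi p (u y - a)) 2 (muOm d) ≤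
      eLpNorm (fun y => (1 + |a|) + |u y|) 2 (muOm d) := by
    refine eLpNorm_mono fun y => ?_
    rw [Real.norm_eq_abs, Real.norm_of_nonneg (by positivity)]
    have := abs_psi_sub_le hp1 hp2 (u y) a
    linarith
  refine h1.trans ((eLpNorm_add_le (f := fun _ => 1 + |a|) (g := fun y => |u y|)
    aestronglyMeasurable_const hu.norm (by norm_num)).trans ?_)
  rw [eLpNorm_const_real, eLpNorm_norm u (μ := muOm d) (p := 2) |>.symm]
  gcongr
  · refine (enorm_add_le _ _).trans ?_
    simp
  · exact le_rfl

lemma eLpNorm_eLpNorm_section {E : Pt d → Pt d → ℝ}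
    (hE : Measurable (Function.uncurry E)) :
    eLpNorm (fun x => eLpNorm (E x) 2 (muOm d)) 2 (muOm d) =
      eLpNorm (fun z : Pt d × Pt d => E z.1 z.2) 2 (muOm2 d) := by
  simp only [eLpNorm_eq_lintegral_rpow_enorm_toReal (show (2 : ℝ≥0∞) ≠ 0 by simp)
    (show (2 : ℝ≥0∞) ≠ ⊤ by simp)]
  rw [muOm2_eq, lintegral_prod (fun z : Pt d × Pt d => ‖E z.1 z.2‖ₑ ^ (2 : ℝ≥0∞).toReal)
    (hE.enorm.pow_const _).aemeasurable]
  congr 1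
  apply lintegral_congr
  intro x
  rw [enorm_eq_self, ← ENNReal.rpow_mul]
  simp

lemma eLpNorm_enorm_mul_le_of_ae {F : Pt d → ℝ} {a b : Pt d → ℝ≥0∞} {C : ℝ≥0∞}
    (h : ∀ᵐ x ∂(muOm d), ‖F x‖ₑ ≤ a x * b x) (hb : ∀ᵐ x ∂(muOm d), b x ≤ C) (hC : C ≠ ⊤) :
    eLpNorm F 2 (muOm d) ≤ eLpNorm a 2 (muOm d) * C := by
  have h2 : (2 : ℝ≥0∞) ≠ 0 := by simp
  have h3 : (2 : ℝ≥0∞) ≠ ⊤ := by simp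
  rw [eLpNorm_eq_lintegral_rpow_enorm_toReal h2 h3, eLpNorm_eq_lintegral_rpow_enorm_toReal h2 h3]
  have e : C = (C ^ (2 : ℝ≥0∞).toReal) ^ (1 / (2 : ℝ≥0∞).toReal) := by
    rw [← ENNReal.rpow_mul]
    simp
  conv_rhs => rw [e]
  rw [← ENNReal.mul_rpow_of_nonneg _ _ (by simp), ← lintegral_mul_const' _ _ (by simp [hC])]
  gcongr ?_ ^ _
  apply lintegral_mono_ae
  filter_upwards [h, hb] with x h1 h2
  rw [enorm_eq_self, ← ENNReal.mul_rpow_of_nonneg _ _ (by simp)]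
  gcongr
  exact h1.trans (by gcongr)

/-- Dependence of the nonlocal `p`-Laplacian on the kernel. -/
lemma ae_enorm_plap_sub_plap_le {K' : Pt d → Pt d → ℝ} {M' : ℝ≥0} (hK : IsKernel K M)
    (hK' : IsKernel K' M') (hp1 : 1 < p) (hp2 : p ≤ 2) {u : Pt d → ℝ}
    (hu : MemLp u 2 (muOm d)) :
    ∀ᵐ x ∂(muOm d), ‖plap K p u x - plap K' p u x‖ₑ ≤
      eLpNorm (fun y => K x y - K' x y) 2 (muOm d) *
        eLpNorm (fun y => Psi p (u y - u x)) 2 (muOm d) := by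
  have hui := hu.integrable one_le_two
  filter_upwards [(hK.integrable_psi hp1 hp2 hui).prod_right_ae,
    (hK'.integrable_psi hp1 hp2 hui).prod_right_ae] with x h1 h2
  have e1 : plap K p u x - plap K' p u x =
      -∫ y, (K x y - K' x y) * Psi p (u y - u x) ∂(muOm d) := by
    simp only [sub_mul]
    rw [integral_sub h1 h2, plap, plap]
    ring
  rw [e1, enorm_neg]
  refine enorm_integral_mul_le ?_ ?_
  · exact ((hK.meas.comp measurable_prodMk_left).sub
      (hK'.meas.comp measurable_prodMk_left)).aestronglyMeasurable
  · exact (measurable_psi.comp_aemeasurable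
      (hu.1.sub aestronglyMeasurable_const).aemeasurable).aestronglyMeasurable

/-- Hölder in `y`, then the supremum over `x` for the kernel factor. The other factor is at most `1
+ ‖u‖ + |u x|` by the growth of `Ψ`, and only this is integrated in `x`. -/
lemma eLpNorm_plap_sub_plap_le {K' : Pt d → Pt d → ℝ} {M' : ℝ≥0} (hK : IsKernel K M)
    (hK' : IsKernel K' M') (hp1 : 1 < p) (hp2 : p ≤ 2) {u : Pt d → ℝ}
    (hu : MemLp u 2 (muOm d)) :
    eLpNorm (fun x => plap K p u x - plap K' p u x) 2 (muOm d) ≤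
      normInf (fun x y => K x y - K' x y) 2 * (1 + 2 * eLpNorm u 2 (muOm d)) := by
  set E : Pt d → Pt d → ℝ := fun x y => K x y - K' x y with hE
  rcases eq_or_ne (normInf E 2) ⊤ with htop | htop
  · rw [htop, ENNReal.top_mul (by simp)]
    exact le_top
  have h1 : ∀ᵐ x ∂(muOm d), ‖plap K p u x - plap K' p u x‖ₑ ≤
      (1 + eLpNorm u 2 (muOm d) + ‖u x‖ₑ) * eLpNorm (E x) 2 (muOm d) := by
    filter_upwards [ae_enorm_plap_sub_plap_le hK hK' hp1 hp2 hu] with x hx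
    rw [mul_comm]
    refine hx.trans (mul_le_mul' le_rfl ((eLpNorm_psi_sub_le hp1 hp2 hu.1 _).trans_eq ?_))
    ring
  have h2 := eLpNorm_enorm_mul_le_of_ae h1
    (ae_le_essSup (f := fun x => eLpNorm (E x) 2 (muOm d))) htop
  refine h2.trans ?_
  rw [mul_comm]
  change normInf E 2 * _ ≤ _
  gcongr
  have h3 : eLpNorm (fun x => 1 + eLpNorm u 2 (muOm d) + ‖u x‖ₑ) 2 (muOm d) =
      eLpNorm (fun x => 1 + (eLpNorm u 2 (muOm d)).toReal + ‖u x‖) 2 (muOm d) := by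
    refine eLpNorm_congr_enorm_ae (Eventually.of_forall fun x => ?_)
    rw [enorm_eq_self, Real.enorm_of_nonneg (r := _ + ‖u x‖) (by positivity),
      ENNReal.ofReal_add (by positivity)
      (norm_nonneg _), ENNReal.ofReal_add zero_le_one ENNReal.toReal_nonneg,
      ENNReal.ofReal_toReal hu.eLpNorm_ne_top, ENNReal.ofReal_one, ofReal_norm]
  rw [h3]
  refine (eLpNorm_add_le (f := fun _ => 1 + (eLpNorm u 2 (muOm d)).toReal) (g := fun x => ‖u x‖)
    aestronglyMeasurable_const hu.1.norm (by norm_num)).trans ?_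
  rw [eLpNorm_const_real, eLpNorm_norm, Real.enorm_of_nonneg (by positivity),
    ENNReal.ofReal_add zero_le_one ENNReal.toReal_nonneg, ENNReal.ofReal_toReal hu.eLpNorm_ne_top,
    ENNReal.ofReal_one, two_mul, add_assoc]

/-- For bounded `u` the roles are exchanged: the factor with `Ψ` is bounded uniformly in `x`, so the
kernel factor need only be square integrable in `x`. -/
lemma eLpNorm_plap_sub_plap_le_of_bounded {K' : Pt d → Pt d → ℝ} {M' : ℝ≥0} (hK : IsKernel K M)
    (hK' : IsKernel K' M') (hp1 : 1 < p) (hp2 : p ≤ 2) {u : Pt d → ℝ}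
    (hu : MemLp u 2 (muOm d)) {B : ℝ} (hB : ∀ᵐ x ∂(muOm d), |u x| ≤ B) :
    eLpNorm (fun x => plap K p u x - plap K' p u x) 2 (muOm d) ≤
      eLpNorm (fun z : Pt d × Pt d => K z.1 z.2 - K' z.1 z.2) 2 (muOm2 d) *
        ENNReal.ofReal (1 + 2 * B) := by
  rw [← eLpNorm_eLpNorm_section (E := fun x y => K x y - K' x y) (hK.meas.sub hK'.meas)]
  refine eLpNorm_enorm_mul_le_of_ae (ae_enorm_plap_sub_plap_le hK hK' hp1 hp2 hu) ?_ (by simp)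
  filter_upwards [hB] with x hx
  have hB0 : 0 ≤ B := (abs_nonneg _).trans hx
  have h1 : eLpNorm (fun y => Psi p (u y - u x)) 2 (muOm d) ≤
      eLpNorm (fun _ : Pt d => 1 + 2 * B) 2 (muOm d) := by
    refine eLpNorm_mono_ae ?_
    filter_upwards [hB] with y hy
    rw [Real.norm_eq_abs, Real.norm_of_nonneg (by positivity)]
    have := abs_psi_sub_le hp1 hp2 (u y) (u x)
    linarith
  rwa [eLpNorm_const_real, Real.enorm_of_nonneg (by positivity)] at h1

end KernelOp

/-! ### Comparison principle in `L¹(Ω)` -/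

section Comparison

open Set Filter Topology
open scoped NNReal

/-- Transfers absolute continuity from the primitive of `‖W'‖` to the mass of the positive part in
the comparison principle. -/
lemma absolutelyContinuousOnInterval_of_dist_le {X Y : Type*} [PseudoMetricSpace X]
    [PseudoMetricSpace Y] {f : ℝ → X} {g : ℝ → Y} {a b : ℝ}
    (h : ∀ x ∈ uIcc a b, ∀ y ∈ uIcc a b, dist (f x) (f y) ≤ dist (g x) (g y))
    (hg : AbsolutelyContinuousOnInterval g a b) : AbsolutelyContinuousOnInterval f a b := by
  rw [absolutelyContinuousOnInterval_iff] at hg ⊢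
  intro ε hε
  obtain ⟨δ, hδ, H⟩ := hg ε hε
  refine ⟨δ, hδ, fun E hE hE' => lt_of_le_of_lt (Finset.sum_le_sum fun i hi => ?_) (H E hE hE')⟩
  exact h _ (hE.1 i hi).1 _ (hE.1 i hi).2

variable {d : ℕ} {p : ℝ} {K : Pt d → Pt d → ℝ} {M : ℝ≥0}

/-- T-accretivity of the nonlocal `p`-Laplacian in `L¹(Ω)`. -/
lemma IsKernel.setIntegral_plap_sub_nonneg (hK : IsKernel K M) (hp1 : 1 < p) (hp2 : p ≤ 2)
    {u v : Pt d → ℝ} (hu : Integrable u (muOm d)) (hv : Integrable v (muOm d)) {S : Set (Pt d)}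
    (hS : MeasurableSet S) (hSuv : ∀ x, x ∈ S ↔ v x < u x) :
    0 ≤ ∫ x in S, (plap K p u x - plap K p v x) ∂(muOm d) := by
  set w : Pt d → ℝ := S.indicator fun _ => 1 with hw
  have hi : Integrable (fun z : Pt d × Pt d =>
      K z.1 z.2 * (Psi p (u z.2 - u z.1) - Psi p (v z.2 - v z.1)) * w z.1)
      ((muOm d).prod (muOm d)) := by
    have h1 := (hK.integrable_psi hp1 hp2 hu).sub (hK.integrable_psi hp1 hp2 hv)
    have h2 := h1.indicator (s := Prod.fst ⁻¹' S) (measurable_fst hS)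
    refine h2.congr (Eventually.of_forall fun z => ?_)
    by_cases hz : z.1 ∈ S
    · rw [indicator_of_mem (by exact hz), hw]
      simp only [Pi.sub_apply, indicator_of_mem hz]
      ring
    · rw [indicator_of_notMem (by exact hz), hw]
      simp only [indicator_of_notMem hz]
      ring
  rw [← integral_indicator hS]
  have e1 : ∫ x, S.indicator (fun x => plap K p u x - plap K p v x) x ∂(muOm d) =
      ∫ x, (-∫ y, K x y * (Psi p (u y - u x) - Psi p (v y - v x)) ∂(muOm d)) * w x ∂(muOm d) := by
    apply integral_congr_ae
    filter_upwards [hK.ae_plap_sub hp1 hp2 hu hv] with x hx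
    by_cases hz : x ∈ S
    · rw [hw, indicator_of_mem hz, indicator_of_mem hz, mul_one, hx]
    · rw [hw, indicator_of_notMem hz, indicator_of_notMem hz, mul_zero]
  rw [e1, hK.integral_mul_eq (psi_sub_antisymm u v) hi]
  refine mul_nonneg (by norm_num) (integral_nonneg fun z => mul_nonneg (hK.nonneg _ _) ?_)
  have hmem : ∀ x ∈ S, w x = 1 := fun x hx => by rw [hw, indicator_of_mem hx]
  have hnot : ∀ x ∉ S, w x = 0 := fun x hx => by rw [hw, indicator_of_notMem hx]
  -- Only pairs with exactly one point in `S` contribute. There the ordering of `u` and `v` at the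
  -- two points fixes the sign of the difference of increments, and `Psi` is monotone.
  by_cases h1 : z.1 ∈ S <;> by_cases h2 : z.2 ∈ S
  · rw [hmem _ h1, hmem _ h2]; simp
  · rw [hmem _ h1, hnot _ h2]
    rw [hSuv] at h1 h2
    have := psi_mono hp1 (show u z.2 - u z.1 ≤ v z.2 - v z.1 by linarith)
    linarith
  · rw [hnot _ h1, hmem _ h2]
    rw [hSuv] at h1 h2
    have := psi_mono hp1 (show v z.2 - v z.1 ≤ u z.2 - u z.1 by linarith)
    linarith
  · rw [hnot _ h1, hnot _ h2]; simp

/-- The indicator of `{a > 0}` is a subgradient of the positive part at `a`. -/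
lemma integral_posPart_sub_le {α : Type*} [MeasurableSpace α] {μ : Measure α} {a b : α → ℝ}
    (ha : Integrable a μ) (hb : Integrable b μ) {S : Set α} (hS : MeasurableSet S)
    (hSa : ∀ x, x ∈ S ↔ 0 < a x) :
    ∫ x, max (a x) 0 ∂μ - ∫ x, max (b x) 0 ∂μ ≤ ∫ x in S, (a x - b x) ∂μ := by
  rw [← integral_sub ha.pos_part hb.pos_part, ← integral_indicator hS]
  refine integral_mono (ha.pos_part.sub hb.pos_part) ((ha.sub hb).indicator hS) fun x => ?_
  simp only
  by_cases hx : x ∈ S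
  · rw [indicator_of_mem hx, max_eq_left ((hSa x).1 hx).le]
    linarith [le_max_left (b x) 0]
  · rw [indicator_of_notMem hx, max_eq_right (not_lt.1 fun h => hx ((hSa x).2 h))]
    linarith [le_max_right (b x) 0]

/-- Comparison principle for curves in `W^{1,1}(0,T;L¹(Ω))`. -/
theorem IsKernel.comparison (hK : IsKernel K M) (hp1 : 1 < p) (hp2 : p ≤ 2) {T : ℝ}
    {V₁ V₂ V₁' V₂' : ℝ → Lp ℝ 1 (muOm d)}
    (hi₁ : IntervalIntegrable V₁' volume 0 T) (hi₂ : IntervalIntegrable V₂' volume 0 T)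
    (h₁ : ∀ t ∈ Icc 0 T, V₁ t = V₁ 0 + ∫ r in (0 : ℝ)..t, V₁' r)
    (h₂ : ∀ t ∈ Icc 0 T, V₂ t = V₂ 0 + ∫ r in (0 : ℝ)..t, V₂' r)
    (h0 : V₁ 0 ≤ᵐ[muOm d] V₂ 0)
    (hle : ∀ᵐ t ∂(volume.restrict (Ioo 0 T)), ∀ᵐ x ∂(muOm d),
      V₁' t x - V₂' t x ≤ -(plap K p (V₁ t) x - plap K p (V₂ t) x))
    {t : ℝ} (ht : t ∈ Icc 0 T) : V₁ t ≤ᵐ[muOm d] V₂ t := by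
  have hT : 0 ≤ T := ht.1.trans ht.2
  set W : ℝ → Lp ℝ 1 (muOm d) := fun t => V₁ t - V₂ t with hW
  set W' : ℝ → Lp ℝ 1 (muOm d) := fun t => V₁' t - V₂' t with hW'
  have hWi : IntervalIntegrable W' volume 0 T := hi₁.sub hi₂
  have hsub : ∀ s ∈ Icc 0 T, ∀ r ∈ Icc 0 T, uIcc s r ⊆ uIcc 0 T := fun s hs r hr => by
    rw [uIcc_of_le hT]
    exact uIcc_subset_Icc hs hr
  have h0T : (0 : ℝ) ∈ Icc 0 T := ⟨le_rfl, hT⟩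
  have hWeq : ∀ s ∈ Icc 0 T, W s = W 0 + ∫ r in (0 : ℝ)..s, W' r := by
    intro s hs
    simp only [hW, hW']
    rw [intervalIntegral.integral_sub (hi₁.mono_set (hsub _ h0T _ hs))
      (hi₂.mono_set (hsub _ h0T _ hs)), h₁ s hs, h₂ s hs]
    abel
  have hWsub : ∀ s ∈ Icc 0 T, ∀ r ∈ Icc 0 T, W s - W r = ∫ q in r..s, W' q := by
    intro s hs r hr
    rw [hWeq s hs, hWeq r hr, add_sub_add_left_eq_sub, intervalIntegral.integral_interval_sub_left
      (hWi.mono_set (hsub _ h0T _ hs)) (hWi.mono_set (hsub _ h0T _ hr))]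
  set P : ℝ → ℝ := fun s => ∫ x, max (W s x) 0 ∂(muOm d) with hP
  set G : ℝ → ℝ := fun s => ∫ q in (0 : ℝ)..s, ‖W' q‖ with hG
  have hint : ∀ s, Integrable (W s) (muOm d) := fun s => L1.integrable_coeFn _
  set S : ℝ → Set (Pt d) := fun s => {x | 0 < W s x} with hS
  have hSm : ∀ s, MeasurableSet (S s) := fun s =>
    measurableSet_lt measurable_const (Lp.stronglyMeasurable (W s)).measurable
  have hPle : ∀ s r, P s - P r ≤ ∫ x in S s, (W s - W r) x ∂(muOm d) := by
    intro s r
    refine (integral_posPart_sub_le (hint s) (hint r) (hSm s) fun x => Iff.rfl).trans_eq ?_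
    apply setIntegral_congr_ae (hSm s)
    filter_upwards [Lp.coeFn_sub (W s) (W r)] with x hx _
    rw [hx, Pi.sub_apply]
  have hPnorm : ∀ s r, P s - P r ≤ ‖W s - W r‖ := by
    intro s r
    refine (hPle s r).trans ?_
    rw [L1.norm_eq_integral_norm]
    refine (Real.le_norm_self _).trans ((norm_integral_le_integral_norm _).trans ?_)
    exact setIntegral_le_integral (L1.integrable_coeFn _).norm
      (Eventually.of_forall fun x => norm_nonneg _)
  have hGac : AbsolutelyContinuousOnInterval G 0 T :=
    hWi.norm.absolutelyContinuousOnInterval_intervalIntegral left_mem_uIcc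
  -- The positive part is 1-Lipschitz in `L¹`, and the increments of `W` are dominated by those of
  -- `G`.
  have hPac : AbsolutelyContinuousOnInterval P 0 T := by
    refine absolutelyContinuousOnInterval_of_dist_le (fun s hs r hr => ?_) hGac
    rw [uIcc_of_le hT] at hs hr
    have e1 : ‖W s - W r‖ ≤ |G s - G r| := by
      rw [hWsub s hs r hr]
      simp only [hG]
      rw [intervalIntegral.integral_interval_sub_left
        (hWi.norm.mono_set (hsub _ h0T _ hs)) (hWi.norm.mono_set (hsub _ h0T _ hr))]
      exact intervalIntegral.norm_integral_le_abs_integral_norm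
    rw [Real.dist_eq, Real.dist_eq, abs_le]
    have e2 := hPnorm s r
    have e3 := hPnorm r s
    rw [norm_sub_rev] at e3
    constructor <;> linarith
  have hderiv : ∀ᵐ s, s ∈ Ioo 0 T → deriv P s ≤ 0 := by
    have hle' := (ae_restrict_iff' measurableSet_Ioo).1 hle
    filter_upwards [hle', hPac.ae_differentiableAt, hWi.ae_hasDerivAt_integral]
      with s hs1 hs2 hs3 hs
    have hsI : s ∈ Icc 0 T := Ioo_subset_Icc_self hs
    have hsu : s ∈ uIcc 0 T := by rwa [uIcc_of_le hT]
    have hd : HasDerivAt P (deriv P s) s := (hs2 hsu).hasDerivAt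
    have hWd : HasDerivAt W (W' s) s := by
      have h := ((hs3 hsu) 0 left_mem_uIcc).const_add (W 0)
      refine h.congr_of_eventuallyEq ?_
      filter_upwards [Ioo_mem_nhds hs.1 hs.2] with r hr
      exact hWeq r (Ioo_subset_Icc_self hr)
    have hcont := continuous_setIntegral (μ := muOm d) (E := ℝ) (S s)
    -- Left difference quotients suffice, since `P` is differentiable at `s`. For `r < s` the
    -- subgradient inequality involves the set `S s`, which stays fixed as `r` tends to `s`.
    have hlim1 : Tendsto (slope P s) (𝓝[<] s) (𝓝 (deriv P s)) :=
      (hasDerivAt_iff_tendsto_slope.1 hd).mono_left (nhdsWithin_mono _ fun r hr => ne_of_lt hr)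
    have hlim2 : Tendsto (fun r => ∫ x in S s, slope W s r x ∂(muOm d)) (𝓝[<] s)
        (𝓝 (∫ x in S s, W' s x ∂(muOm d))) :=
      (hcont.tendsto _).comp ((hasDerivAt_iff_tendsto_slope.1 hWd).mono_left
        (nhdsWithin_mono _ fun r hr => ne_of_lt hr))
    have hle1 : deriv P s ≤ ∫ x in S s, W' s x ∂(muOm d) := by
      refine le_of_tendsto_of_tendsto hlim1 hlim2 ?_
      filter_upwards [self_mem_nhdsWithin] with r hr
      have hr' : r < s := hr
      have e1 : ∫ x in S s, slope W s r x ∂(muOm d) =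
          (s - r)⁻¹ * ∫ x in S s, (W s - W r) x ∂(muOm d) := by
        rw [← integral_const_mul]
        apply setIntegral_congr_ae (hSm s)
        have e2 : slope W s r = (s - r)⁻¹ • (W s - W r) := by
          rw [slope_comm, slope_def_module]
        rw [e2]
        filter_upwards [Lp.coeFn_smul ((s - r)⁻¹) (W s - W r)] with x hx _
        rw [hx]
        rfl
      rw [e1, slope_comm, slope_def_module, smul_eq_mul]
      have : 0 < (s - r)⁻¹ := inv_pos.2 (by linarith)
      exact mul_le_mul_of_nonneg_left (hPle s r) this.le
    have hSx : ∀ᵐ x ∂(muOm d), (x ∈ S s ↔ V₂ s x < V₁ s x) := by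
      filter_upwards [Lp.coeFn_sub (V₁ s) (V₂ s)] with x hx
      simp only [hS, hW, mem_ofPred_eq]
      rw [hx, Pi.sub_apply, sub_pos]
    -- `S s` is defined by a representative of the difference `V₁ s - V₂ s`, whereas accretivity
    -- requires the pointwise difference of the two representatives. The sets agree up to a null
    -- set.
    set S' : Set (Pt d) := {x | V₂ s x < V₁ s x} with hS'
    have hS'm : MeasurableSet S' := measurableSet_lt
      (Lp.stronglyMeasurable (V₂ s)).measurable (Lp.stronglyMeasurable (V₁ s)).measurable
    have hSS' : S s =ᵐ[muOm d] S' := by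
      filter_upwards [hSx] with x hx
      exact propext hx
    have hacc := hK.setIntegral_plap_sub_nonneg hp1 hp2 (L1.integrable_coeFn (V₁ s))
      (L1.integrable_coeFn (V₂ s)) hS'm (fun x => Iff.rfl)
    have hle2 : ∫ x in S s, W' s x ∂(muOm d) ≤
        -∫ x in S', (plap K p (V₁ s) x - plap K p (V₂ s) x) ∂(muOm d) := by
      rw [setIntegral_congr_set hSS', ← integral_neg]
      refine setIntegral_mono_ae (L1.integrable_coeFn _).integrableOn
        ((hK.integrable_plap hp1 hp2 (L1.integrable_coeFn (V₁ s))).sub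
          (hK.integrable_plap hp1 hp2 (L1.integrable_coeFn (V₂ s)))).neg.integrableOn ?_
      filter_upwards [hs1 hs, Lp.coeFn_sub (V₁' s) (V₂' s)] with x hx hx'
      rw [hx']
      exact hx
    linarith
  have hP0 : P 0 = 0 := by
    simp only [hP]
    rw [integral_eq_zero_of_ae]
    filter_upwards [h0, Lp.coeFn_sub (V₁ 0) (V₂ 0)] with x hx hx'
    simp only [hW, Pi.zero_apply]
    rw [hx', Pi.sub_apply, max_eq_right (by linarith)]
  have hPt : P t ≤ 0 := by
    have h := (hPac.mono (hsub 0 h0T t ht)).integral_deriv_eq_sub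
    have h2 : ∫ s in (0 : ℝ)..t, deriv P s ≤ 0 := by
      rw [intervalIntegral.integral_of_le ht.1]
      refine integral_nonpos_of_ae ?_
      rw [EventuallyLE, ae_restrict_iff' measurableSet_Ioc]
      have hne : ∀ᵐ s : ℝ, s ≠ T := by simp [ae_iff, measure_singleton]
      filter_upwards [hderiv, hne] with s hs hs' hst
      exact hs ⟨hst.1, lt_of_le_of_ne (hst.2.trans ht.2) hs'⟩
    rw [h, hP0, sub_zero] at h2
    exact h2
  have hPz : P t = 0 := le_antisymm hPt (integral_nonneg fun x => le_max_right _ _)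
  have hz := (integral_eq_zero_iff_of_nonneg (fun x => le_max_right _ _)
    (hint t).pos_part).1 hPz
  filter_upwards [hz, Lp.coeFn_sub (V₁ t) (V₂ t)] with x hx hx'
  have h3 : W t x ≤ 0 := by
    rw [← max_eq_right_iff]
    exact hx
  simp only [hW] at h3
  rw [hx', Pi.sub_apply] at h3
  linarith

end Comparison

/-! ### Rate of convergence of the Euler scheme -/

section Rate

open Set Filter Topology

variable {p : ℝ}

/-- The first inequality amounts to `(p - 1)(2 - p) > 0`. This gap between the rate `τ^(p/2)` that
is proved and the rate that is claimed closes at `p = 2`. -/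
lemma one_div_three_sub_lt (hp1 : 1 < p) (hp2 : p < 2) : 1 / (3 - p) < p / 2 ∧ 1 / (3 - p) < 1 := by
  have h : 0 < 3 - p := by linarith
  rw [div_lt_div_iff₀ h two_pos, div_lt_one h]
  constructor <;> nlinarith

/-- However large `a` and `b` are, a positive power of `τ` is left over to absorb them. In this way
constants growing with `T` affect only the threshold for `τ` and not the final constant. -/
lemma exists_rate_le (hp1 : 1 < p) (hp2 : p < 2) {a b : ℝ} :
    ∃ τ₀ : ℝ, 0 < τ₀ ∧ ∀ τ, 0 ≤ τ → τ ≤ τ₀ →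
      a * τ ^ (p / 2) + b * τ ≤ τ ^ (1 / (3 - p)) := by
  obtain ⟨h1, h2⟩ := one_div_three_sub_lt hp1 hp2
  have h0 : 0 < 1 / (3 - p) := by
    have : 0 < 3 - p := by linarith
    positivity
  set γ := 1 / (3 - p)
  have hc : Continuous fun τ : ℝ => a * τ ^ (p / 2 - γ) + b * τ ^ (1 - γ) :=
    ((Real.continuous_rpow_const (by linarith)).const_mul a).add
      ((Real.continuous_rpow_const (by linarith)).const_mul b)
  have hlt : ∀ᶠ τ in 𝓝 (0 : ℝ), a * τ ^ (p / 2 - γ) + b * τ ^ (1 - γ) < 1 := by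
    refine hc.continuousAt.eventually (Iio_mem_nhds ?_)
    beta_reduce
    rw [Real.zero_rpow (by linarith), Real.zero_rpow (by linarith)]
    simp
  obtain ⟨r, hr, hball⟩ := Metric.eventually_nhds_iff.1 hlt
  refine ⟨r / 2, by positivity, fun τ hτ0 hτ => ?_⟩
  have h3 := @hball τ (by rw [Real.dist_eq, sub_zero, abs_of_nonneg hτ0]; linarith)
  have e1 : τ ^ (p / 2) = τ ^ γ * τ ^ (p / 2 - γ) := by
    rw [← Real.rpow_add_of_nonneg hτ0 h0.le (by linarith), add_sub_cancel]
  have e2 : τ = τ ^ γ * τ ^ (1 - γ) := by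
    rw [← Real.rpow_add_of_nonneg hτ0 h0.le (by linarith), add_sub_cancel, Real.rpow_one]
  have h4 : 0 ≤ τ ^ γ := Real.rpow_nonneg hτ0 _
  calc a * τ ^ (p / 2) + b * τ
      = τ ^ γ * (a * τ ^ (p / 2 - γ) + b * τ ^ (1 - γ)) := by
        conv_lhs => rw [e1]; arg 2; rw [e2]
        ring
    _ ≤ τ ^ γ * 1 := by gcongr
    _ = τ ^ γ := mul_one _

lemma sqrt_two_mul_rpow {c τ R : ℝ} (hc : 0 < c) (hτ : 0 ≤ τ) (hR : 0 ≤ R) :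
    Real.sqrt (2 * ((1 / c) ^ (p - 1) * (τ * R) ^ p)) =
      Real.sqrt (2 * ((1 / c) ^ (p - 1) * R ^ p)) * τ ^ (p / 2) := by
  have e : τ ^ (p / 2) = Real.sqrt (τ ^ p) := by
    rw [Real.sqrt_eq_rpow, ← Real.rpow_mul hτ]
    ring_nf
  rw [e, ← Real.sqrt_mul (by positivity), Real.mul_rpow hτ hR]
  ring_nf

lemma sqrt_add_le_add_sqrt {a b : ℝ} (ha : 0 ≤ a) (hb : 0 ≤ b) :
    Real.sqrt (a + b) ≤ Real.sqrt a + Real.sqrt b := by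
  rw [Real.sqrt_le_left (by positivity), add_sq, Real.sq_sqrt ha, Real.sq_sqrt hb]
  have : 0 ≤ 2 * Real.sqrt a * Real.sqrt b := by positivity
  linarith

/-- Convergence rate of the forward Euler scheme, uniformly over co-coercive operators. -/
theorem exists_euler_rate (hp1 : 1 < p) (hp2 : p ≤ 2) {c G F β T₀ : ℝ} (hc : 0 < c) (hG : 0 ≤ G)
    (hF : 0 ≤ F) (hβ : 0 ≤ β) (hT₀ : 0 < T₀) (H : Type*) [NormedAddCommGroup H]
    [InnerProductSpace ℝ H] :
    ∃ C : ℝ, 0 < C ∧ ∀ T : ℝ, 0 < T → (p < 2 ∨ T₀ ≤ T) → ∃ τ₀ : ℝ, 0 < τ₀ ∧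
      ∀ (N : ℕ) (θ : TimeGrid T N) (A B : H → H) (b f : H) (x : Fin (N + 1) → H) (u : ℝ → H)
        (ε : ℝ), Cocoercive p c A → A 0 = 0 → ‖b‖ ≤ F → ‖x 0‖ ≤ G → IsEuler θ A b x →
        (∀ t ∈ Icc 0 T, HasDerivAt u (-B (u t) + f) t) → 0 ≤ ε →
        (∀ t ∈ Icc 0 T, Real.exp (-t) * ‖A (u t) - B (u t)‖ ^ 2 ≤ (ε * β) ^ 2) → θ.tau ≤ τ₀ →
        ∀ (k : Fin N), ∀ t ∈ Ioc (θ.t k.castSucc) (θ.t k.succ),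
          ‖x k.castSucc - u t‖ ≤ Real.exp (T / 2) * (‖x 0 - u 0‖ +
            C * Real.sqrt T * (θ.tau ^ (1 / (3 - p)) + ‖b - f‖ + ε)) := by
  -- Bound of the initial residual `‖A (x 0) - b‖`, independent of `T`.
  set R₀ := 1 + G / c + F with hR₀
  have hR₀0 : 0 ≤ R₀ := by positivity
  -- The summand 1 serves `p < 2`. The rest serves `p = 2`: the first term is the error of the
  -- polygon, the second the jump between node and polygon after division by `√T ≥ √T₀`.
  set C₁ := 1 + (Real.sqrt (2 * (1 / c)) * R₀ + R₀ / Real.sqrt T₀) with hC₁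
  have hC₁1 : 1 ≤ C₁ := by
    have : 0 ≤ Real.sqrt (2 * (1 / c)) * R₀ + R₀ / Real.sqrt T₀ := by positivity
    linarith
  refine ⟨C₁ + (2 + 2 * β), by positivity, fun T hT hpT => ?_⟩
  have hsT : 0 < Real.sqrt T := Real.sqrt_pos.2 hT
  have hres : ∀ (A : H → H) (b : H), Cocoercive p c A → A 0 = 0 → ‖b‖ ≤ F → ∀ v,
      ‖A v - b‖ ≤ 1 + ‖v‖ / c + F := fun A b hA hA0 hb v => by
    have h1 := hA.norm_le hc hp1 hp2 hA0 v
    have h2 := norm_sub_le (A v) b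
    linarith
  -- The two ranges of `p` differ only in the bound `R` of the residuals and in the threshold; the
  -- remaining argument is common.
  obtain ⟨τ₀, hτ₀, R, hR, hbound⟩ : ∃ τ₀ : ℝ, 0 < τ₀ ∧ ∃ R : ℝ,
      (∀ (N : ℕ) (θ : TimeGrid T N) (A : H → H) (b : H) (x : Fin (N + 1) → H),
        Cocoercive p c A → A 0 = 0 → ‖b‖ ≤ F → ‖x 0‖ ≤ G → IsEuler θ A b x → θ.tau ≤ τ₀ →
        ∀ k : Fin N, ‖A (x k.castSucc) - b‖ ≤ R) ∧
      (0 ≤ R → ∀ τ, 0 ≤ τ → τ ≤ τ₀ → Real.sqrt (2 * ((1 / c) ^ (p - 1) * (τ * R) ^ p)) +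
        τ * R / Real.sqrt T ≤ C₁ * τ ^ (1 / (3 - p))) := by
    rcases hp2.lt_or_eq with hp2' | rfl
    · set L := 1 + 1 / c + F with hL
      have hL0 : 0 ≤ L := by positivity
      -- The Gronwall bound. It depends on `T`, but enters only through coefficients absorbed by
      -- small `τ`.
      set R := L * ((1 + G) * Real.exp (L * T)) with hR
      obtain ⟨τ₀, hτ₀, h⟩ := exists_rate_le hp1 hp2'
        (a := Real.sqrt (2 * ((1 / c) ^ (p - 1) * R ^ p))) (b := R / Real.sqrt T)
      refine ⟨τ₀, hτ₀, R, ?_, fun hR0 τ hτ0 hτ => ?_⟩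
      · intro N θ A b x hA hA0 hb hx0 hx _ k
        have hLv : ∀ v, ‖A v - b‖ ≤ L * (1 + ‖v‖) := fun v => by
          refine (hres A b hA hA0 hb v).trans ?_
          have h1 : 0 ≤ 1 / c := by positivity
          have h2 : ‖v‖ / c = 1 / c * ‖v‖ := by ring
          have h3 : 0 ≤ F * ‖v‖ := by positivity
          rw [hL, h2]
          linarith [norm_nonneg v]
        refine (hLv _).trans ?_
        rw [hR]
        gcongr
        refine (hx.norm_le hLv _).trans ?_
        have := (θ.t_mem k.castSucc).2
        gcongr
      · rw [sqrt_two_mul_rpow hc hτ0 hR0]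
        have h1 := h τ hτ0 hτ
        have h2 : τ * R / Real.sqrt T = R / Real.sqrt T * τ := by ring
        rw [h2]
        refine h1.trans ?_
        exact le_mul_of_one_le_left (Real.rpow_nonneg hτ0 _) hC₁1
    · have hT₀T : T₀ ≤ T := hpT.resolve_left (lt_irrefl _)
      -- For `τ ≤ 2c` the residuals do not increase, so the initial one bounds them all.
      refine ⟨2 * c, by positivity, R₀, ?_, fun hR0 τ hτ0 hτ => ?_⟩
      · intro N θ A b x hA hA0 hb hx0 hx hτ k
        refine (hx.norm_residual_le hA hτ _).trans ((hres A b hA hA0 hb _).trans ?_)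
        rw [hR₀]
        gcongr
      · have e1 : (1 : ℝ) / (3 - 2) = 1 := by norm_num
        have e2 : Real.sqrt (2 * ((1 / c) ^ ((2 : ℝ) - 1) * (τ * R₀) ^ (2 : ℝ))) =
            Real.sqrt (2 * (1 / c)) * (τ * R₀) := by
          rw [show (2 : ℝ) - 1 = 1 by norm_num, Real.rpow_one, Real.rpow_two, ← mul_assoc,
            Real.sqrt_mul (by positivity), Real.sqrt_sq (by positivity)]
        rw [e1, e2, Real.rpow_one, hC₁]
        have e3 : τ * R₀ / Real.sqrt T ≤ τ * R₀ / Real.sqrt T₀ := by gcongr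
        have e4 : τ * R₀ / Real.sqrt T₀ = R₀ / Real.sqrt T₀ * τ := by ring
        linarith
  refine ⟨τ₀, hτ₀, fun N θ A B b f x u ε hA hA0 hb hx0 hx hu hε hεu hτ k t ht => ?_⟩
  have hRk := hR N θ A b x hA hA0 hb hx0 hx hτ
  have hR0 : 0 ≤ R := (norm_nonneg _).trans (hRk k)
  have hτ0 := θ.tau_nonneg
  have hΓ : ∀ t ∈ Icc 0 T, Real.exp (-t) * (‖b - f‖ + ‖A (u t) - B (u t)‖) ^ 2 ≤
      2 * ‖b - f‖ ^ 2 + 2 * (ε * β) ^ 2 := by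
    intro t ht
    have h1 : (‖b - f‖ + ‖A (u t) - B (u t)‖) ^ 2 ≤
        2 * ‖b - f‖ ^ 2 + 2 * ‖A (u t) - B (u t)‖ ^ 2 := by
      nlinarith [sq_nonneg (‖b - f‖ - ‖A (u t) - B (u t)‖)]
    have h2 : Real.exp (-t) ≤ 1 := Real.exp_le_one_iff.2 (by linarith [ht.1])
    have h3 := hεu t ht
    calc _ ≤ Real.exp (-t) * (2 * ‖b - f‖ ^ 2 + 2 * ‖A (u t) - B (u t)‖ ^ 2) := by gcongr
      _ = Real.exp (-t) * (2 * ‖b - f‖ ^ 2) +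
          2 * (Real.exp (-t) * ‖A (u t) - B (u t)‖ ^ 2) := by ring
      _ ≤ 1 * (2 * ‖b - f‖ ^ 2) + 2 * (ε * β) ^ 2 := by gcongr
      _ = _ := by ring
  have herr := hA.euler_error hc hp1 hx hRk hu hΓ k (Ioc_subset_Icc_self ht)
  refine herr.trans ?_
  have h1 := hbound hR0 θ.tau hτ0 hτ
  set Y := 2 * ((1 / c) ^ (p - 1) * (θ.tau * R) ^ p) with hY
  have hY0 : 0 ≤ Y := by positivity
  have h2 : Real.sqrt (Y + (2 * ‖b - f‖ ^ 2 + 2 * (ε * β) ^ 2)) ≤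
      Real.sqrt Y + (2 * ‖b - f‖ + 2 * (ε * β)) := by
    refine (sqrt_add_le_add_sqrt hY0 (by positivity)).trans ?_
    gcongr
    rw [Real.sqrt_le_left (by positivity)]
    have : 0 ≤ ‖b - f‖ * (ε * β) := by positivity
    nlinarith [sq_nonneg ‖b - f‖, sq_nonneg (ε * β)]
  -- The jump is brought under the common factor `exp(T/2) √T`; its division by `√T` is already
  -- included in `hbound`.
  have h3 : θ.tau * R ≤ Real.exp (T / 2) * (Real.sqrt T * (θ.tau * R / Real.sqrt T)) := by
    rw [mul_div_cancel₀ _ hsT.ne']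
    exact le_mul_of_one_le_left (by positivity) (Real.one_le_exp (by positivity))
  set γτ := θ.tau ^ (1 / (3 - p)) with hγ
  have hγ0 : 0 ≤ γτ := Real.rpow_nonneg hτ0 _
  calc _ ≤ Real.exp (T / 2) * (‖x 0 - u 0‖ + Real.sqrt T *
          (Real.sqrt Y + (2 * ‖b - f‖ + 2 * (ε * β)))) +
          Real.exp (T / 2) * (Real.sqrt T * (θ.tau * R / Real.sqrt T)) := by gcongr
    _ = Real.exp (T / 2) * (‖x 0 - u 0‖ + Real.sqrt T *
          ((Real.sqrt Y + θ.tau * R / Real.sqrt T) + (2 * ‖b - f‖ + 2 * (ε * β)))) := by ring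
    _ ≤ Real.exp (T / 2) * (‖x 0 - u 0‖ + Real.sqrt T *
          ((C₁ + (2 + 2 * β)) * (γτ + ‖b - f‖ + ε))) := by
        gcongr
        have q1 : 0 ≤ ‖b - f‖ := norm_nonneg _
        have q2 : 0 ≤ C₁ * ‖b - f‖ := by positivity
        have q3 : 0 ≤ C₁ * ε := by positivity
        have q4 : 0 ≤ β * γτ := by positivity
        have q5 : 0 ≤ β * ‖b - f‖ := by positivity
        linarith
    _ = _ := by ring

end Rate

/-! ### Solutions of the continuous problem -/

section Solution

open Set Filter Topology
open scoped NNReal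

variable {d : ℕ} {p : ℝ} {K : Pt d → Pt d → ℝ} {M : ℝ≥0} {T : ℝ} {f g : Pt d → ℝ}

/-- The inclusion of `L²(Ω)` in `L¹(Ω)`. -/
noncomputable def lpIncl (d : ℕ) : Lp ℝ 2 (muOm d) →L[ℝ] Lp ℝ 1 (muOm d) :=
  LinearMap.mkContinuous
    { toFun := fun u => ((Lp.memLp u).mono_exponent one_le_two).toLp u
      map_add' := fun u v => by
        rw [← MemLp.toLp_add]
        exact MemLp.toLp_congr _ _ (Lp.coeFn_add u v)
      map_smul' := fun c u => by
        rw [RingHom.id_apply, ← MemLp.toLp_const_smul]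
        exact MemLp.toLp_congr _ _ (Lp.coeFn_smul c u) }
    1 fun u => by
      rw [one_mul]
      simp only [LinearMap.coe_mk, AddHom.coe_mk]
      rw [Lp.norm_toLp, Lp.norm_def]
      exact ENNReal.toReal_mono (Lp.eLpNorm_ne_top _)
        (eLpNorm_le_eLpNorm_of_exponent_le one_le_two (Lp.aestronglyMeasurable u))

lemma coeFn_lpIncl (u : Lp ℝ 2 (muOm d)) : lpIncl d u =ᵐ[muOm d] u :=
  MemLp.coeFn_toLp ((Lp.memLp u).mono_exponent one_le_two)

lemma IsKernel.isSolution_of_flow (hK : IsKernel K M) (hp1 : 1 < p) (hp2 : p ≤ 2) (hM : 0 < M)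
    (hf : MemLp f 2 (muOm d)) (hg : MemLp g 2 (muOm d)) {u : ℝ → Lp ℝ 2 (muOm d)}
    (huc : Continuous u) (hu0 : u 0 = hg.toLp g)
    (hu : ∀ t ∈ Icc 0 T, HasDerivAt u (-plapLp K p (u t) + hf.toLp f) t) :
    IsSolution p T K (fun _ => f) g (fun t => lpIncl d (u t)) := by
  have hAc : Continuous fun t => lpIncl d (-plapLp K p (u t) + hf.toLp f) :=
    (lpIncl d).continuous.comp ((((hK.cocoercive hp1 hp2 hM).uniformContinuous
      (coerConst_pos hM) hp1).continuous.comp huc).neg.add continuous_const)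
  refine ⟨((lpIncl d).continuous.comp huc).continuousOn, ?_,
    fun t => lpIncl d (-plapLp K p (u t) + hf.toLp f), hAc.intervalIntegrable _ _, ?_, ?_⟩
  · filter_upwards [coeFn_lpIncl (u 0), hg.coeFn_toLp] with x h1 h2
    rw [h1, hu0, h2]
  · intro t ht
    rw [intervalIntegral.integral_eq_sub_of_hasDerivAt (f := fun t => lpIncl d (u t))
      (fun s hs => ?_) (hAc.intervalIntegrable _ _)]
    · abel
    · rw [uIcc_of_le ht.1] at hs
      exact (lpIncl d).hasFDerivAt.comp_hasDerivAt s (hu s ⟨hs.1, hs.2.trans ht.2⟩)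
  · refine Eventually.of_forall fun t => ?_
    filter_upwards [coeFn_lpIncl (-plapLp K p (u t) + hf.toLp f),
      Lp.coeFn_add (-plapLp K p (u t)) (hf.toLp f), Lp.coeFn_neg (plapLp K p (u t)),
      hK.coeFn_plapLp hp1 hp2 (u t), hf.coeFn_toLp,
      plap_congr (K := K) (p := p) (coeFn_lpIncl (u t))] with x h1 h2 h3 h4 h5 h6
    rw [h1, h2, Pi.add_apply, h3, Pi.neg_apply, h4, h5, h6]

lemma IsKernel.isSolution_le (hK : IsKernel K M) (hp1 : 1 < p) (hp2 : p ≤ 2)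
    {U V : ℝ → Lp ℝ 1 (muOm d)} (hU : IsSolution p T K (fun _ => f) g U)
    (hV : IsSolution p T K (fun _ => f) g V) {t : ℝ} (ht : t ∈ Icc 0 T) :
    U t ≤ᵐ[muOm d] V t := by
  obtain ⟨-, hU0, U', hU1, hU2, hU3⟩ := hU
  obtain ⟨-, hV0, V', hV1, hV2, hV3⟩ := hV
  refine hK.comparison hp1 hp2 hU1 hV1 hU2 hV2 (hU0.trans hV0.symm).le ?_ ht
  filter_upwards [hU3, hV3] with s h1 h2
  filter_upwards [h1, h2] with x h3 h4
  rw [h3, h4]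
  apply le_of_eq
  ring

lemma IsKernel.isSolution_unique (hK : IsKernel K M) (hp1 : 1 < p) (hp2 : p ≤ 2)
    {U V : ℝ → Lp ℝ 1 (muOm d)} (hU : IsSolution p T K (fun _ => f) g U)
    (hV : IsSolution p T K (fun _ => f) g V) {t : ℝ} (ht : t ∈ Icc 0 T) : U t = V t :=
  Lp.ext ((hK.isSolution_le hp1 hp2 hU hV ht).antisymm (hK.isSolution_le hp1 hp2 hV hU ht))

lemma plap_const (a : ℝ) (x : Pt d) : plap K p (fun _ => a) x = 0 := by simp [plap, psi_zero]

/-- Maximum principle. -/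
lemma IsKernel.isSolution_abs_le (hK : IsKernel K M) (hp1 : 1 < p) (hp2 : p ≤ 2)
    {U : ℝ → Lp ℝ 1 (muOm d)} (hU : IsSolution p T K (fun _ => f) g U) {F G : ℝ}
    (hF : ∀ᵐ x ∂(muOm d), |f x| ≤ F) (hG : ∀ᵐ x ∂(muOm d), |g x| ≤ G) {t : ℝ}
    (ht : t ∈ Icc 0 T) : ∀ᵐ x ∂(muOm d), |U t x| ≤ G + t * F := by
  obtain ⟨-, hU0, U', hU1, hU2, hU3⟩ := hU
  -- Spatially constant barriers `a + t b`: the operator vanishes on them, so they solve the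
  -- equation with source `b`.
  set V : ℝ → ℝ → ℝ → Lp ℝ 1 (muOm d) := fun a b t => (a + t * b) • Lp.const 1 (muOm d) (1 : ℝ)
    with hV
  set V' : ℝ → ℝ → Lp ℝ 1 (muOm d) := fun b _ => b • Lp.const 1 (muOm d) (1 : ℝ) with hV'
  have hVc : ∀ a b t, V a b t =ᵐ[muOm d] fun _ => a + t * b := fun a b t => by
    filter_upwards [Lp.coeFn_smul (a + t * b) (Lp.const 1 (muOm d) (1 : ℝ)),
      Lp.coeFn_const (p := 1) (μ := muOm d) (1 : ℝ)] with x h1 h2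
    rw [h1, Pi.smul_apply, h2]
    simp
  have hVc' : ∀ b t, V' b t =ᵐ[muOm d] fun _ => b := fun b t => by
    filter_upwards [Lp.coeFn_smul b (Lp.const 1 (muOm d) (1 : ℝ)),
      Lp.coeFn_const (p := 1) (μ := muOm d) (1 : ℝ)] with x h1 h2
    rw [h1, Pi.smul_apply, h2]
    simp
  have hVi : ∀ b, IntervalIntegrable (V' b) volume 0 T := fun b => intervalIntegrable_const
  have hVe : ∀ a b, ∀ t ∈ Icc 0 T, V a b t = V a b 0 + ∫ r in (0 : ℝ)..t, V' b r := by
    intro a b t _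
    simp only [hV, hV']
    rw [intervalIntegral.integral_const, smul_smul, ← add_smul]
    congr 1
    ring
  have h1 : U t ≤ᵐ[muOm d] V G F t := by
    refine hK.comparison hp1 hp2 hU1 (hVi F) hU2 (hVe G F) ?_ ?_ ht
    · filter_upwards [hU0, hG, hVc G F 0] with x h1 h2 h3
      rw [h1, h3]
      linarith [le_abs_self (g x)]
    · filter_upwards [hU3] with s hs
      filter_upwards [hs, hF, hVc' F s, plap_congr (K := K) (p := p) (hVc G F s)] with x h1 h2 h3 h4
      rw [h1, h3, h4, plap_const]
      linarith [le_abs_self (f x)]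
  have h2 : V (-G) (-F) t ≤ᵐ[muOm d] U t := by
    refine hK.comparison hp1 hp2 (hVi (-F)) hU1 (hVe (-G) (-F)) hU2 ?_ ?_ ht
    · filter_upwards [hU0, hG, hVc (-G) (-F) 0] with x h1 h2 h3
      rw [h1, h3]
      linarith [neg_abs_le (g x)]
    · filter_upwards [hU3] with s hs
      filter_upwards [hs, hF, hVc' (-F) s,
        plap_congr (K := K) (p := p) (hVc (-G) (-F) s)] with x h1 h2 h3 h4
      rw [h1, h3, h4, plap_const]
      linarith [neg_abs_le (f x)]
  filter_upwards [h1, h2, hVc G F t, hVc (-G) (-F) t] with x h1 h2 h3 h4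
  rw [h3] at h1
  rw [h4] at h2
  rw [abs_le]
  constructor <;> linarith

end Solution

/-! ### The mesh -/

section Mesh

open Set Filter
open scoped NNReal

variable {d n : ℕ} (m : Mesh d n)

lemma Mesh.pt_mem (k : Fin d) (a : Fin (n + 1)) : m.pt k a ∈ Icc (0 : ℝ) 1 := by
  constructor
  · rw [← m.pt_zero k]
    exact (m.strictMono k).monotone (Fin.zero_le a)
  · rw [← m.pt_last k]
    exact (m.strictMono k).monotone (Fin.le_last a)

lemma Mesh.cell_subset (i : Fin d → Fin n) : m.cell i ⊆ Om d := by
  intro x hx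
  simp only [Mesh.cell, mem_univ_pi, mem_Ioc] at hx
  exact ⟨fun k => (m.pt_mem k _).1.trans (hx k).1.le, fun k => (hx k).2.trans (m.pt_mem k _).2⟩

lemma Mesh.measurableSet_cell (i : Fin d → Fin n) : MeasurableSet (m.cell i) :=
  MeasurableSet.univ_pi fun _ => measurableSet_Ioc

lemma Mesh.volume_cell (i : Fin d → Fin n) : volume (m.cell i) =
    ∏ k, ENNReal.ofReal (m.pt k (i k).succ - m.pt k (i k).castSucc) := by
  rw [Mesh.cell, Real.volume_pi_Ioc]

lemma Mesh.volume_cell_pos (i : Fin d → Fin n) : 0 < volume (m.cell i) := by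
  rw [m.volume_cell, pos_iff_ne_zero, Finset.prod_ne_zero_iff]
  intro k _
  rw [← pos_iff_ne_zero, ENNReal.ofReal_pos, sub_pos]
  exact m.strictMono k (i k).castSucc_lt_succ

lemma Mesh.volume_cell_ne_top (i : Fin d → Fin n) : volume (m.cell i) ≠ ⊤ := by
  rw [m.volume_cell]
  exact ENNReal.prod_ne_top fun _ _ => ENNReal.ofReal_ne_top

lemma Mesh.vol_pos (i : Fin d → Fin n) : 0 < m.vol i :=
  ENNReal.toReal_pos (m.volume_cell_pos i).ne' (m.volume_cell_ne_top i)

lemma Mesh.ofReal_vol (i : Fin d → Fin n) : ENNReal.ofReal (m.vol i) = volume (m.cell i) :=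
  ENNReal.ofReal_toReal (m.volume_cell_ne_top i)

lemma Mesh.eq_of_mem_cell {i j : Fin d → Fin n} {x : Pt d} (hi : x ∈ m.cell i)
    (hj : x ∈ m.cell j) : i = j := by
  simp only [Mesh.cell, mem_univ_pi, mem_Ioc] at hi hj
  have key : ∀ i j : Fin d → Fin n, (∀ k, m.pt k (i k).castSucc < x k ∧ x k ≤ m.pt k (i k).succ) →
      (∀ k, m.pt k (j k).castSucc < x k ∧ x k ≤ m.pt k (j k).succ) → ∀ k, i k ≤ j k := by
    intro i j hi hj k
    have h := (m.strictMono k).lt_iff_lt.1 ((hi k).1.trans_le (hj k).2)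
    rw [Fin.lt_def] at h
    rw [Fin.le_def]
    simp only [Fin.val_castSucc, Fin.val_succ] at h
    omega
  funext k
  exact le_antisymm (key i j hi hj k) (key j i hj hi k)

lemma exists_mem_Ioc_of_grid {n : ℕ} {a : Fin (n + 1) → ℝ} (h0 : a 0 = 0)
    (h1 : a (Fin.last n) = 1) {x : ℝ} (hx0 : 0 < x) (hx1 : x ≤ 1) :
    ∃ j : Fin n, x ∈ Ioc (a j.castSucc) (a j.succ) := by
  by_contra hcon
  push Not at hcon
  have key : ∀ j : Fin (n + 1), a j < x := by
    intro j
    induction j using Fin.induction with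
    | zero => rwa [h0]
    | succ j ih =>
      by_contra hlt
      exact hcon j ⟨ih, not_lt.1 hlt⟩
  have := key (Fin.last n)
  rw [h1] at this
  linarith

lemma Mesh.exists_mem_cell {x : Pt d} (hx : ∀ k, 0 < x k ∧ x k ≤ 1) : ∃ i, x ∈ m.cell i := by
  choose i hi using fun k => exists_mem_Ioc_of_grid (m.pt_zero k) (m.pt_last k) (hx k).1 (hx k).2
  exact ⟨i, by simpa [Mesh.cell, mem_univ_pi] using hi⟩

lemma Mesh.iUnion_cell : (⋃ i, m.cell i) = univ.pi fun _ => Ioc (0 : ℝ) 1 := by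
  apply Subset.antisymm
  · refine iUnion_subset fun i x hx => ?_
    simp only [Mesh.cell, mem_univ_pi, mem_Ioc] at hx ⊢
    exact fun k => ⟨(m.pt_mem k _).1.trans_lt (hx k).1, (hx k).2.trans (m.pt_mem k _).2⟩
  · intro x hx
    simp only [mem_univ_pi, mem_Ioc] at hx
    exact mem_iUnion.2 (m.exists_mem_cell hx)

/-- The half-open cells are disjoint and fill `]0,1]^d`, which differs from the closed cube by a
null set. -/
lemma Mesh.muOm_eq_sum : muOm d = ∑ i, volume.restrict (m.cell i) := by
  have h1 : (Om d : Set (Pt d)) =ᵐ[volume] ⋃ i, m.cell i := by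
    rw [m.iUnion_cell]
    exact (Measure.univ_pi_Ioc_ae_eq_Icc (f := (0 : Pt d)) (g := 1)
      (μ := fun _ : Fin d => (volume : Measure ℝ))).symm
  rw [muOm, Measure.restrict_congr_set h1, Measure.restrict_iUnion (fun i j hij =>
    Set.disjoint_left.2 fun x hi hj => hij (m.eq_of_mem_cell hi hj)) m.measurableSet_cell,
    Measure.sum_fintype]

lemma Mesh.ae_muOm_iff {P : Pt d → Prop} :
    (∀ᵐ x ∂(muOm d), P x) ↔ ∀ i, ∀ᵐ x ∂(volume.restrict (m.cell i)), P x := by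
  rw [m.muOm_eq_sum, ← Measure.sum_fintype, Measure.ae_sum_iff]

lemma Mesh.ae_of_cell {P : Pt d → Prop} (h : ∀ i, ∀ x ∈ m.cell i, P x) : ∀ᵐ x ∂(muOm d), P x :=
  m.ae_muOm_iff.2 fun i => (ae_restrict_iff' (m.measurableSet_cell i)).2
    (Eventually.of_forall fun x hx => h i x hx)

lemma Mesh.lintegral_muOm (F : Pt d → ℝ≥0∞) :
    ∫⁻ x, F x ∂(muOm d) = ∑ i, ∫⁻ x in m.cell i, F x := by
  rw [m.muOm_eq_sum, lintegral_finsetSum_measure]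

lemma Mesh.integrableOn_cell {F : Pt d → ℝ} (hF : Integrable F (muOm d)) (i : Fin d → Fin n) :
    IntegrableOn F (m.cell i) :=
  IntegrableOn.mono_set hF (m.cell_subset i)

lemma Mesh.indicator_cell {i j : Fin d → Fin n} {x : Pt d} (hx : x ∈ m.cell i) :
    (m.cell j).indicator (fun _ => (1 : ℝ)) x = if j = i then 1 else 0 := by
  split_ifs with h
  · rw [h, indicator_of_mem hx]
  · exact indicator_of_notMem (fun hj => h (m.eq_of_mem_cell hj hx)) _

lemma Mesh.inj_apply (v : (Fin d → Fin n) → ℝ) {i : Fin d → Fin n} {x : Pt d}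
    (hx : x ∈ m.cell i) : m.inj v x = v i := by
  simp [Mesh.inj, m.indicator_cell hx]

lemma Mesh.inj2_apply (A : (Fin d → Fin n) → (Fin d → Fin n) → ℝ) {i j : Fin d → Fin n}
    {x y : Pt d} (hx : x ∈ m.cell i) (hy : y ∈ m.cell j) : m.inj2 A x y = A i j := by
  simp [Mesh.inj2, m.indicator_cell hx, m.indicator_cell hy]

lemma Mesh.measurable_inj (v : (Fin d → Fin n) → ℝ) : Measurable (m.inj v) := by
  unfold Mesh.inj
  exact Finset.measurable_sum _ fun i _ =>
    (measurable_const.indicator (m.measurableSet_cell i)).const_mul _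

lemma Mesh.measurable_inj2 (A : (Fin d → Fin n) → (Fin d → Fin n) → ℝ) :
    Measurable (Function.uncurry (m.inj2 A)) := by
  unfold Mesh.inj2 Function.uncurry
  refine Finset.measurable_sum _ fun i _ => Finset.measurable_sum _ fun j _ => ?_
  exact (((measurable_const.indicator (m.measurableSet_cell i)).comp measurable_fst).const_mul
    _).mul ((measurable_const.indicator (m.measurableSet_cell j)).comp measurable_snd)

lemma Mesh.memLp_inj (v : (Fin d → Fin n) → ℝ) : MemLp (m.inj v) 2 (muOm d) := by
  refine MemLp.of_bound (m.measurable_inj v).aestronglyMeasurable (∑ i, |v i|)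
    (m.ae_of_cell fun i x hx => ?_)
  rw [m.inj_apply v hx, Real.norm_eq_abs]
  exact Finset.single_le_sum (f := fun i => |v i|) (fun _ _ => abs_nonneg _) (Finset.mem_univ i)

lemma Mesh.integral_muOm {F : Pt d → ℝ} (hF : ∀ i, IntegrableOn F (m.cell i)) :
    ∫ x, F x ∂(muOm d) = ∑ i, ∫ x in m.cell i, F x := by
  rw [m.muOm_eq_sum, integral_finsetSum_measure fun i _ => hF i]

/-- The discrete operator is the restriction of the continuous one to step functions. -/
lemma Mesh.plap_inj {p : ℝ} (A : (Fin d → Fin n) → (Fin d → Fin n) → ℝ)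
    (v : (Fin d → Fin n) → ℝ) {i : Fin d → Fin n} {x : Pt d} (hx : x ∈ m.cell i) :
    plap (m.inj2 A) p (m.inj v) x = m.plapDisc A p v i := by
  have hcell : ∀ j, EqOn (fun y => m.inj2 A x y * Psi p (m.inj v y - m.inj v x))
      (fun _ => A i j * Psi p (v j - v i)) (m.cell j) := fun j y hy => by
    simp only [m.inj2_apply A hx hy, m.inj_apply v hx, m.inj_apply v hy]
  rw [plap, Mesh.plapDisc, m.integral_muOm fun j => ?_]
  · congr 1
    refine Finset.sum_congr rfl fun j _ => ?_
    rw [setIntegral_congr_fun (m.measurableSet_cell j) (hcell j), setIntegral_const, smul_eq_mul,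
      Measure.real, ← Mesh.vol, mul_assoc]
  · exact (integrableOn_const (m.volume_cell_ne_top j)).congr_fun (hcell j).symm
      (m.measurableSet_cell j)

lemma enorm_setIntegral_sq_le {E : Type*} [MeasureSpace E] {Q : Set E} {F : E → ℝ}
    (hF : AEStronglyMeasurable F (volume.restrict Q)) :
    ‖∫ x in Q, F x‖ₑ ^ 2 ≤ volume Q * ∫⁻ x in Q, ‖F x‖ₑ ^ 2 := by
  have h1 : ‖∫ x in Q, F x‖ₑ ≤ ∫⁻ x in Q, ‖F x‖ₑ := enorm_integral_le_lintegral_enorm _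
  -- With weight 1 and exponent 2 this is the Cauchy–Schwarz inequality.
  have h2 := lintegral_weighted_rpow_le (ν := volume.restrict Q) (p := 2) (by norm_num)
    (k := fun _ => 1) aemeasurable_const hF.enorm
  norm_num at h2
  refine le_trans ?_ h2
  gcongr

end Mesh

/-! ### Mean values over a set in `L²`. -/

section Mean

open Set Filter
open scoped NNReal

lemma eLpNorm_two_sq {α : Type*} [MeasurableSpace α] {μ : Measure α} (F : α → ℝ) :
    eLpNorm F 2 μ ^ 2 = ∫⁻ x, ‖F x‖ₑ ^ 2 ∂μ := by
  rw [eLpNorm_eq_lintegral_rpow_enorm_toReal (by simp) (by simp), ← ENNReal.rpow_natCast,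
    ← ENNReal.rpow_mul]
  simp

lemma le_of_sq_le_sq_ennreal {a b : ℝ≥0∞} (h : a ^ 2 ≤ b ^ 2) : a ≤ b :=
  (ENNReal.pow_le_pow_left_iff two_ne_zero).1 h

lemma enorm_sq_eq (a : ℝ) : ‖a‖ₑ ^ 2 = ENNReal.ofReal (a ^ 2) := by
  rw [Real.enorm_eq_ofReal_abs, ← ENNReal.ofReal_pow (abs_nonneg a), sq_abs]

lemma enorm_add_sq_le (a b : ℝ) : ‖a + b‖ₑ ^ 2 ≤ 2 * ‖a‖ₑ ^ 2 + 2 * ‖b‖ₑ ^ 2 := by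
  rw [enorm_sq_eq, enorm_sq_eq, enorm_sq_eq, show (2 : ℝ≥0∞) = ENNReal.ofReal 2 by simp,
    ← ENNReal.ofReal_mul (by norm_num), ← ENNReal.ofReal_mul (by norm_num),
    ← ENNReal.ofReal_add (by positivity) (by positivity)]
  apply ENNReal.ofReal_le_ofReal
  nlinarith [sq_nonneg (a - b)]

variable {E : Type*} [MeasureSpace E]

/-- The mean value does not increase the `L²` norm. -/
lemma volume_mul_enorm_mean_sq_le {Q : Set E} {F : E → ℝ} {c : ℝ} (hc : 0 < c)
    (hcQ : ENNReal.ofReal c = volume Q) (hF : AEStronglyMeasurable F (volume.restrict Q)) :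
    volume Q * ‖(1 / c) * ∫ x in Q, F x‖ₑ ^ 2 ≤ ∫⁻ x in Q, ‖F x‖ₑ ^ 2 := by
  have h := enorm_setIntegral_sq_le hF
  have h0 : ENNReal.ofReal c ≠ 0 := by simpa using hc
  rw [← hcQ] at h ⊢
  rw [enorm_mul, mul_pow, Real.enorm_of_nonneg (by positivity), one_div,
    ENNReal.ofReal_inv_of_pos hc]
  calc ENNReal.ofReal c * ((ENNReal.ofReal c)⁻¹ ^ 2 * ‖∫ x in Q, F x‖ₑ ^ 2)
      ≤ ENNReal.ofReal c * ((ENNReal.ofReal c)⁻¹ ^ 2 *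
        (ENNReal.ofReal c * ∫⁻ x in Q, ‖F x‖ₑ ^ 2)) := by gcongr
    _ = (ENNReal.ofReal c * (ENNReal.ofReal c)⁻¹) * (ENNReal.ofReal c * (ENNReal.ofReal c)⁻¹) *
        ∫⁻ x in Q, ‖F x‖ₑ ^ 2 := by ring
    _ = ∫⁻ x in Q, ‖F x‖ₑ ^ 2 := by
        rw [ENNReal.mul_inv_cancel h0 ENNReal.ofReal_ne_top, one_mul, one_mul]

/-- The mean reproduces the constant `a` and contracts the `L²` norm of `F - a`. Freedom in `a` is
essential: below, `a` is a value of `F` at a point that may lie outside `Q`. -/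
lemma setLIntegral_mean_sub_le {Q : Set E} (hQ : MeasurableSet Q) {F Fn : E → ℝ} {c : ℝ}
    (hc : 0 < c) (hcQ : ENNReal.ofReal c = volume Q) (hF : IntegrableOn F Q)
    (hFn : ∀ x ∈ Q, Fn x = (1 / c) * ∫ y in Q, F y) (a : ℝ) :
    ∫⁻ x in Q, ‖Fn x - F x‖ₑ ^ 2 ≤ 4 * ∫⁻ x in Q, ‖F x - a‖ₑ ^ 2 := by
  have hQtop : volume Q ≠ ⊤ := by
    rw [← hcQ]
    exact ENNReal.ofReal_ne_top
  have hai : IntegrableOn (fun _ => a) Q := integrableOn_const hQtop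
  set A : ℝ := (1 / c) * ∫ y in Q, (F y - a) with hA
  have hmean : (1 / c) * ∫ y in Q, F y = A + a := by
    rw [hA, integral_sub hF hai, setIntegral_const, smul_eq_mul, Measure.real, ← hcQ,
      ENNReal.toReal_ofReal hc.le]
    field_simp
    ring
  have hm := volume_mul_enorm_mean_sq_le hc hcQ (hF.aestronglyMeasurable.sub
    hai.aestronglyMeasurable)
  calc ∫⁻ x in Q, ‖Fn x - F x‖ₑ ^ 2
      ≤ ∫⁻ x in Q, (2 * ‖A‖ₑ ^ 2 + 2 * ‖F x - a‖ₑ ^ 2) := by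
        apply setLIntegral_mono' hQ
        intro x hx
        rw [hFn x hx, hmean, show A + a - F x = A + -(F x - a) by ring]
        refine (enorm_add_sq_le _ _).trans_eq ?_
        rw [enorm_neg]
    _ = 2 * (volume Q * ‖A‖ₑ ^ 2) + 2 * ∫⁻ x in Q, ‖F x - a‖ₑ ^ 2 := by
        rw [lintegral_add_left measurable_const, setLIntegral_const,
          lintegral_const_mul' _ _ (by simp)]
        ring
    _ ≤ 2 * (∫⁻ x in Q, ‖F x - a‖ₑ ^ 2) + 2 * ∫⁻ x in Q, ‖F x - a‖ₑ ^ 2 := by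
        gcongr
        exact hm
    _ = 4 * ∫⁻ x in Q, ‖F x - a‖ₑ ^ 2 := by ring

end Mean

/-! ### Approximation by mean values in Lipschitz spaces -/

section Approx

open Set Filter
open scoped NNReal

variable {E : Type} [AddGroup E] [MeasureSpace E] {ℓ : E → ℝ} {S : Set E} {F : E → ℝ}

/-- A null set stays null under translation, so the modulus may be computed from a Borel measurable
representative. -/
lemma modSmooth_congr [MeasurableAdd E] [(volume : Measure E).IsAddRightInvariant] {q : ℝ≥0∞}
    {F' : E → ℝ} (hS : MeasurableSet S) (h : F =ᵐ[volume.restrict S] F') (r : ℝ) :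
    modSmooth ℓ S q F r = modSmooth ℓ S q F' r := by
  unfold modSmooth
  refine iSup_congr fun z => iSup_congr fun _ => eLpNorm_congr_ae ?_
  have h' := (ae_restrict_iff' hS).1 h
  have h'' := (measurePreserving_add_right volume z).quasiMeasurePreserving.ae h'
  refine (ae_restrict_iff' (hS.inter (measurable_add_const z hS))).2 ?_
  filter_upwards [h', h''] with x h1 h2 hx
  rw [h1 hx.1, h2 hx.2]

/-- Mean values over small cells approximate in `L²` with the accuracy of the modulus of
smoothness. The sets `B i` play the role of enlarged cells of comparable size. -/
theorem eLpNorm_mean_sub_sq_le [MeasurableAdd₂ E] [SFinite (volume : Measure E)]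
    [(volume : Measure E).IsAddLeftInvariant]
    {ι : Type*} [Fintype ι] {Q B : ι → Set E} {W : Set E} {c : ι → ℝ}
    {Fn : E → ℝ} {b ρ : ℝ≥0∞} {h : ℝ} (hF : Measurable F)
    (hFS : ∀ i, IntegrableOn F (Q i)) (hS : MeasurableSet S)
    (hSQ : volume.restrict S = ∑ i, volume.restrict (Q i)) (hQ : ∀ i, MeasurableSet (Q i))
    (hc : ∀ i, 0 < c i) (hcQ : ∀ i, ENNReal.ofReal (c i) = volume (Q i))
    (hB : ∀ i, MeasurableSet (B i)) (hBS : ∀ i, B i ⊆ S) (hBb : ∀ i, volume (B i) = b)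
    (hb0 : b ≠ 0) (hb : b ≠ ⊤) (hW : MeasurableSet W) (hWb : volume W ≤ ρ * b)
    (hWℓ : ∀ w ∈ W, ℓ w < h) (hQBW : ∀ i, ∀ x ∈ Q i, ∀ w, x + w ∈ B i → w ∈ W)
    (hFn : ∀ i, ∀ x ∈ Q i, Fn x = (1 / c i) * ∫ y in Q i, F y) :
    eLpNorm (fun x => Fn x - F x) 2 (volume.restrict S) ^ 2 ≤
      4 * ρ * modSmooth ℓ S 2 F h ^ 2 := by
  -- The squared increment for the displacement `w`, cut off when `x + w` leaves `S`.
  set Φ : E → E → ℝ≥0∞ := fun x w => S.indicator (fun y => ‖F x - F y‖ₑ ^ 2) (x + w) with hΦ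
  have hΦm : Measurable (Function.uncurry Φ) := by
    have h1 : Measurable fun z : E × E => ‖F z.1 - F (z.1 + z.2)‖ₑ ^ 2 :=
      (((hF.comp measurable_fst).sub (hF.comp (measurable_fst.add measurable_snd))).enorm.pow_const
        _)
    have h2 : MeasurableSet {z : E × E | z.1 + z.2 ∈ S} := (measurable_fst.add measurable_snd) hS
    exact h1.indicator h2
  -- The inequality for means is averaged over `a = F z`, `z ∈ B i`. Averaging over sets of the
  -- common measure `b`, rather than over the cells, avoids any dependence on how thin or unequal
  -- the cells are.
  have hcell : ∀ i, b * ∫⁻ x in Q i, ‖Fn x - F x‖ₑ ^ 2 ≤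
      4 * ∫⁻ x in Q i, ∫⁻ w in W, Φ x w := by
    intro i
    calc b * ∫⁻ x in Q i, ‖Fn x - F x‖ₑ ^ 2
        = ∫⁻ _ in B i, ∫⁻ x in Q i, ‖Fn x - F x‖ₑ ^ 2 := by
          rw [setLIntegral_const, hBb, mul_comm]
      _ ≤ ∫⁻ z in B i, 4 * ∫⁻ x in Q i, ‖F x - F z‖ₑ ^ 2 :=
          lintegral_mono fun z => setLIntegral_mean_sub_le (hQ i) (hc i) (hcQ i) (hFS i) (hFn i) _
      _ = 4 * ∫⁻ x in Q i, ∫⁻ z in B i, ‖F x - F z‖ₑ ^ 2 := by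
          rw [lintegral_const_mul' _ _ (by simp), lintegral_lintegral_swap]
          exact (((hF.comp measurable_snd).sub (hF.comp measurable_fst)).enorm.pow_const
            _).aemeasurable
      _ ≤ 4 * ∫⁻ x in Q i, ∫⁻ w in W, Φ x w := by
          gcongr 4 * ?_
          apply setLIntegral_mono' (hQ i)
          intro x hx
          rw [← lintegral_indicator (hB i), ← lintegral_indicator hW,
            ← lintegral_add_left_eq_self _ x]
          refine lintegral_mono fun w => ?_
          by_cases hw : x + w ∈ B i
          · rw [indicator_of_mem hw, indicator_of_mem (hQBW i x hx w hw)]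
            simp only [hΦ]
            rw [indicator_of_mem (hBS i hw)]
          · rw [indicator_of_notMem hw]
            exact zero_le
  have hsum : b * eLpNorm (fun x => Fn x - F x) 2 (volume.restrict S) ^ 2 ≤
      b * (4 * ρ * modSmooth ℓ S 2 F h ^ 2) := by
    calc b * eLpNorm (fun x => Fn x - F x) 2 (volume.restrict S) ^ 2
        = ∑ i, b * ∫⁻ x in Q i, ‖Fn x - F x‖ₑ ^ 2 := by
          rw [eLpNorm_two_sq, hSQ, lintegral_finsetSum_measure, Finset.mul_sum]
      _ ≤ ∑ i, 4 * ∫⁻ x in Q i, ∫⁻ w in W, Φ x w := Finset.sum_le_sum fun i _ => hcell i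
      _ = 4 * ∫⁻ w in W, ∫⁻ x in S, Φ x w := by
          rw [← Finset.mul_sum, ← lintegral_finsetSum_measure, ← hSQ,
            lintegral_lintegral_swap hΦm.aemeasurable]
      -- After exchange of the integrals, the inner one is the squared increment for a single
      -- translation `w`, bounded by the modulus.
      _ ≤ 4 * ∫⁻ _ in W, modSmooth ℓ S 2 F h ^ 2 := by
          gcongr 4 * ?_
          apply setLIntegral_mono' hW
          intro w hw
          have hset : MeasurableSet {x | x ∈ S ∧ x + w ∈ S} :=
            hS.inter (measurable_add_const w hS)
          have e1 : ∫⁻ x in S, Φ x w =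
              eLpNorm (fun x => F (x + w) - F x) 2 (volume.restrict {x | x ∈ S ∧ x + w ∈ S}) ^ 2 := by
            rw [eLpNorm_two_sq, ← lintegral_indicator hS, ← lintegral_indicator hset]
            refine lintegral_congr fun x => ?_
            by_cases h1 : x ∈ S
            · by_cases h2 : x + w ∈ S
              · rw [indicator_of_mem h1, indicator_of_mem (show x ∈ {x | x ∈ S ∧ x + w ∈ S} from
                  ⟨h1, h2⟩)]
                simp only [hΦ]
                rw [indicator_of_mem h2, ← enorm_neg, neg_sub]
              · rw [indicator_of_mem h1, indicator_of_notMem (fun hx => h2 hx.2)]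
                simp only [hΦ]
                rw [indicator_of_notMem h2]
            · rw [indicator_of_notMem h1, indicator_of_notMem (fun hx => h1 hx.1)]
          rw [e1]
          gcongr
          exact le_iSup₂_of_le w (hWℓ w hw) le_rfl
      _ ≤ 4 * (modSmooth ℓ S 2 F h ^ 2 * (ρ * b)) := by
          rw [setLIntegral_const]
          gcongr
      _ = b * (4 * ρ * modSmooth ℓ S 2 F h ^ 2) := by ring
  exact (ENNReal.mul_le_mul_iff_right hb0 hb).1 hsum

lemma MemLip.exists_modSmooth_le {s : ℝ} {q : ℝ≥0∞} (hF : MemLip ℓ S s q F) :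
    ∃ C : ℝ, 0 ≤ C ∧ ∀ h, 0 < h → modSmooth ℓ S q F h ≤ ENNReal.ofReal (C * h ^ s) := by
  set c := ⨆ (h : ℝ) (_ : 0 < h), ENNReal.ofReal (h ^ (-s)) * modSmooth ℓ S q F h with hc
  refine ⟨c.toReal, ENNReal.toReal_nonneg, fun h hh => ?_⟩
  have h1 : ENNReal.ofReal (h ^ (-s)) * modSmooth ℓ S q F h ≤ c :=
    le_iSup₂_of_le (f := fun (h : ℝ) (_ : 0 < h) =>
      ENNReal.ofReal (h ^ (-s)) * modSmooth ℓ S q F h) h hh le_rfl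
  have h2 : ENNReal.ofReal (h ^ s) * ENNReal.ofReal (h ^ (-s)) = 1 := by
    rw [← ENNReal.ofReal_mul (by positivity), ← Real.rpow_add hh, add_neg_cancel, Real.rpow_zero,
      ENNReal.ofReal_one]
  calc modSmooth ℓ S q F h
      = ENNReal.ofReal (h ^ s) * (ENNReal.ofReal (h ^ (-s)) * modSmooth ℓ S q F h) := by
        rw [← mul_assoc, h2, one_mul]
    _ ≤ ENNReal.ofReal (h ^ s) * c := by gcongr
    _ = ENNReal.ofReal (c.toReal * h ^ s) := by
        rw [ENNReal.ofReal_mul ENNReal.toReal_nonneg, ENNReal.ofReal_toReal hF.2.ne, mul_comm]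

end Approx

/-! ### The discrete scheme as an Euler scheme in `L²(Ω)`, with constants uniform in the mesh. -/

section Discretization

open Set Filter
open scoped NNReal

variable {d n : ℕ} (m : Mesh d n) {p : ℝ} {K : Pt d → Pt d → ℝ} {M : ℝ≥0}

lemma Mesh.eLpNorm_inj_proj_le {u : Pt d → ℝ} (hu : MemLp u 2 (muOm d)) :
    eLpNorm (m.inj (m.proj u)) 2 (muOm d) ≤ eLpNorm u 2 (muOm d) := by
  apply le_of_sq_le_sq_ennreal
  rw [eLpNorm_two_sq, eLpNorm_two_sq, m.lintegral_muOm, m.lintegral_muOm]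
  refine Finset.sum_le_sum fun i _ => ?_
  have h : ∫⁻ x in m.cell i, ‖m.inj (m.proj u) x‖ₑ ^ 2 =
      ∫⁻ _ in m.cell i, ‖m.proj u i‖ₑ ^ 2 :=
    setLIntegral_congr_fun (m.measurableSet_cell i) fun x hx => by
      simp only [m.inj_apply _ hx]
  rw [h, setLIntegral_const, mul_comm]
  exact volume_mul_enorm_mean_sq_le (m.vol_pos i) (m.ofReal_vol i)
    (hu.1.mono_measure (Measure.restrict_mono (m.cell_subset i) le_rfl))

lemma IsKernel.proj2_symm (hK : IsKernel K M) (i j : Fin d → Fin n) :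
    m.proj2 K i j = m.proj2 K j i := by
  unfold Mesh.proj2
  rw [mul_comm (m.vol j), Measure.volume_eq_prod, ← setIntegral_prod_swap]
  congr 2
  ext z
  exact hK.symm _ _

lemma IsKernel.proj2_nonneg (hK : IsKernel K M) (i j : Fin d → Fin n) : 0 ≤ m.proj2 K i j := by
  unfold Mesh.proj2
  have := m.vol_pos i
  have := m.vol_pos j
  exact mul_nonneg (by positivity) (integral_nonneg fun z => hK.nonneg _ _)

lemma IsKernel.vol_mul_enorm_proj2_le (hK : IsKernel K M) (i j : Fin d → Fin n) :
    volume (m.cell j) * ‖m.proj2 K i j‖ₑ ≤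
      (volume (m.cell i))⁻¹ * ∫⁻ x in m.cell i, ∫⁻ y in m.cell j, ‖K x y‖ₑ := by
  have hi := m.vol_pos i
  have hj := m.vol_pos j
  have h1 : ‖∫ z in m.cell i ×ˢ m.cell j, K z.1 z.2‖ₑ ≤
      ∫⁻ x in m.cell i, ∫⁻ y in m.cell j, ‖K x y‖ₑ := by
    refine (enorm_integral_le_lintegral_enorm _).trans_eq ?_
    rw [Measure.volume_eq_prod, ← Measure.prod_restrict,
      lintegral_prod (fun z : Pt d × Pt d => ‖K z.1 z.2‖ₑ) hK.meas.enorm.aemeasurable]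
  unfold Mesh.proj2
  rw [enorm_mul, Real.enorm_of_nonneg (by positivity), one_div,
    ENNReal.ofReal_inv_of_pos (by positivity), ENNReal.ofReal_mul hi.le, m.ofReal_vol,
    m.ofReal_vol, ENNReal.mul_inv (Or.inl (m.volume_cell_pos i).ne')
      (Or.inl (m.volume_cell_ne_top i))]
  calc _ = (volume (m.cell j) * (volume (m.cell j))⁻¹) * ((volume (m.cell i))⁻¹ *
        ‖∫ z in m.cell i ×ˢ m.cell j, K z.1 z.2‖ₑ) := by ring
    _ ≤ _ := by
        rw [ENNReal.mul_inv_cancel (m.volume_cell_pos j).ne' (m.volume_cell_ne_top j), one_mul]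
        gcongr

/-- On cell `i`, the `L¹` norm of a row of the averaged kernel is at most the mean over that cell of
`∫ |K(x,y)| dy`. Since `M` is preserved, so is the co-coercivity constant, on every mesh. -/
lemma IsKernel.inj2_proj2 (hK : IsKernel K M) : IsKernel (m.inj2 (m.proj2 K)) M where
  meas := m.measurable_inj2 _
  nonneg x y := by
    unfold Mesh.inj2
    refine Finset.sum_nonneg fun i _ => Finset.sum_nonneg fun j _ => ?_
    exact mul_nonneg (mul_nonneg (hK.proj2_nonneg m i j)
      (indicator_nonneg (fun _ _ => zero_le_one) _)) (indicator_nonneg (fun _ _ => zero_le_one) _)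
  symm x y := by
    unfold Mesh.inj2
    rw [Finset.sum_comm]
    refine Finset.sum_congr rfl fun i _ => Finset.sum_congr rfl fun j _ => ?_
    rw [hK.proj2_symm m j i]
    ring
  bound := by
    refine essSup_le_of_ae_le _ (m.ae_of_cell fun i x hx => ?_)
    have hj : ∀ j, ∫⁻ y in m.cell j, ‖m.inj2 (m.proj2 K) x y‖ₑ =
        volume (m.cell j) * ‖m.proj2 K i j‖ₑ := fun j => by
      rw [setLIntegral_congr_fun (g := fun _ => ‖m.proj2 K i j‖ₑ) (m.measurableSet_cell j)
        (fun y hy => by simp only [m.inj2_apply _ hx hy]), setLIntegral_const, mul_comm]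
    beta_reduce
    rw [eLpNorm_one_eq_lintegral_enorm, m.lintegral_muOm]
    simp only [hj]
    calc ∑ j, volume (m.cell j) * ‖m.proj2 K i j‖ₑ
        ≤ ∑ j, (volume (m.cell i))⁻¹ * ∫⁻ x in m.cell i, ∫⁻ y in m.cell j, ‖K x y‖ₑ :=
          Finset.sum_le_sum fun j _ => hK.vol_mul_enorm_proj2_le m i j
      _ = (volume (m.cell i))⁻¹ * ∫⁻ x in m.cell i, ∫⁻ y, ‖K x y‖ₑ ∂(muOm d) := by
          rw [← Finset.mul_sum, ← lintegral_finsetSum]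
          · simp only [m.lintegral_muOm]
          · intro j _
            exact hK.meas.enorm.lintegral_prod_right'
      _ ≤ (volume (m.cell i))⁻¹ * ∫⁻ _ in m.cell i, (M : ℝ≥0∞) := by
          gcongr 1
          apply lintegral_mono_ae
          exact ae_mono (Measure.restrict_mono (m.cell_subset i) le_rfl) hK.ae_lintegral_le
      _ = M := by
          rw [setLIntegral_const, mul_comm (M : ℝ≥0∞), ← mul_assoc,
            ENNReal.inv_mul_cancel (m.volume_cell_pos i).ne' (m.volume_cell_ne_top i), one_mul]

/-- The step function of a discrete function as an element of `L²(Ω)`. -/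
noncomputable def Mesh.injLp (v : (Fin d → Fin n) → ℝ) : Lp ℝ 2 (muOm d) :=
  (m.memLp_inj v).toLp (m.inj v)

lemma Mesh.coeFn_injLp (v : (Fin d → Fin n) → ℝ) : m.injLp v =ᵐ[muOm d] m.inj v :=
  MemLp.coeFn_toLp _

lemma Mesh.coeFn_plapLp_injLp {A : (Fin d → Fin n) → (Fin d → Fin n) → ℝ}
    (hA : IsKernel (m.inj2 A) M) (hp1 : 1 < p) (hp2 : p ≤ 2) (v : (Fin d → Fin n) → ℝ) :
    plapLp (m.inj2 A) p (m.injLp v) =ᵐ[muOm d] plap (m.inj2 A) p (m.inj v) :=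
  (hA.coeFn_plapLp hp1 hp2 _).trans (plap_congr (m.coeFn_injLp v))

/-- Step functions are invariant under the operator with a piecewise constant kernel, on which it
acts as the discrete one (`Mesh.plap_inj`). -/
lemma IsForwardEuler.isEuler {T : ℝ} {N : ℕ} {θ : TimeGrid T N} {m : Mesh d n}
    {A : (Fin d → Fin n) → (Fin d → Fin n) → ℝ} (hA : IsKernel (m.inj2 A) M) (hp1 : 1 < p)
    (hp2 : p ≤ 2) {b a : (Fin d → Fin n) → ℝ} {u : Fin (N + 1) → (Fin d → Fin n) → ℝ}
    (hu : IsForwardEuler m θ p A b a u) :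
    IsEuler θ (plapLp (m.inj2 A) p) (m.injLp b) (fun k => m.injLp (u k)) := by
  intro k
  have hs := θ.step_pos k
  apply Lp.ext
  set y := plapLp (m.inj2 A) p (m.injLp (u k.castSucc)) with hy
  have hcell : ∀ᵐ x ∂(muOm d), m.inj (u k.succ) x = m.inj (u k.castSucc) x -
      θ.step k * (plap (m.inj2 A) p (m.inj (u k.castSucc)) x - m.inj b x) := by
    refine m.ae_of_cell fun i x hx => ?_
    rw [m.inj_apply _ hx, m.inj_apply _ hx, m.inj_apply _ hx, m.plap_inj A _ hx]
    have := hu.2 k i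
    rw [div_eq_iff hs.ne'] at this
    linarith
  filter_upwards [hcell, m.coeFn_injLp (u k.succ), m.coeFn_injLp (u k.castSucc), m.coeFn_injLp b,
    m.coeFn_plapLp_injLp hA hp1 hp2 (u k.castSucc),
    Lp.coeFn_sub (m.injLp (u k.castSucc)) (θ.step k • (y - m.injLp b)),
    Lp.coeFn_smul (θ.step k) (y - m.injLp b), Lp.coeFn_sub y (m.injLp b)]
    with x h1 h2 h3 h4 h5 h6 h7 h8
  rw [h2, h1, h6, Pi.sub_apply, h7, Pi.smul_apply, h8, Pi.sub_apply, h3, h4, h5, smul_eq_mul]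

lemma existsUnique_isForwardEuler {T : ℝ} {N : ℕ} (θ : TimeGrid T N)
    (A : (Fin d → Fin n) → (Fin d → Fin n) → ℝ) (b a : (Fin d → Fin n) → ℝ) :
    ∃! u, IsForwardEuler m θ p A b a u := by
  have hiff : ∀ (k : Fin N) (x y : (Fin d → Fin n) → ℝ),
      (∀ i, (y i - x i) / θ.step k = -m.plapDisc A p x i + b i) ↔
      y = fun i => x i + θ.step k * (-m.plapDisc A p x i + b i) := by
    intro k x y
    have hs := (θ.step_pos k).ne'
    rw [funext_iff]
    refine forall_congr' fun i => ?_
    rw [div_eq_iff hs]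
    constructor <;> intro h <;> linarith
  refine ⟨fun k => Fin.induction (motive := fun _ => (Fin d → Fin n) → ℝ) a
    (fun k x i => x i + θ.step k * (-m.plapDisc A p x i + b i)) k, ⟨rfl, fun k => ?_⟩, ?_⟩
  · rw [hiff]
    beta_reduce
    rw [Fin.induction_succ]
  · intro v hv
    funext k
    induction k using Fin.induction with
    | zero => exact hv.1
    | succ k ih =>
      rw [(hiff k _ _).1 (hv.2 k), Fin.induction_succ]
      beta_reduce at ih
      rw [← ih]

end Discretization

/-! ### Approximation by cell means on meshes that need not be uniform. -/

section MeshApprox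

open Set Filter
open scoped NNReal

variable {d n : ℕ} (m : Mesh d n)

lemma Mesh.side_le_delta (k : Fin d) (j : Fin n) :
    m.pt k j.succ - m.pt k j.castSucc ≤ m.delta :=
  le_ciSup (Finite.bddAbove_range fun a : Fin d × Fin n =>
    m.pt a.1 a.2.succ - m.pt a.1 a.2.castSucc) (k, j)

lemma Mesh.delta_pos (hd : 1 ≤ d) : 0 < m.delta := by
  have hn : 0 < n := by
    rcases Nat.eq_zero_or_pos n with rfl | hn
    · have h0 := m.pt_zero ⟨0, hd⟩
      have h1 := m.pt_last ⟨0, hd⟩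
      rw [show Fin.last 0 = 0 from rfl, h0] at h1
      norm_num at h1
    · exact hn
  have h := m.side_le_delta ⟨0, hd⟩ ⟨0, hn⟩
  have := m.strictMono ⟨0, hd⟩ (Fin.castSucc_lt_succ (i := ⟨0, hn⟩))
  linarith

lemma Mesh.delta_le_one : m.delta ≤ 1 := by
  refine Real.iSup_le (fun a => ?_) zero_le_one
  linarith [(m.pt_mem a.1 a.2.succ).2, (m.pt_mem a.1 a.2.castSucc).1]

/-- A cube of side `δ_n` in `Ω` that contains a given cell. -/
def Mesh.box (i : Fin d → Fin n) : Set (Pt d) :=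
  -- The corner of the cell is moved down where a cube of side `δ_n` would otherwise leave `Ω`.
  Icc (fun k => min (m.pt k (i k).castSucc) (1 - m.delta))
    (fun k => min (m.pt k (i k).castSucc) (1 - m.delta) + m.delta)

lemma Mesh.volume_box (i : Fin d → Fin n) :
    volume (m.box i) = ENNReal.ofReal m.delta ^ d := by
  rw [Mesh.box, Real.volume_Icc_pi]
  simp

lemma Mesh.box_subset (i : Fin d → Fin n) : m.box i ⊆ Om d := by
  intro x hx
  constructor
  · intro k
    refine le_trans ?_ (hx.1 k)
    exact le_min (m.pt_mem k _).1 (sub_nonneg.2 m.delta_le_one)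
  · intro k
    refine (hx.2 k).trans ?_
    have := min_le_right (m.pt k (i k).castSucc) (1 - m.delta)
    simp only [Pi.one_apply]
    linarith

/-- The cube of translations between points of a cell and of its enlargement. -/
def Mesh.shift : Set (Pt d) := Icc (fun _ => -m.delta) (fun _ => m.delta)

lemma Mesh.volume_shift : volume m.shift = 2 ^ d * ENNReal.ofReal m.delta ^ d := by
  rw [Mesh.shift, Real.volume_Icc_pi]
  simp only [sub_neg_eq_add, Finset.prod_const, Finset.card_univ, Fintype.card_fin]
  rw [← two_mul, ENNReal.ofReal_mul two_pos.le, mul_pow]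
  simp

lemma Mesh.mem_shift {i : Fin d → Fin n} {x w : Pt d} (hx : x ∈ m.cell i)
    (hw : x + w ∈ m.box i) : w ∈ m.shift := by
  simp only [Mesh.cell, mem_univ_pi, mem_Ioc] at hx
  have key : ∀ k, -m.delta ≤ w k ∧ w k ≤ m.delta := by
    intro k
    have h1 := hw.1 k
    have h2 := hw.2 k
    simp only [Pi.add_apply] at h1 h2
    have h3 := hx k
    have h4 := m.side_le_delta k (i k)
    have h5 := (m.pt_mem k (i k).succ).2
    rcases min_cases (m.pt k (i k).castSucc) (1 - m.delta) with ⟨h, -⟩ | ⟨h, h'⟩ <;>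
      rw [h] at h1 h2 <;> constructor <;> linarith
  exact ⟨fun k => (key k).1, fun k => (key k).2⟩

lemma Mesh.sum_sq_le {w : Pt d} (hw : w ∈ m.shift) : ∑ k, w k ^ 2 ≤ d * m.delta ^ 2 := by
  calc ∑ k, w k ^ 2 ≤ ∑ _k : Fin d, m.delta ^ 2 :=
        Finset.sum_le_sum fun k _ => sq_le_sq' (hw.1 k) (hw.2 k)
    _ = d * m.delta ^ 2 := by simp

lemma Mesh.len_lt (hd : 1 ≤ d) {w : Pt d} (hw : w ∈ m.shift) : len w < (d + 1) * m.delta := by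
  have h0 := m.delta_pos hd
  have h1 := m.sum_sq_le hw
  rw [len, Real.sqrt_lt' (by positivity)]
  refine h1.trans_lt ?_
  rw [mul_pow]
  gcongr
  nlinarith [(Nat.cast_nonneg d : (0 : ℝ) ≤ d)]

lemma Mesh.len2_lt (hd : 1 ≤ d) {w : Pt d × Pt d} (hw : w ∈ m.shift ×ˢ m.shift) :
    len2 w < (d + 1) * m.delta := by
  have h0 := m.delta_pos hd
  have h1 := m.sum_sq_le hw.1
  have h2 := m.sum_sq_le hw.2
  rw [len2, Real.sqrt_lt' (by positivity)]
  refine (add_le_add h1 h2).trans_lt ?_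
  rw [mul_pow, ← add_mul]
  gcongr
  nlinarith [(Nat.cast_nonneg d : (0 : ℝ) ≤ d)]

lemma le_ofReal_of_sq_le {a b ρ : ℝ≥0∞} {C D : ℝ} (h : a ^ 2 ≤ 4 * ρ * b ^ 2)
    (hb : b ≤ ENNReal.ofReal D) (hC : 0 ≤ C) (hρ : 4 * ρ = ENNReal.ofReal (C ^ 2)) :
    a ≤ ENNReal.ofReal (C * D) := by
  apply le_of_sq_le_sq_ennreal
  rw [ENNReal.ofReal_mul hC, mul_pow, ← ENNReal.ofReal_pow hC, ← hρ]
  refine h.trans ?_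
  gcongr

/-- Approximation of a Lipschitz function by its mean values over the cells. -/
lemma exists_eLpNorm_inj_proj_sub_le (hd : 1 ≤ d) {s : ℝ} {f : Pt d → ℝ}
    (hf : MemLip len (Om d) s 2 f) :
    ∃ C : ℝ, 0 ≤ C ∧ ∀ (n : ℕ) (m : Mesh d n),
      eLpNorm (fun x => m.inj (m.proj f) x - f x) 2 (muOm d) ≤ ENNReal.ofReal (C * m.delta ^ s) := by
  obtain ⟨c, hc, hmod⟩ := hf.exists_modSmooth_le
  -- `2^(d+1)` is the square root of `4ρ` for `ρ = 4^d`, and `d + 1` converts a displacement with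
  -- coordinates at most `δ_n` into a strict bound of its Euclidean length.
  refine ⟨2 ^ (d + 1) * (c * ((d : ℝ) + 1) ^ s), by positivity, fun n m => ?_⟩
  have hδ := m.delta_pos hd
  have hOm : MeasurableSet (Om d) := measurableSet_Icc
  obtain ⟨f', hf'm, hff'⟩ := hf.1.1.aemeasurable
  have hi : Integrable f (muOm d) := MemLp.integrable one_le_two hf.1
  have hi' : Integrable f' (muOm d) := hi.congr hff'
  have hcell : ∀ i, ∫ y in m.cell i, f y = ∫ y in m.cell i, f' y := fun i =>
    integral_congr_ae (ae_mono (Measure.restrict_mono (m.cell_subset i) le_rfl) hff')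
  have h := eLpNorm_mean_sub_sq_le (ℓ := len) (S := Om d) (F := f') (Q := m.cell) (B := m.box)
    (W := m.shift) (c := m.vol) (Fn := m.inj (m.proj f)) (b := ENNReal.ofReal m.delta ^ d)
    (ρ := 2 ^ d * 2 ^ d) (h := (d + 1) * m.delta) hf'm (m.integrableOn_cell hi') hOm
    m.muOm_eq_sum m.measurableSet_cell m.vol_pos m.ofReal_vol (fun i => measurableSet_Icc)
    m.box_subset m.volume_box (pow_ne_zero _ (by simpa using hδ)) (by simp) measurableSet_Icc
    -- The measures have ratio `2^d`; the larger `4^d` makes `4ρ` a perfect square and is the ratio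
    -- for kernels.
    (m.volume_shift.le.trans (by
      gcongr
      exact le_mul_of_one_le_right' (one_le_pow₀ (by norm_num))))
    (fun w hw => m.len_lt hd hw) (fun i x hx w hw => m.mem_shift hx hw)
    (fun i x hx => by rw [m.inj_apply _ hx, Mesh.proj, hcell])
  rw [← modSmooth_congr hOm hff'] at h
  have e1 : eLpNorm (fun x => m.inj (m.proj f) x - f x) 2 (muOm d) =
      eLpNorm (fun x => m.inj (m.proj f) x - f' x) 2 (volume.restrict (Om d)) := by
    apply eLpNorm_congr_ae
    filter_upwards [hff'] with x hx
    rw [hx]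
  rw [e1]
  refine (le_ofReal_of_sq_le (C := 2 ^ (d + 1)) h (hmod _ (by positivity)) (by positivity)
    ?_).trans_eq ?_
  · rw [ENNReal.ofReal_pow (by positivity), ENNReal.ofReal_pow (by positivity)]
    simp only [ENNReal.ofReal_ofNat]
    ring
  · rw [Real.mul_rpow (by positivity) hδ.le]
    congr 1
    ring

lemma Mesh.muOm2_eq_sum :
    muOm2 d = ∑ ij : (Fin d → Fin n) × (Fin d → Fin n),
      volume.restrict (m.cell ij.1 ×ˢ m.cell ij.2) := by
  have h : ∀ ij : (Fin d → Fin n) × (Fin d → Fin n),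
      (volume.restrict (m.cell ij.1 ×ˢ m.cell ij.2) : Measure (Pt d × Pt d)) =
      (volume.restrict (m.cell ij.1)).prod (volume.restrict (m.cell ij.2)) := fun ij => by
    rw [Measure.volume_eq_prod, Measure.prod_restrict]
  simp only [h]
  rw [muOm2_eq, m.muOm_eq_sum, ← Measure.sum_fintype, ← Measure.sum_fintype, Measure.prod_sum]

/-- Approximation of a Lipschitz kernel by its mean values over the products of cells. -/
lemma exists_eLpNorm_inj2_proj2_sub_le (hd : 1 ≤ d) {s : ℝ} {K : Pt d → Pt d → ℝ}
    (hKm : Measurable (Function.uncurry K))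
    (hK : MemLip len2 (Om d ×ˢ Om d) s 2 (fun z : Pt d × Pt d => K z.1 z.2)) :
    ∃ C : ℝ, 0 ≤ C ∧ ∀ (n : ℕ) (m : Mesh d n),
      eLpNorm (fun z : Pt d × Pt d => m.inj2 (m.proj2 K) z.1 z.2 - K z.1 z.2) 2 (muOm2 d) ≤
        ENNReal.ofReal (C * m.delta ^ s) := by
  obtain ⟨c, hc, hmod⟩ := hK.exists_modSmooth_le
  refine ⟨2 ^ (d + 1) * (c * ((d : ℝ) + 1) ^ s), by positivity, fun n m => ?_⟩
  have hδ := m.delta_pos hd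
  have hOm : MeasurableSet (Om d ×ˢ Om d) := measurableSet_Icc.prod measurableSet_Icc
  have : IsFiniteMeasure (muOm2 d) := by
    rw [muOm2_eq]
    infer_instance
  have : (volume : Measure (Pt d × Pt d)).IsAddLeftInvariant :=
    inferInstanceAs ((volume : Measure (Pt d)).prod volume).IsAddLeftInvariant
  have hi : Integrable (fun z : Pt d × Pt d => K z.1 z.2) (muOm2 d) :=
    MemLp.integrable one_le_two hK.1
  have h := eLpNorm_mean_sub_sq_le (ℓ := len2) (S := Om d ×ˢ Om d)
    (F := fun z : Pt d × Pt d => K z.1 z.2)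
    (Q := fun ij : (Fin d → Fin n) × (Fin d → Fin n) => m.cell ij.1 ×ˢ m.cell ij.2)
    (B := fun ij => m.box ij.1 ×ˢ m.box ij.2)
    (W := m.shift ×ˢ m.shift) (c := fun ij => m.vol ij.1 * m.vol ij.2)
    (Fn := fun z => m.inj2 (m.proj2 K) z.1 z.2)
    (b := ENNReal.ofReal m.delta ^ d * ENNReal.ofReal m.delta ^ d)
    (ρ := 2 ^ d * 2 ^ d) (h := (d + 1) * m.delta) hKm
    (fun ij => IntegrableOn.mono_set hi (prod_mono (m.cell_subset _) (m.cell_subset _))) hOm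
    m.muOm2_eq_sum (fun ij => (m.measurableSet_cell _).prod (m.measurableSet_cell _))
    (fun ij => mul_pos (m.vol_pos _) (m.vol_pos _))
    (fun ij => by
      rw [ENNReal.ofReal_mul (m.vol_pos _).le, m.ofReal_vol, m.ofReal_vol, Measure.volume_eq_prod,
        Measure.prod_prod])
    (fun ij => measurableSet_Icc.prod measurableSet_Icc)
    (fun ij => prod_mono (m.box_subset _) (m.box_subset _))
    (fun ij => by
      rw [Measure.volume_eq_prod, Measure.prod_prod, m.volume_box, m.volume_box])
    (mul_ne_zero (pow_ne_zero _ (by simpa using hδ)) (pow_ne_zero _ (by simpa using hδ)))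
    (ENNReal.mul_ne_top (by simp) (by simp))
    (measurableSet_Icc.prod measurableSet_Icc)
    (by
      rw [Measure.volume_eq_prod, Measure.prod_prod, m.volume_shift]
      apply le_of_eq
      ring)
    (fun w hw => m.len2_lt hd hw)
    (fun ij x hx w hw => ⟨m.mem_shift hx.1 hw.1, m.mem_shift hx.2 hw.2⟩)
    (fun ij x hx => by rw [m.inj2_apply _ hx.1 hx.2, Mesh.proj2])
  refine (le_ofReal_of_sq_le (C := 2 ^ (d + 1)) h (hmod _ (by positivity)) (by positivity)
    ?_).trans_eq ?_
  · rw [ENNReal.ofReal_pow (by positivity), ENNReal.ofReal_pow (by positivity)]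
    simp only [ENNReal.ofReal_ofNat]
    ring
  · rw [Real.mul_rpow (by positivity) hδ.le]
    congr 1
    ring

end MeshApprox

/-! ### Error estimates -/

section Estimates

open Set Filter
open scoped NNReal

variable {d : ℕ} {p : ℝ} {K : Pt d → Pt d → ℝ} {M : ℝ≥0} {T : ℝ} {f g : Pt d → ℝ}

lemma eLpNorm_eq_ofReal_norm {F : Pt d → ℝ} {w : Lp ℝ 2 (muOm d)} (h : F =ᵐ[muOm d] w) :
    eLpNorm F 2 (muOm d) = ENNReal.ofReal ‖w‖ := by
  rw [eLpNorm_congr_ae h, Lp.norm_def, ENNReal.ofReal_toReal (Lp.eLpNorm_ne_top _)]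

lemma eLpNorm_sub_eq_ofReal_norm {F G : Pt d → ℝ} {v w : Lp ℝ 2 (muOm d)}
    (hv : v =ᵐ[muOm d] F) (hw : w =ᵐ[muOm d] G) :
    eLpNorm (fun x => F x - G x) 2 (muOm d) = ENNReal.ofReal ‖v - w‖ := by
  apply eLpNorm_eq_ofReal_norm
  filter_upwards [hv, hw, Lp.coeFn_sub v w] with x h1 h2 h3
  rw [h3, Pi.sub_apply, h1, h2]

lemma Mesh.norm_injLp_proj_le {n : ℕ} (m : Mesh d n) (hf : MemLp f 2 (muOm d)) :
    ‖m.injLp (m.proj f)‖ ≤ ‖hf.toLp f‖ := by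
  have h := m.eLpNorm_inj_proj_le hf
  rw [eLpNorm_eq_ofReal_norm (m.coeFn_injLp _).symm, eLpNorm_eq_ofReal_norm hf.coeFn_toLp.symm] at h
  exact (ENNReal.ofReal_le_ofReal_iff (norm_nonneg _)).1 h

/-- A solution that is a `C¹` curve in `L²(Ω)`. -/
structure IsFlow (p T : ℝ) (K : Pt d → Pt d → ℝ) (f g : Lp ℝ 2 (muOm d))
    (u : ℝ → Lp ℝ 2 (muOm d)) : Prop where
  cont : Continuous u
  init : u 0 = g
  deriv : ∀ t ∈ Icc 0 T, HasDerivAt u (-plapLp K p (u t) + f) t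

lemma IsKernel.exists_isFlow (hK : IsKernel K M) (hM : 0 < M) (hp1 : 1 < p) (hp2 : p ≤ 2)
    (f g : Lp ℝ 2 (muOm d)) (hT : 0 < T) : ∃ u, IsFlow p T K f g u := by
  obtain ⟨u, h1, h2, h3⟩ := (hK.cocoercive hp1 hp2 hM).exists_flow (coerConst_pos hM) hp1 hp2
    (hK.plapLp_zero hp1 hp2) f g hT
  exact ⟨u, h1, h2, h3⟩

lemma IsKernel.isFlow_isSolution (hK : IsKernel K M) (hM : 0 < M) (hp1 : 1 < p) (hp2 : p ≤ 2)
    (hf : MemLp f 2 (muOm d)) (hg : MemLp g 2 (muOm d)) {u : ℝ → Lp ℝ 2 (muOm d)}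
    (hu : IsFlow p T K (hf.toLp f) (hg.toLp g) u) :
    IsSolution p T K (fun _ => f) g (fun t => lpIncl d (u t)) :=
  hK.isSolution_of_flow hp1 hp2 hM hf hg hu.cont hu.init hu.deriv

/-- Error estimate for the scheme, with a general measure `err` of the error in the kernel. -/
theorem IsKernel.error_estimate (hK : IsKernel K M) (hM : 0 < M) (hp1 : 1 < p) (hp2 : p ≤ 2)
    (hf : MemLp f 2 (muOm d)) (hg : MemLp g 2 (muOm d)) {β : ℝ} (hβ : 0 ≤ β)
    {err : (Pt d → Pt d → ℝ) → ℝ≥0∞}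
    (herr : ∀ (T : ℝ) (u : ℝ → Lp ℝ 2 (muOm d)), IsFlow p T K (hf.toLp f) (hg.toLp g) u →
      ∀ K', IsKernel K' M → ∀ ε : ℝ, 0 ≤ ε → err (fun x y => K' x y - K x y) = ENNReal.ofReal ε →
      ∀ t ∈ Icc 0 T, Real.exp (-t) * ‖plapLp K' p (u t) - plapLp K p (u t)‖ ^ 2 ≤ (ε * β) ^ 2)
    {T₀ : ℝ} (hT₀ : 0 < T₀) :
    ∃ C : ℝ, 0 < C ∧ ∀ T : ℝ, 0 < T → (p < 2 ∨ T₀ ≤ T) →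
      ∃ τ₀ : ℝ, 0 < τ₀ ∧ ∀ U, IsSolution p T K (fun _ => f) g U →
      ∀ (n N : ℕ) (m : Mesh d n) (θ : TimeGrid T N) (u : Fin (N + 1) → (Fin d → Fin n) → ℝ),
      IsForwardEuler m θ p (m.proj2 K) (m.proj f) (m.proj g) u → θ.tau ≤ τ₀ →
      ∀ (k : Fin N), ∀ t ∈ Ioc (θ.t k.castSucc) (θ.t k.succ),
        eLpNorm (fun x => m.inj (u k.castSucc) x - U t x) 2 (muOm d) ≤
          ENNReal.ofReal (Real.exp (T / 2)) *
            (eLpNorm (fun x => m.inj (m.proj g) x - g x) 2 (muOm d) +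
              ENNReal.ofReal (C * Real.sqrt T) *
                (ENNReal.ofReal (θ.tau ^ (1 / (3 - p))) +
                  eLpNorm (fun x => m.inj (m.proj f) x - f x) 2 (muOm d) +
                  err (fun x y => m.inj2 (m.proj2 K) x y - K x y))) := by
  obtain ⟨C, hC, hrate⟩ := exists_euler_rate hp1 hp2 (coerConst_pos hM (p := p))
    (norm_nonneg (hg.toLp g)) (norm_nonneg (hf.toLp f)) hβ hT₀ (Lp ℝ 2 (muOm d))
  refine ⟨C, hC, fun T hT hpT => ?_⟩
  obtain ⟨τ₀, hτ₀, hrate⟩ := hrate T hT hpT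
  refine ⟨τ₀, hτ₀, fun U hU n N m θ u hu hτ k t ht => ?_⟩
  -- By uniqueness the given `L¹` solution is the `L²` flow, to which the Hilbert space estimate
  -- applies.
  obtain ⟨v, hv⟩ := hK.exists_isFlow hM hp1 hp2 (hf.toLp f) (hg.toLp g) hT
  have htT : t ∈ Icc 0 T := ⟨(θ.t_mem _).1.trans ht.1.le, ht.2.trans (θ.t_mem _).2⟩
  have hUv : U t = lpIncl d (v t) :=
    hK.isSolution_unique hp1 hp2 hU (hK.isFlow_isSolution hM hp1 hp2 hf hg hv) htT
  have hKn := hK.inj2_proj2 m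
  rcases eq_or_ne (err (fun x y => m.inj2 (m.proj2 K) x y - K x y)) ⊤ with htop | htop
  · have h1 : ENNReal.ofReal (C * Real.sqrt T) ≠ 0 := by
      have : 0 < C * Real.sqrt T := mul_pos hC (Real.sqrt_pos.2 hT)
      simpa using this
    have h2 : ENNReal.ofReal (Real.exp (T / 2)) ≠ 0 := by simp [Real.exp_pos]
    rw [htop, add_top, ENNReal.mul_top h1, add_top, ENNReal.mul_top h2]
    exact le_top
  set ε := (err (fun x y => m.inj2 (m.proj2 K) x y - K x y)).toReal with hε
  have hεe : err (fun x y => m.inj2 (m.proj2 K) x y - K x y) = ENNReal.ofReal ε :=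
    (ENNReal.ofReal_toReal htop).symm
  have hε0 : 0 ≤ ε := ENNReal.toReal_nonneg
  have hx0 : m.injLp (u 0) = m.injLp (m.proj g) := by rw [hu.1]
  have h := hrate N θ (plapLp (m.inj2 (m.proj2 K)) p) (plapLp K p) (m.injLp (m.proj f))
    (hf.toLp f) (fun k => m.injLp (u k)) v ε (hKn.cocoercive hp1 hp2 hM)
    (hKn.plapLp_zero hp1 hp2) (m.norm_injLp_proj_le hf)
    (by rw [hx0]; exact m.norm_injLp_proj_le hg) (hu.isEuler hKn hp1 hp2) hv.deriv hε0
    (herr T v hv _ hKn ε hε0 hεe) hτ k t ht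
  rw [hx0, hv.init] at h
  have hvU : v t =ᵐ[muOm d] U t := by
    rw [hUv]
    exact (coeFn_lpIncl (v t)).symm
  rw [eLpNorm_sub_eq_ofReal_norm (m.coeFn_injLp _) hvU,
    eLpNorm_sub_eq_ofReal_norm (m.coeFn_injLp _) hg.coeFn_toLp,
    eLpNorm_sub_eq_ofReal_norm (m.coeFn_injLp _) hf.coeFn_toLp, hεe]
  have hτγ : 0 ≤ θ.tau ^ (1 / (3 - p)) := Real.rpow_nonneg θ.tau_nonneg _
  rw [← ENNReal.ofReal_add hτγ (norm_nonneg _), ← ENNReal.ofReal_add (by positivity) hε0,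
    ← ENNReal.ofReal_mul (by positivity), ← ENNReal.ofReal_add (norm_nonneg _) (by positivity),
    ← ENNReal.ofReal_mul (by positivity)]
  exact ENNReal.ofReal_le_ofReal h

lemma norm_plapLp_sub_le {K' : Pt d → Pt d → ℝ} (hK : IsKernel K M) (hK' : IsKernel K' M)
    (hp1 : 1 < p) (hp2 : p ≤ 2) (w : Lp ℝ 2 (muOm d)) {ε z : ℝ} (hε : 0 ≤ ε) (hz : 0 ≤ z)
    (h : eLpNorm (fun x => plap K' p w x - plap K p w x) 2 (muOm d) ≤
      ENNReal.ofReal ε * ENNReal.ofReal z) : ‖plapLp K' p w - plapLp K p w‖ ≤ ε * z := by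
  rw [eLpNorm_sub_eq_ofReal_norm (hK'.coeFn_plapLp hp1 hp2 w) (hK.coeFn_plapLp hp1 hp2 w),
    ← ENNReal.ofReal_mul hε] at h
  exact (ENNReal.ofReal_le_ofReal_iff (by positivity)).1 h

/-- Error estimate for square integrable data. -/
theorem IsKernel.error_estimate_normInf (hK : IsKernel K M) (hM : 0 < M) (hp1 : 1 < p)
    (hp2 : p ≤ 2) (hf : MemLp f 2 (muOm d)) (hg : MemLp g 2 (muOm d)) {T₀ : ℝ} (hT₀ : 0 < T₀) :
    ∃ C : ℝ, 0 < C ∧ ∀ T : ℝ, 0 < T → (p < 2 ∨ T₀ ≤ T) →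
      ∃ τ₀ : ℝ, 0 < τ₀ ∧ ∀ U, IsSolution p T K (fun _ => f) g U →
      ∀ (n N : ℕ) (m : Mesh d n) (θ : TimeGrid T N) (u : Fin (N + 1) → (Fin d → Fin n) → ℝ),
      IsForwardEuler m θ p (m.proj2 K) (m.proj f) (m.proj g) u → θ.tau ≤ τ₀ →
      ∀ (k : Fin N), ∀ t ∈ Ioc (θ.t k.castSucc) (θ.t k.succ),
        eLpNorm (fun x => m.inj (u k.castSucc) x - U t x) 2 (muOm d) ≤
          ENNReal.ofReal (Real.exp (T / 2)) *
            (eLpNorm (fun x => m.inj (m.proj g) x - g x) 2 (muOm d) +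
              ENNReal.ofReal (C * Real.sqrt T) *
                (ENNReal.ofReal (θ.tau ^ (1 / (3 - p))) +
                  eLpNorm (fun x => m.inj (m.proj f) x - f x) 2 (muOm d) +
                  normInf (fun x y => m.inj2 (m.proj2 K) x y - K x y) 2)) := by
  -- `β` comes from `(1 + 2‖u‖)² ≤ 2 + 8‖u‖²` and the energy estimate, whose weight `e^{-t}` makes
  -- it independent of `T`.
  refine hK.error_estimate hM hp1 hp2 hf hg (err := fun F => normInf F 2)
    (β := Real.sqrt (2 + 8 * (‖hg.toLp g‖ ^ 2 + ‖hf.toLp f‖ ^ 2))) (by positivity) ?_ hT₀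
  intro T u hu K' hK' ε hε he t ht
  have h1 := eLpNorm_plap_sub_plap_le hK' hK hp1 hp2 (Lp.memLp (u t))
  rw [he, eLpNorm_eq_ofReal_norm (w := u t) ae_eq_rfl] at h1
  have h2 : (1 : ℝ≥0∞) + 2 * ENNReal.ofReal ‖u t‖ = ENNReal.ofReal (1 + 2 * ‖u t‖) := by
    rw [ENNReal.ofReal_add zero_le_one (by positivity), ENNReal.ofReal_mul two_pos.le]
    simp
  rw [h2] at h1
  have h3 := norm_plapLp_sub_le hK hK' hp1 hp2 (u t) hε (by positivity) h1
  have h4 := norm_sq_flow_le (B := plapLp K p) (fun x => by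
    have := (hK.cocoercive hp1 hp2 hM).inner_nonneg (coerConst_pos hM).le x 0
    rwa [hK.plapLp_zero hp1 hp2, sub_zero, sub_zero] at this) hu.deriv ht
  rw [hu.init] at h4
  have h5 : Real.exp (-t) ≤ 1 := Real.exp_le_one_iff.2 (by linarith [ht.1])
  rw [mul_pow, Real.sq_sqrt (by positivity)]
  calc Real.exp (-t) * ‖plapLp K' p (u t) - plapLp K p (u t)‖ ^ 2
      ≤ Real.exp (-t) * (ε * (1 + 2 * ‖u t‖)) ^ 2 := by gcongr
    _ ≤ Real.exp (-t) * (ε ^ 2 * (2 + 8 * ‖u t‖ ^ 2)) := by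
        rw [mul_pow]
        gcongr
        nlinarith [sq_nonneg (1 - 2 * ‖u t‖)]
    _ = ε ^ 2 * (2 * Real.exp (-t) + 8 * (Real.exp (-t) * ‖u t‖ ^ 2)) := by ring
    _ ≤ ε ^ 2 * (2 * 1 + 8 * (‖hg.toLp g‖ ^ 2 + ‖hf.toLp f‖ ^ 2)) := by gcongr
    _ = _ := by ring

lemma ae_abs_le_of_memLp_top (hf : MemLp f ⊤ (muOm d)) :
    ∃ F : ℝ, 0 ≤ F ∧ ∀ᵐ x ∂(muOm d), |f x| ≤ F := by
  refine ⟨(eLpNorm f ⊤ (muOm d)).toReal, ENNReal.toReal_nonneg, ?_⟩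
  filter_upwards [ae_le_eLpNormEssSup (f := f) (μ := muOm d)] with x hx
  rw [← eLpNorm_exponent_top] at hx
  have := ENNReal.toReal_mono hf.eLpNorm_ne_top hx
  rwa [toReal_enorm, Real.norm_eq_abs] at this

/-- The sup bound of the solution grows linearly in time; the exponential weight, through `e^t ≥ 1 +
t + t²/2`, removes this growth from the constant. -/
lemma exp_neg_mul_sq_le {a b t : ℝ} (ht : 0 ≤ t) :
    Real.exp (-t) * (a + t * b) ^ 2 ≤ 2 * a ^ 2 + 4 * b ^ 2 := by
  have h1 := Real.quadratic_le_exp_of_nonneg ht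
  have h2 : (a + t * b) ^ 2 ≤ Real.exp t * (2 * a ^ 2 + 4 * b ^ 2) := by
    have h3 : (1 + t + t ^ 2 / 2) * (2 * a ^ 2 + 4 * b ^ 2) ≤
        Real.exp t * (2 * a ^ 2 + 4 * b ^ 2) := by gcongr
    nlinarith [sq_nonneg (a - t * b), mul_nonneg ht (sq_nonneg a), mul_nonneg ht (sq_nonneg b),
      sq_nonneg (t * a), sq_nonneg b]
  calc Real.exp (-t) * (a + t * b) ^ 2
      ≤ Real.exp (-t) * (Real.exp t * (2 * a ^ 2 + 4 * b ^ 2)) := by gcongr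
    _ = 2 * a ^ 2 + 4 * b ^ 2 := by
        rw [← mul_assoc, ← Real.exp_add]
        simp

/-- Error estimate for bounded data. -/
theorem IsKernel.error_estimate_of_bounded (hK : IsKernel K M) (hM : 0 < M) (hp1 : 1 < p)
    (hp2 : p ≤ 2) (hf : MemLp f ⊤ (muOm d)) (hg : MemLp g ⊤ (muOm d)) {T₀ : ℝ} (hT₀ : 0 < T₀) :
    ∃ C : ℝ, 0 < C ∧ ∀ T : ℝ, 0 < T → (p < 2 ∨ T₀ ≤ T) →
      ∃ τ₀ : ℝ, 0 < τ₀ ∧ ∀ U, IsSolution p T K (fun _ => f) g U →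
      ∀ (n N : ℕ) (m : Mesh d n) (θ : TimeGrid T N) (u : Fin (N + 1) → (Fin d → Fin n) → ℝ),
      IsForwardEuler m θ p (m.proj2 K) (m.proj f) (m.proj g) u → θ.tau ≤ τ₀ →
      ∀ (k : Fin N), ∀ t ∈ Ioc (θ.t k.castSucc) (θ.t k.succ),
        eLpNorm (fun x => m.inj (u k.castSucc) x - U t x) 2 (muOm d) ≤
          ENNReal.ofReal (Real.exp (T / 2)) *
            (eLpNorm (fun x => m.inj (m.proj g) x - g x) 2 (muOm d) +
              ENNReal.ofReal (C * Real.sqrt T) *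
                (ENNReal.ofReal (θ.tau ^ (1 / (3 - p))) +
                  eLpNorm (fun x => m.inj (m.proj f) x - f x) 2 (muOm d) +
                  eLpNorm (fun z : Pt d × Pt d =>
                    m.inj2 (m.proj2 K) z.1 z.2 - K z.1 z.2) 2 (muOm2 d))) := by
  obtain ⟨F, hF0, hF⟩ := ae_abs_le_of_memLp_top hf
  obtain ⟨G, hG0, hG⟩ := ae_abs_le_of_memLp_top hg
  have hf2 : MemLp f 2 (muOm d) := hf.mono_exponent le_top
  have hg2 : MemLp g 2 (muOm d) := hg.mono_exponent le_top
  -- `β` results from `exp_neg_mul_sq_le` applied to `1 + 2(G + tF)`, where `G + tF` is the bound of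
  -- the maximum principle.
  refine hK.error_estimate hM hp1 hp2 hf2 hg2
    (err := fun F => eLpNorm (fun z : Pt d × Pt d => F z.1 z.2) 2 (muOm2 d))
    (β := Real.sqrt (2 * (1 + 2 * G) ^ 2 + 4 * (2 * F) ^ 2)) (by positivity) ?_ hT₀
  intro T u hu K' hK' ε hε he t ht
  have hb : ∀ᵐ x ∂(muOm d), |u t x| ≤ G + t * F := by
    filter_upwards [hK.isSolution_abs_le hp1 hp2
      (hK.isFlow_isSolution hM hp1 hp2 hf2 hg2 hu) hF hG ht, coeFn_lpIncl (u t)] with x h1 h2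
    rwa [h2] at h1
  have h1 := eLpNorm_plap_sub_plap_le_of_bounded hK' hK hp1 hp2 (Lp.memLp (u t)) hb
  rw [he] at h1
  have ht0 : 0 ≤ t := ht.1
  have h3 := norm_plapLp_sub_le hK hK' hp1 hp2 (u t) hε (by positivity) h1
  rw [mul_pow, Real.sq_sqrt (by positivity)]
  calc Real.exp (-t) * ‖plapLp K' p (u t) - plapLp K p (u t)‖ ^ 2
      ≤ Real.exp (-t) * (ε * (1 + 2 * (G + t * F))) ^ 2 := by gcongr
    _ = ε ^ 2 * (Real.exp (-t) * ((1 + 2 * G) + t * (2 * F)) ^ 2) := by ring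
    _ ≤ ε ^ 2 * (2 * (1 + 2 * G) ^ 2 + 4 * (2 * F) ^ 2) := by
        gcongr
        exact exp_neg_mul_sq_le ht0

/-- Boundedness of the iterates on a bounded time interval. -/
theorem IsKernel.exists_eLpNorm_euler_le (hK : IsKernel K M) (hM : 0 < M) (hp1 : 1 < p)
    (hp2 : p ≤ 2) (hf : MemLp f 2 (muOm d)) (hg : MemLp g 2 (muOm d)) (T : ℝ) :
    ∃ B : ℝ, ∀ (n N : ℕ) (m : Mesh d n) (θ : TimeGrid T N)
      (u : Fin (N + 1) → (Fin d → Fin n) → ℝ),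
      IsForwardEuler m θ p (m.proj2 K) (m.proj f) (m.proj g) u →
      ∀ k, eLpNorm (m.inj (u k)) 2 (muOm d) ≤ ENNReal.ofReal B := by
  have hc := coerConst_pos hM (p := p)
  set c := coerConst p M
  set L := 1 + 1 / c + ‖hf.toLp f‖ with hL
  refine ⟨(1 + ‖hg.toLp g‖) * Real.exp (L * T), fun n N m θ u hu k => ?_⟩
  have hKn := hK.inj2_proj2 m
  have hfn := m.norm_injLp_proj_le hf
  have hLv : ∀ v, ‖plapLp (m.inj2 (m.proj2 K)) p v - m.injLp (m.proj f)‖ ≤ L * (1 + ‖v‖) := by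
    intro v
    have h1 := (hKn.cocoercive hp1 hp2 hM).norm_le hc hp1 hp2 (hKn.plapLp_zero hp1 hp2) v
    have h2 := norm_sub_le (plapLp (m.inj2 (m.proj2 K)) p v) (m.injLp (m.proj f))
    have h3 : ‖v‖ / c = 1 / c * ‖v‖ := by ring
    have h4 : 0 ≤ 1 / c := by positivity
    have h5 : 0 ≤ ‖hf.toLp f‖ * ‖v‖ := by positivity
    rw [hL]
    linarith [norm_nonneg v]
  have h := (hu.isEuler hKn hp1 hp2).norm_le hLv k
  rw [eLpNorm_eq_ofReal_norm (m.coeFn_injLp _).symm]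
  apply ENNReal.ofReal_le_ofReal
  have hg' := m.norm_injLp_proj_le hg
  rw [← hu.1] at hg'
  have ht := (θ.t_mem k).2
  have hL0 : 0 ≤ L := by positivity
  calc ‖m.injLp (u k)‖ ≤ (1 + ‖m.injLp (u 0)‖) * Real.exp (L * θ.t k) := by linarith
    _ ≤ (1 + ‖hg.toLp g‖) * Real.exp (L * T) := by gcongr

end Estimates

/-! ### Boundedness under the CFL condition -/

section CFL

open Set Filter
open scoped NNReal

variable {d n N : ℕ} {p : ℝ} {K : Pt d → Pt d → ℝ} {M : ℝ≥0} {T : ℝ} {g : Pt d → ℝ}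
  {m : Mesh d n} {θ : TimeGrid T N}

/-- The power of 2 is at most 1, `√C₂ ≥ 1` carries a negative exponent, and `1 - 1/p ≤ 1/2`. The
right side is the coercivity constant of `IsKernel.inner_self_ge`. -/
lemma cflConst_le {A : Pt d → Pt d → ℝ} (hM : 0 < M) (hA : normInf A 1 = M) (hp1 : 1 < p)
    (hp2 : p ≤ 2) :
    cflConst A p ≤ ENNReal.ofReal (1 / 2 * (M : ℝ) ^ (1 / (1 - p))) := by
  have h1 : ENNReal.ofReal ((2 : ℝ) ^ ((p - 2) / (2 * (p - 1)))) ≤ 1 := by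
    rw [ENNReal.ofReal_le_one]
    exact Real.rpow_le_one_of_one_le_of_nonpos one_le_two
      (div_nonpos_of_nonpos_of_nonneg (by linarith) (by linarith))
  have h2 : (1 : ℝ≥0∞) ≤ ENNReal.ofReal (Real.sqrt (constTwo p)) := by
    rw [ENNReal.one_le_ofReal, Real.one_le_sqrt]
    exact le_max_right _ _
  have h3 : (ENNReal.ofReal (Real.sqrt (constTwo p)) * normInf A 1) ^ (1 / (1 - p)) ≤
      ENNReal.ofReal ((M : ℝ) ^ (1 / (1 - p))) := by
    have h4 : (1 : ℝ) / (1 - p) = -(1 / (p - 1)) := by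
      rw [← neg_sub p 1, div_neg]
    rw [← ENNReal.ofReal_rpow_of_pos (by exact_mod_cast hM), ENNReal.ofReal_coe_nnreal, hA, h4,
      ENNReal.rpow_neg, ENNReal.rpow_neg, ENNReal.inv_le_inv]
    refine ENNReal.rpow_le_rpow ?_ (one_div_nonneg.2 (by linarith))
    simpa using mul_le_mul_left h2 (M : ℝ≥0∞)
  have h5 : 1 - 1 / p ≤ 1 / 2 := by
    have := one_div_le_one_div_of_le (by linarith) hp2
    linarith
  calc cflConst A p ≤ 1 * ENNReal.ofReal ((M : ℝ) ^ (1 / (1 - p))) * ENNReal.ofReal (1 / 2) :=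
        mul_le_mul' (mul_le_mul' h1 h3) (ENNReal.ofReal_le_ofReal h5)
    _ = _ := by
        rw [one_mul, mul_comm, ENNReal.ofReal_mul (by norm_num)]

lemma Mesh.residual_zero_eq {A : (Fin d → Fin n) → (Fin d → Fin n) → ℝ}
    (hA : IsKernel (m.inj2 A) M) (hp1 : 1 < p) (hp2 : p ≤ 2) (v : (Fin d → Fin n) → ℝ) :
    residual m p A 0 v = ENNReal.ofReal ‖plapLp (m.inj2 A) p (m.injLp v)‖ := by
  apply eLpNorm_eq_ofReal_norm
  filter_upwards [m.coeFn_plapLp_injLp hA hp1 hp2 v] with x h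
  simp [h, Mesh.inj]

/-- Under the CFL condition, the `L²(Ω)` norm of the iterates of the homogeneous scheme is bounded
by that of the initial value. -/
theorem IsKernel.eLpNorm_euler_le_of_stepCondition (hK : IsKernel K M) (hp1 : 1 < p) (hp2 : p ≤ 2)
    (hg : MemLp g 2 (muOm d)) {u : Fin (N + 1) → (Fin d → Fin n) → ℝ}
    (hu : IsForwardEuler m θ p (m.proj2 K) 0 (m.proj g) u)
    (hcfl : StepCondition m θ p (m.proj2 K) 0 u) (k : Fin (N + 1)) :
    eLpNorm (m.inj (u k)) 2 (muOm d) ≤ eLpNorm g 2 (muOm d) := by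
  have hKn := hK.inj2_proj2 m
  set Kn := m.inj2 (m.proj2 K) with hKn_def
  -- The CFL constant contains the norm of the projected kernel itself, so coercivity is used with
  -- this exact value in place of the bound `M`.
  obtain ⟨M₁, hM₁⟩ := WithTop.ne_top_iff_exists.1 (hKn.bound.trans_lt ENNReal.coe_lt_top).ne
  have hK₁ : IsKernel Kn M₁ := ⟨hKn.meas, hKn.nonneg, hKn.symm, hM₁.ge⟩
  have h0 : m.injLp 0 = 0 := by
    apply Lp.ext
    filter_upwards [m.coeFn_injLp 0, Lp.coeFn_zero ℝ 2 (muOm d)] with x h1 h2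
    rw [h1, h2]
    simp [Mesh.inj]
  have hE := hu.isEuler hKn hp1 hp2
  rw [h0] at hE
  have hle := hE.norm_le_of_cfl hp1 hp2 (fun j => ?_) k
  · rw [hu.1] at hle
    rw [eLpNorm_eq_ofReal_norm (m.coeFn_injLp _).symm, eLpNorm_eq_ofReal_norm hg.coeFn_toLp.symm]
    exact ENNReal.ofReal_le_ofReal (hle.trans (m.norm_injLp_proj_le hg))
  have hself := hK₁.inner_self_ge hp1 hp2 (m.injLp (u j.castSucc))
  have hres := m.residual_zero_eq hKn hp1 hp2 (u j.castSucc)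
  set r := ‖plapLp Kn p (m.injLp (u j.castSucc))‖ with hr
  have hr0 : 0 ≤ r := norm_nonneg _
  have hp' : 0 < 1 / (p - 1) := one_div_pos.2 (by linarith)
  rcases hr0.eq_or_lt with hr' | hr'
  · exact Or.inl (norm_eq_zero.1 hr'.symm)
  rcases (zero_le (a := M₁)).eq_or_lt with hM | hM
  -- If the projected kernel vanishes, coercivity forces a zero residual, against `0 < r`.
  · have : 0 < r ^ (p / (p - 1)) := Real.rpow_pos_of_pos hr' _
    rw [← hM, NNReal.coe_zero, Real.zero_rpow hp'.ne', zero_mul] at hself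
    linarith
  refine Or.inr ⟨1 / 2 * (M₁ : ℝ) ^ (1 / (1 - p)), ?_, ?_⟩
  · have h := (hcfl j).resolve_left (by rw [hres]; simpa using hr')
    rw [hres, ENNReal.ofReal_rpow_of_nonneg hr0 (div_nonneg (by linarith) (by linarith))] at h
    have h2 := h.trans (mul_le_mul_left (mul_le_mul_right (cflConst_le hM hM₁.symm hp1 hp2) 2) _)
    rw [show (2 : ℝ≥0∞) = ENNReal.ofReal 2 by simp, ← ENNReal.ofReal_mul two_pos.le,
      ← ENNReal.ofReal_mul (by positivity), ENNReal.ofReal_le_ofReal_iff (by positivity)] at h2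
    exact h2
  · have hMr : (0 : ℝ) < M₁ := hM
    have h4 : (1 : ℝ) / (1 - p) = -(1 / (p - 1)) := by
      rw [← neg_sub p 1, div_neg]
    have h5 : (M₁ : ℝ) ^ (1 / (1 - p)) * (M₁ : ℝ) ^ (1 / (p - 1)) = 1 := by
      rw [← Real.rpow_add hMr, h4, neg_add_cancel, Real.rpow_zero]
    have h6 : (0 : ℝ) ≤ (M₁ : ℝ) ^ (1 / (1 - p)) := by positivity
    have h7 := mul_le_mul_of_nonneg_left hself h6
    rw [← mul_assoc (_ ^ _) (_ ^ _) (inner _ _ _), h5, one_mul] at h7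
    linarith

end CFL

/-! ### Restriction of the kernel to the domain -/

section Cut

open Set Filter
open scoped NNReal

variable {d n : ℕ} {p T : ℝ} {K A : Pt d → Pt d → ℝ}

/-- The kernel `K` on `Ω²`, extended by zero. -/
noncomputable def cut (K : Pt d → Pt d → ℝ) (x y : Pt d) : ℝ :=
  (Om d ×ˢ Om d).indicator (Function.uncurry K) (x, y)

lemma cut_eq {x y : Pt d} (hx : x ∈ Om d) (hy : y ∈ Om d) : cut K x y = K x y :=
  indicator_of_mem (mk_mem_prod hx hy) _

lemma ae_mem_Om (d : ℕ) : ∀ᵐ x ∂(muOm d), x ∈ Om d := ae_restrict_mem measurableSet_Icc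

lemma normInf_congr {F G : Pt d → Pt d → ℝ} (h : ∀ x ∈ Om d, ∀ y ∈ Om d, F x y = G x y)
    (q : ℝ≥0∞) : normInf F q = normInf G q := by
  refine essSup_congr_ae ?_
  filter_upwards [ae_mem_Om d] with x hx
  refine eLpNorm_congr_ae ?_
  filter_upwards [ae_mem_Om d] with y hy using h x hx y hy

lemma eLpNorm_muOm2_congr {F G : Pt d → Pt d → ℝ} (h : ∀ x ∈ Om d, ∀ y ∈ Om d, F x y = G x y)
    (q : ℝ≥0∞) : eLpNorm (fun z : Pt d × Pt d => F z.1 z.2) q (muOm2 d) =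
      eLpNorm (fun z : Pt d × Pt d => G z.1 z.2) q (muOm2 d) := by
  refine eLpNorm_congr_ae ?_
  filter_upwards [ae_restrict_mem (measurableSet_Icc.prod measurableSet_Icc)] with z hz
    using h _ hz.1 _ hz.2

lemma Mesh.proj2_cut (m : Mesh d n) : m.proj2 (cut K) = m.proj2 K := by
  ext i j
  unfold Mesh.proj2
  congr 1
  refine setIntegral_congr_fun ((m.measurableSet_cell i).prod (m.measurableSet_cell j)) ?_
  exact fun z hz => cut_eq (m.cell_subset i hz.1) (m.cell_subset j hz.2)

lemma plap_cut {u : Pt d → ℝ} {x : Pt d} (hx : x ∈ Om d) : plap (cut K) p u x = plap K p u x := by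
  unfold plap
  congr 1
  refine integral_congr_ae ?_
  filter_upwards [ae_mem_Om d] with y hy
  rw [cut_eq hx hy]

lemma isSolution_cut {f : ℝ → Pt d → ℝ} {g : Pt d → ℝ} {U : ℝ → Lp ℝ 1 (muOm d)} :
    IsSolution p T (cut K) f g U ↔ IsSolution p T K f g U := by
  unfold IsSolution
  have h : ∀ t (w : Lp ℝ 1 (muOm d)), (∀ᵐ x ∂(muOm d),
      w x = -plap (cut K) p (U t) x + f t x) ↔ ∀ᵐ x ∂(muOm d), w x = -plap K p (U t) x + f t x := by
    intro t w
    refine eventually_congr ?_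
    filter_upwards [ae_mem_Om d] with x hx
    rw [plap_cut hx]
  simp only [h]

/-- Extension by zero makes positivity and symmetry hold everywhere. The summand 1 keeps the bound
positive for a vanishing kernel, so that `coerConst` is positive. -/
lemma isKernel_cut (hKmeas : Measurable (Function.uncurry K))
    (hKpos : ∀ x ∈ Om d, ∀ y ∈ Om d, 0 ≤ K x y)
    (hKsymm : ∀ x ∈ Om d, ∀ y ∈ Om d, K x y = K y x) (hK : normInf K 2 < ⊤) :
    IsKernel (cut K) ((normInf K 1).toNNReal + 1) where
  meas := hKmeas.indicator (measurableSet_Icc.prod measurableSet_Icc)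
  nonneg x y := indicator_nonneg (fun z hz => hKpos _ hz.1 _ hz.2) _
  symm x y := by
    by_cases h : x ∈ Om d ∧ y ∈ Om d
    · rw [cut_eq h.1 h.2, cut_eq h.2 h.1, hKsymm x h.1 y h.2]
    · have h' : ¬(y ∈ Om d ∧ x ∈ Om d) := fun h' => h h'.symm
      simp [cut, indicator, h, h']
  bound := by
    have h : normInf K 1 ≤ normInf K 2 := by
      refine essSup_mono_ae (Eventually.of_forall fun x => ?_)
      exact eLpNorm_le_eLpNorm_of_exponent_le one_le_two
        (hKmeas.comp measurable_prodMk_left).aestronglyMeasurable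
    rw [normInf_congr (fun x hx y hy => cut_eq hx hy), ENNReal.coe_add,
      ENNReal.coe_toNNReal (h.trans_lt hK).ne]
    exact le_self_add

end Cut

end NonlocalPLap

/-! ### Assembly of the results, through the kernel `cut K`. -/

theorem mainTheorem4 (d : ℕ) (hd : 1 ≤ d) (p : ℝ) (hp1 : 1 < p) (hp2 : p ≤ 2)
    (K : Pt d → Pt d → ℝ) (hKmeas : Measurable (Function.uncurry K))
    (hKpos : ∀ x ∈ Om d, ∀ y ∈ Om d, 0 ≤ K x y)
    (hKsymm : ∀ x ∈ Om d, ∀ y ∈ Om d, K x y = K y x)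
    (hK : normInf K 2 < ⊤)
    (f g : Pt d → ℝ) (hf : MemLp f 2 (muOm d)) (hg : MemLp g 2 (muOm d)) :
    -- existence and uniqueness of the solution
    (∀ T : ℝ, 0 < T → ∃ U, IsSolution p T K (fun _ => f) g U ∧
      ∀ V, IsSolution p T K (fun _ => f) g V → ∀ t ∈ Set.Icc 0 T, V t = U t) ∧
    -- the discrete sequence is uniquely defined
    (∀ (T : ℝ) (n N : ℕ) (m : Mesh d n) (θ : TimeGrid T N), 0 < T →
      ∃! u, IsForwardEuler m θ p (m.proj2 K) (m.proj f) (m.proj g) u) ∧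
    -- boundedness
    (∀ (T : ℝ) (n : ℕ) (m : Mesh d n), 0 < T → ∃ B : ℝ, ∀ (N : ℕ) (θ : TimeGrid T N)
      (u : Fin (N + 1) → (Fin d → Fin n) → ℝ),
      IsForwardEuler m θ p (m.proj2 K) (m.proj f) (m.proj g) u →
      StepCondition m θ p (m.proj2 K) (m.proj f) u →
      ∀ k, eLpNorm (m.inj (u k)) 2 (muOm d) ≤ ENNReal.ofReal B) ∧
    -- boundedness uniformly in the discretization if the discrete second member vanishes
    (∃ B : ℝ, ∀ (T : ℝ) (n N : ℕ) (m : Mesh d n) (θ : TimeGrid T N)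
      (u : Fin (N + 1) → (Fin d → Fin n) → ℝ), 0 < T →
      m.proj f = 0 →
      IsForwardEuler m θ p (m.proj2 K) (m.proj f) (m.proj g) u →
      StepCondition m θ p (m.proj2 K) (m.proj f) u →
      ∀ k, eLpNorm (m.inj (u k)) 2 (muOm d) ≤ ENNReal.ofReal B) ∧
    -- error estimate for square integrable data
    (∀ T₀ : ℝ, 0 < T₀ → ∃ C : ℝ, 0 < C ∧ ∀ T : ℝ, 0 < T → (p < 2 ∨ T₀ ≤ T) →
      ∃ τ₀ : ℝ, 0 < τ₀ ∧ ∀ U, IsSolution p T K (fun _ => f) g U →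
      ∀ (n N : ℕ) (m : Mesh d n) (θ : TimeGrid T N) (u : Fin (N + 1) → (Fin d → Fin n) → ℝ),
      IsForwardEuler m θ p (m.proj2 K) (m.proj f) (m.proj g) u →
      StepCondition m θ p (m.proj2 K) (m.proj f) u → θ.tau ≤ τ₀ →
      ∀ (k : Fin N), ∀ t ∈ Set.Ioc (θ.t k.castSucc) (θ.t k.succ),
        eLpNorm (fun x => m.inj (u k.castSucc) x - U t x) 2 (muOm d) ≤
          ENNReal.ofReal (Real.exp (T / 2)) *
            (eLpNorm (fun x => m.inj (m.proj g) x - g x) 2 (muOm d) +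
              ENNReal.ofReal (C * Real.sqrt T) *
                (ENNReal.ofReal (θ.tau ^ (1 / (3 - p))) +
                  eLpNorm (fun x => m.inj (m.proj f) x - f x) 2 (muOm d) +
                  normInf (fun x y => m.inj2 (m.proj2 K) x y - K x y) 2))) ∧
    -- error estimate for bounded data
    (MemLp f ⊤ (muOm d) → MemLp g ⊤ (muOm d) →
      ∀ T₀ : ℝ, 0 < T₀ → ∃ C : ℝ, 0 < C ∧ ∀ T : ℝ, 0 < T → (p < 2 ∨ T₀ ≤ T) →
      ∃ τ₀ : ℝ, 0 < τ₀ ∧ ∀ U, IsSolution p T K (fun _ => f) g U →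
      ∀ (n N : ℕ) (m : Mesh d n) (θ : TimeGrid T N) (u : Fin (N + 1) → (Fin d → Fin n) → ℝ),
      IsForwardEuler m θ p (m.proj2 K) (m.proj f) (m.proj g) u →
      StepCondition m θ p (m.proj2 K) (m.proj f) u → θ.tau ≤ τ₀ →
      ∀ (k : Fin N), ∀ t ∈ Set.Ioc (θ.t k.castSucc) (θ.t k.succ),
        eLpNorm (fun x => m.inj (u k.castSucc) x - U t x) 2 (muOm d) ≤
          ENNReal.ofReal (Real.exp (T / 2)) *
            (eLpNorm (fun x => m.inj (m.proj g) x - g x) 2 (muOm d) +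
              ENNReal.ofReal (C * Real.sqrt T) *
                (ENNReal.ofReal (θ.tau ^ (1 / (3 - p))) +
                  eLpNorm (fun x => m.inj (m.proj f) x - f x) 2 (muOm d) +
                  eLpNorm (fun z : Pt d × Pt d =>
                    m.inj2 (m.proj2 K) z.1 z.2 - K z.1 z.2) 2 (muOm2 d)))) ∧
    -- rate for Lipschitz data
    (∀ s : ℝ, 0 < s → s ≤ 1 →
      MemLp f ⊤ (muOm d) → MemLp g ⊤ (muOm d) →
      MemLip len (Om d) s 2 f → MemLip len (Om d) s 2 g →
      MemLip len2 (Om d ×ˢ Om d) s 2 (fun z : Pt d × Pt d => K z.1 z.2) →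
      ∀ T₀ : ℝ, 0 < T₀ → ∃ C : ℝ, 0 < C ∧ ∀ T : ℝ, 0 < T → (p < 2 ∨ T₀ ≤ T) →
      ∃ τ₀ : ℝ, 0 < τ₀ ∧ ∀ U, IsSolution p T K (fun _ => f) g U →
      ∀ (n N : ℕ) (m : Mesh d n) (θ : TimeGrid T N) (u : Fin (N + 1) → (Fin d → Fin n) → ℝ),
      IsForwardEuler m θ p (m.proj2 K) (m.proj f) (m.proj g) u →
      StepCondition m θ p (m.proj2 K) (m.proj f) u → θ.tau ≤ τ₀ →
      ∀ (k : Fin N), ∀ t ∈ Set.Ioc (θ.t k.castSucc) (θ.t k.succ),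
        eLpNorm (fun x => m.inj (u k.castSucc) x - U t x) 2 (muOm d) ≤
          ENNReal.ofReal (C * Real.exp (T / 2) *
            ((1 + Real.sqrt T) * m.delta ^ s + Real.sqrt T * θ.tau ^ (1 / (3 - p))))) := by
  have hker := isKernel_cut hKmeas hKpos hKsymm hK
  have hM : 0 < (normInf K 1).toNNReal + 1 := by positivity
  have hL2 := fun T₀ (hT₀ : 0 < T₀) => hker.error_estimate_normInf hM hp1 hp2 hf hg hT₀
  have hbdd := fun (hf' : MemLp f ⊤ (muOm d)) (hg' : MemLp g ⊤ (muOm d)) T₀ (hT₀ : 0 < T₀) =>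
    hker.error_estimate_of_bounded hM hp1 hp2 hf' hg' hT₀
  have hnorm : ∀ (n : ℕ) (m : Mesh d n),
      normInf (fun x y => m.inj2 (m.proj2 K) x y - cut K x y) 2 =
        normInf (fun x y => m.inj2 (m.proj2 K) x y - K x y) 2 := fun n m =>
    normInf_congr (fun x hx y hy => by rw [cut_eq hx hy]) 2
  have hnorm2 : ∀ (n : ℕ) (m : Mesh d n),
      eLpNorm (fun z : Pt d × Pt d => m.inj2 (m.proj2 K) z.1 z.2 - cut K z.1 z.2) 2 (muOm2 d) =
        eLpNorm (fun z : Pt d × Pt d => m.inj2 (m.proj2 K) z.1 z.2 - K z.1 z.2) 2 (muOm2 d) :=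
    fun n m => eLpNorm_muOm2_congr
      (F := fun x y => m.inj2 (m.proj2 K) x y - cut K x y)
      (G := fun x y => m.inj2 (m.proj2 K) x y - K x y)
      (fun x hx y hy => by rw [cut_eq hx hy]) 2
  -- Projections, solutions and error norms only see the kernel on `Ω²`, so the estimates for `cut
  -- K` are estimates for `K`.
  simp only [Mesh.proj2_cut, isSolution_cut, hnorm] at hL2
  simp only [Mesh.proj2_cut, isSolution_cut, hnorm2] at hbdd
  refine ⟨fun T hT => ?_, fun T n N m θ _ => existsUnique_isForwardEuler m θ _ _ _,
    fun T n m _ => ?_, ⟨(eLpNorm g 2 (muOm d)).toReal, fun T n N m θ u _ h0 hu hstep k => ?_⟩,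
    fun T₀ hT₀ => ?_, fun hf' hg' T₀ hT₀ => ?_,
    fun s hs _ hf' hg' hfs hgs hKs T₀ hT₀ => ?_⟩
  · obtain ⟨v, hv⟩ := hker.exists_isFlow hM hp1 hp2 (hf.toLp f) (hg.toLp g) hT
    have hsol := hker.isFlow_isSolution hM hp1 hp2 hf hg hv
    exact ⟨_, isSolution_cut.1 hsol, fun V hV t ht =>
      hker.isSolution_unique hp1 hp2 (isSolution_cut.2 hV) hsol ht⟩
  · obtain ⟨B, hB⟩ := hker.exists_eLpNorm_euler_le hM hp1 hp2 hf hg T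
    simp only [Mesh.proj2_cut] at hB
    exact ⟨B, fun N θ u hu _ => hB n N m θ u hu⟩
  · rw [ENNReal.ofReal_toReal hg.eLpNorm_ne_top]
    rw [h0, ← Mesh.proj2_cut] at hu hstep
    exact hker.eLpNorm_euler_le_of_stepCondition hp1 hp2 hg hu hstep k
  · obtain ⟨C, hC, h⟩ := hL2 T₀ hT₀
    refine ⟨C, hC, fun T hT hpT => ?_⟩
    obtain ⟨τ₀, hτ₀, h⟩ := h T hT hpT
    exact ⟨τ₀, hτ₀, fun U hU n N m θ u hu _ => h U hU n N m θ u hu⟩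
  · obtain ⟨C, hC, h⟩ := hbdd hf' hg' T₀ hT₀
    refine ⟨C, hC, fun T hT hpT => ?_⟩
    obtain ⟨τ₀, hτ₀, h⟩ := h T hT hpT
    exact ⟨τ₀, hτ₀, fun U hU n N m θ u hu _ => h U hU n N m θ u hu⟩
  · obtain ⟨C, hC, h⟩ := hbdd hf' hg' T₀ hT₀
    obtain ⟨Cf, hCf, hfn⟩ := exists_eLpNorm_inj_proj_sub_le hd hfs
    obtain ⟨Cg, hCg, hgn⟩ := exists_eLpNorm_inj_proj_sub_le hd hgs
    obtain ⟨CK, hCK, hKn⟩ := exists_eLpNorm_inj2_proj2_sub_le hd hKmeas hKs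
    -- `Cg` accounts for the initial value; `1`, `Cf` and `CK` for time step, source and kernel
    -- under the common constant `C`.
    refine ⟨Cg + C * (1 + Cf + CK), by positivity, fun T hT hpT => ?_⟩
    obtain ⟨τ₀, hτ₀, h⟩ := h T hT hpT
    refine ⟨τ₀, hτ₀, fun U hU n N m θ u hu _ hτ k t ht => ?_⟩
    have hδ : 0 ≤ m.delta ^ s := Real.rpow_nonneg (m.delta_pos hd).le _
    have hγ : 0 ≤ θ.tau ^ (1 / (3 - p)) := Real.rpow_nonneg θ.tau_nonneg _
    have hT' := Real.sqrt_nonneg T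
    refine (h U hU n N m θ u hu hτ k t ht).trans ?_
    refine (mul_le_mul_right (add_le_add (hgn n m) (mul_le_mul_right
      (add_le_add (add_le_add le_rfl (hfn n m)) (hKn n m)) _)) _).trans ?_
    rw [← ENNReal.ofReal_add hγ (by positivity), ← ENNReal.ofReal_add (by positivity)
      (by positivity), ← ENNReal.ofReal_mul (by positivity), ← ENNReal.ofReal_add (by positivity)
      (by positivity), ← ENNReal.ofReal_mul (by positivity)]
    apply ENNReal.ofReal_le_ofReal
    clear h
    generalize m.delta ^ s = D at *
    generalize θ.tau ^ (1 / (3 - p)) = E at *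
    generalize Real.sqrt T = R at *
    have h0 := Real.exp_pos (T / 2)
    have h1 : 0 ≤ Cg * R * D := by positivity
    have h2 : 0 ≤ Cg * R * E := by positivity
    have h3 : 0 ≤ C * (1 + Cf + CK) * D := by positivity
    have h4 : 0 ≤ C * R * D := by positivity
    have h5 : 0 ≤ C * (Cf + CK) * R * E := by positivity
    -- The five terms are exactly the nonnegative surplus of the claimed bound.
    linear_combination Real.exp (T / 2) * (h1 + h2 + h3 + h4 + h5)
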